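/- For a prime $q$ and $\eta\in[0,1]$ let $\mathrm{Ber}_q(\eta)$ be the distribution on $\mathbb F_q$ that returns a uniform element of $\mathbb F_q$ with probability $\eta$ and $0$ otherwise. An instance of $\mathrm{LPN}_{q,\eta,n,m}$ is a pair $(A, b=As+e)$, where $s\in\mathbb F_q^n$ and $A\in\mathbb F_q^{m\times n}$ are uniform and the $m$ entries of $e$ are independent with law $\mathrm{Ber}_q(\eta)$ (all independent of each other). A (randomized) algorithm or oracle $\mathcal A$ solves $\mathrm{LPN}_{q,\eta,n,m}$ with probability $\alpha$ if $\Pr[\mathcal A(A,As+e)=s]\ge\alpha$, the probability being over $s,A,e$ and the randomness of $\mathcal A$ (fresh in every call). Let $H_q(\rho)=\rho\log_q(q-1)-\rho\log_q\rho-(1-\rho)\log_q(1-\rho)$, and let $\log$ be the natural logarithm. **Theorem.** There is a single probabilistic oracle algorithm $\mathcal R$ (using fair coins, given $q,n,m,k$, and dyadic approximations, of any precision it asks for, of the real parameters $\eta,\delta,\varepsilon$) with the following property. Let $q$ be a prime, let $n,m,k$ be positive integers, and let $\eta\in(0,1/8)$ and $\delta,\varepsilon\in(0,1]$ be real numbers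 with $$m>\frac{2}{1-H_q(4\eta)}\,n ,\qquad \frac{192}{\delta}\log\frac{8}{\varepsilon}<k<\frac{\varepsilon}{8}\min\bigl(q^n,e^{\eta m/3}\bigr).$$ If $\mathcal O$ is an oracle that solves $\mathrm{LPN}_{q,\,1-(1-\eta)^k,\,kn,\,m}$ with probability $\varepsilon$, then $\mathcal R^{\mathcal O}$ solves $\mathrm{LPN}_{q,\eta,n,m}$ with probability $1-\delta$. For every choice of these parameters, every oracle, every input $(A,b)\in\mathbb F_q^{m\times n}\times\mathbb F_q^m$ and all outcomes of the randomness, $\mathcal R$ makes at most $\mathrm{poly}(n,k,1/\delta,1/\varepsilon)$ oracle calls, and its running time on a logarithmic-cost random access machine (with an oracle call charged for the length of the query and of the answer) is at most $\mathrm{poly}(n,k,1/\delta,1/\varepsilon,m,\log q)$, for fixed polynomials that do not depend on any of the parameters. -/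

import Mathlib

/-! ## Learning parity with noise over a prime field -/

namespace LPN

/-- The `q`-ary entropy function
`H_q(ρ) = ρ log_q (q - 1) - ρ log_q ρ - (1 - ρ) log_q (1 - ρ)`. -/
noncomputable def entropy (q : ℕ) (ρ : ℝ) : ℝ :=
  ρ * Real.logb q ((q : ℝ) - 1) - ρ * Real.logb q ρ - (1 - ρ) * Real.logb q (1 - ρ)

/-- The probability mass function of `Ber_q(η)`: with probability `η` a uniform element of
`𝔽_q`, and `0` otherwise. -/
noncomputable def berMass (q : ℕ) (η : ℝ) (x : ZMod q) : ℝ :=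
  if x = 0 then (1 - η) + η / q else η / q

/-- For a prime `q` the masses of `Ber_q(η)` add up to one. -/
theorem sum_berMass (q : ℕ) [Fact q.Prime] (η : ℝ) : ∑ x : ZMod q, berMass q η x = 1 := by
  have hq : (q : ℝ) ≠ 0 := Nat.cast_ne_zero.mpr (Fact.out (p := q.Prime)).ne_zero
  have h : ∀ x : ZMod q, berMass q η x = (if x = 0 then 1 - η else 0) + η / q := by
    intro x
    unfold berMass
    split_ifs <;> ring
  simp only [h, Finset.sum_add_distrib, Finset.sum_ite_eq', Finset.mem_univ, if_true,
    Finset.sum_const, Finset.card_univ, ZMod.card, nsmul_eq_mul]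
  field_simp
  ring

/-- A (randomized) solver for search problems with `m` samples in dimension `n`: it maps
`(A, b)` to a distribution on candidate secrets.  Repeated calls use fresh randomness. -/
abbrev Solver (q n m : ℕ) : Type :=
  Matrix (Fin m) (Fin n) (ZMod q) → (Fin m → ZMod q) → PMF (Fin n → ZMod q)

/-- The probability that the solver `𝒜` recovers the secret from an instance of
`LPN_{q,η,n,m}`, that is `Pr[𝒜(A, A s + e) = s]` where `s ∈ 𝔽_q^n` and `A ∈ 𝔽_q^{m × n}` are
uniform, the entries of `e` are independent with law `Ber_q(η)`, and `𝒜` uses its own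
randomness. -/
noncomputable def successProb (q n m : ℕ) [Fact q.Prime] (η : ℝ) (𝒜 : Solver q n m) : ℝ :=
  ∑ s : Fin n → ZMod q, ∑ A : Matrix (Fin m) (Fin n) (ZMod q), ∑ e : Fin m → ZMod q,
    (1 / (q : ℝ) ^ n) * (1 / (q : ℝ) ^ (m * n)) * (∏ i, berMass q η (e i)) *
      (𝒜 A (A.mulVec s + e) s).toReal

/-! ## Randomized oracle programs with a bit-cost running time

A random access machine whose cells hold natural numbers.  Programs are built from
assignments, conditionals and bounded loops, so they always halt.  They can toss fair coins,
call an oracle on a block of cells, and read dyadic approximations of three real parameters.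
The time charged is logarithmic: every access to a number or an address costs its bit length. -/

/-- Contents of the memory. -/
abbrev Mem : Type := ℕ → ℕ

/-- Binary operations on natural numbers; `sub` is truncated and `lt` returns `0` or `1`. -/
inductive BinOp : Type
  | add | sub | mul | div | mod | lt

/-- The value of a binary operation. -/
def BinOp.eval : BinOp → ℕ → ℕ → ℕ
  | .add, x, y => x + y
  | .sub, x, y => x - y
  | .mul, x, y => x * y
  | .div, x, y => x / y
  | .mod, x, y => x % y
  | .lt, x, y => if x < y then 1 else 0

/-- Expressions: constants, the cell with a computed address, bit length, binary operations. -/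
inductive Expr : Type
  | const (c : ℕ)
  | load (addr : Expr)
  | size (e : Expr)
  | op (o : BinOp) (e₁ e₂ : Expr)

/-- The value of an expression. -/
def Expr.eval (μ : Mem) : Expr → ℕ
  | .const c => c
  | .load a => μ (a.eval μ)
  | .size e => Nat.size (e.eval μ)
  | .op o e₁ e₂ => o.eval (e₁.eval μ) (e₂.eval μ)

/-- The time charged for evaluating an expression. -/
def Expr.cost (μ : Mem) : Expr → ℕ
  | .const c => Nat.size c + 1
  | .load a => a.cost μ + Nat.size (a.eval μ) + Nat.size (μ (a.eval μ)) + 1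
  | .size e => e.cost μ + Nat.size (e.eval μ) + 1
  | .op _ e₁ e₂ => e₁.cost μ + e₂.cost μ + Nat.size (e₁.eval μ) + Nat.size (e₂.eval μ) + 1

/-- Programs.
* `store addr val`: write the value of `val` into the cell `addr`;
* `ite c P Q`: run `P` if `c` is nonzero, and `Q` otherwise;
* `loop count P`: evaluate `count` once and run `P` that many times;
* `rand addr bits`: toss `bits` fair coins and store them as a number below `2 ^ bits`;
* `approx i addr prec`: store the integer part of `2 ^ prec` times the `i`-th real parameter;
* `query src len dst`: send the `len` cells from `src` on to the oracle, and write its answer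
  into the cells from `dst` on. -/
inductive Prog : Type
  | skip
  | store (addr val : Expr)
  | seq (P Q : Prog)
  | ite (c : Expr) (P Q : Prog)
  | loop (count : Expr) (P : Prog)
  | rand (addr bits : Expr)
  | approx (i : Fin 3) (addr prec : Expr)
  | query (src len dst : Expr)

/-- Memory, time used so far, and number of oracle calls so far. -/
structure State : Type where
  mem : Mem
  time : ℕ
  queries : ℕ

/-- Let time pass. -/
def State.tick (σ : State) (c : ℕ) : State := { σ with time := σ.time + c }

/-- Write `v` into the cell `a`, charging for the access. -/
def State.write (σ : State) (a v : ℕ) : State :=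
  { σ with mem := Function.update σ.mem a v, time := σ.time + (Nat.size a + Nat.size v + 1) }

/-- Write the list `l` into the cells `a, a + 1, …`. -/
def State.writeList (σ : State) (a : ℕ) : List ℕ → State
  | [] => σ
  | v :: l => (σ.write a v).writeList (a + 1) l

/-- The contents of the `len` cells from `a` on. -/
def Mem.block (μ : Mem) (a len : ℕ) : List ℕ := (List.range len).map fun i => μ (a + i)

/-- The time charged for reading the `len` cells from `a` on. -/
def Mem.blockCost (μ : Mem) (a len : ℕ) : ℕ :=
  ∑ i ∈ Finset.range len, (Nat.size (a + i) + Nat.size (μ (a + i)) + 1)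

/-- Run a randomized state transformer a given number of times. -/
noncomputable def iterate (f : State → PMF State) : ℕ → State → PMF State
  | 0, σ => PMF.pure σ
  | N + 1, σ => (f σ).bind (iterate f N)

/-- An oracle on lists of numbers, with a randomized answer. -/
abbrev Oracle : Type := List ℕ → PMF (List ℕ)

/-- The law of the state after running a program, for the real parameters `r` and the oracle
`𝒪`. -/
noncomputable def Prog.exec (r : Fin 3 → ℝ) (𝒪 : Oracle) : Prog → State → PMF State
  | .skip, σ => PMF.pure (σ.tick 1)
  | .store addr val, σ =>
      PMF.pure ((σ.tick (addr.cost σ.mem + val.cost σ.mem)).write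
        (addr.eval σ.mem) (val.eval σ.mem))
  | .seq P Q, σ => (P.exec r 𝒪 σ).bind (Q.exec r 𝒪)
  | .ite c P Q, σ =>
      if c.eval σ.mem ≠ 0 then P.exec r 𝒪 (σ.tick (c.cost σ.mem + 1))
      else Q.exec r 𝒪 (σ.tick (c.cost σ.mem + 1))
  | .loop count P, σ =>
      iterate (fun τ => P.exec r 𝒪 (τ.tick 1)) (count.eval σ.mem)
        (σ.tick (count.cost σ.mem + 1))
  | .rand addr bits, σ =>
      (PMF.uniformOfFintype (Fin (2 ^ bits.eval σ.mem))).map fun v =>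
        (σ.tick (addr.cost σ.mem + bits.cost σ.mem + bits.eval σ.mem)).write
          (addr.eval σ.mem) v
  | .approx i addr prec, σ =>
      PMF.pure ((σ.tick (addr.cost σ.mem + prec.cost σ.mem + prec.eval σ.mem)).write
        (addr.eval σ.mem) ⌊2 ^ prec.eval σ.mem * r i⌋₊)
  | .query src len dst, σ =>
      (𝒪 (σ.mem.block (src.eval σ.mem) (len.eval σ.mem))).map fun ans =>
        let τ := σ.tick (src.cost σ.mem + len.cost σ.mem + dst.cost σ.mem +
          σ.mem.blockCost (src.eval σ.mem) (len.eval σ.mem) + 1)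
        State.writeList { τ with queries := τ.queries + 1 } (dst.eval σ.mem) ans

/-! ## Encodings -/

/-- The list of the entries of `A`, row by row, followed by those of `b`. -/
def encode {q n m : ℕ} (A : Matrix (Fin m) (Fin n) (ZMod q)) (b : Fin m → ZMod q) : List ℕ :=
  (List.ofFn fun p : Fin (m * n) => (A p.divNat p.modNat).val) ++ List.ofFn fun i => (b i).val

/-- A solver as an oracle for programs: on a list of length `m * n + m` it reads the first
`m * n` numbers modulo `q` as the rows of `A` and the others as `b`, and answers with the `n`
entries of the solver's output; on lists of another length it answers with the empty list. -/
noncomputable def Solver.toOracle {q n m : ℕ} (𝒮 : Solver q n m) : Oracle := fun w =>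
  if w.length = m * n + m then
    (𝒮 (fun i j => (w.getD (i * n + j) 0 : ZMod q)) (fun i => (w.getD (m * n + i) 0 : ZMod q))).map
      fun z => List.ofFn fun j => (z j).val
  else PMF.pure []

/-- The law of the final state of the program `P` with oracle `𝒪`, started on `q, n, m, k` and
the instance `(A, b)`, with real parameters `η, δ, ε`. -/
noncomputable def runOn (P : Prog) {q n m : ℕ} (k : ℕ) (η δ ε : ℝ) (𝒪 : Oracle)
    (A : Matrix (Fin m) (Fin n) (ZMod q)) (b : Fin m → ZMod q) : PMF State :=
  P.exec ![η, δ, ε] 𝒪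
    { mem := fun a => (q :: n :: m :: k :: encode A b).getD a 0, time := 0, queries := 0 }

/-- The solver computed by the program `P` with oracle `𝒪`: its output is found in the cells
`0, …, n - 1`, modulo `q`. -/
noncomputable def Prog.toSolver (P : Prog) {q n m : ℕ} (k : ℕ) (η δ ε : ℝ) (𝒪 : Oracle) :
    Solver q n m := fun A b =>
  (runOn P k η δ ε 𝒪 A b).map fun σ i => (σ.mem i : ZMod q)

end LPN

/-! Put the matrices of `k` LPN instances side by side and add their right hand sides. The result is
an instance of dimension `kn` with noise rate `1 - (1 - η)^k`, since a sum of `Ber_q(η)` variables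
is uniform as soon as one summand is (`sum_jointSuccess`). The given instance is therefore hidden at
a random position among `k - 1` fresh ones. The right hand side is shifted by the joint matrix times
a random vector, which makes the joint secret uniform for every `s`. The planted block of the
oracle's answer, minus the shift, is a candidate for `s`.

The oracle is good only on average over the whole tuple, while repetition needs a good chance for
the fixed planted `(A, e)`. This is the direct product lemma `sum_planted_small`. Suppose that the
instances whose planted success is at most `ε/8` have weight `μ > δ/2`. By a Chernoff bound a random
tuple contains `μk/4` of them except with probability `exp(-μk/4) ≤ ε/8`. By resampling one
coordinate, the success weighted by the number of such members is at most `kμε/8`, so tuples with at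
least `μk/4` of them contribute at most `ε/2`. Together this is less than `ε`.

The right candidate can be recognised. The noise has weight at most `2ηm` up to probability
`exp(-ηm/3)` (`sum_heavy_noise`), and no nonzero codeword of `A` has weight at most `4ηm` up to
probability `q^(-n)` (`sum_light_codeword`). Then `s` is the only vector with so few violated
samples (`eq_of_violations_le`), so keeping the best candidate never loses it.

The program has only fair coins and a dyadic approximation of `η`. Replacing the ideal sampling by
what it can do costs at most half of the success probability (`plantedProb_le_hitProb`). A trial
thus succeeds with probability at least `ε/16`, and at least `16k/ε` trials all fail with
probability at most `exp(-k)` (`le_toSolver_apply`). The losses add up to at most `δ` in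
`one_sub_le_successProb`.

For the machine model, all parts of the program except the coins and the oracle call are
deterministic. They are handled by a calculus `wp` that gives the final memory together with a time
bound, `Prog.bound`, which for a fixed program is polynomial in the bit length `S` of the cells and
a bound `N` on loop counts and block lengths. The law of a trial is then an explicit image of the
law of coins and answer (`exec_trial`), and `exec_reduction` combines the trials. -/

namespace LPN

/-! ### Syntactic bounds on values and running times -/

/-- A syntactic weight that controls the bit length of the value of an expression. -/
def Expr.wt : Expr → ℕ
  | .const c => Nat.size c + 1
  | .load a => a.wt + 1
  | .size e => e.wt
  | .op _ e₁ e₂ => e₁.wt + e₂.wt + 1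

/-- A syntactic weight that controls the cost of evaluating an expression. -/
def Expr.cw : Expr → ℕ
  | .const c => Nat.size c + 1
  | .load a => a.cw + a.wt + 2
  | .size e => e.cw + e.wt + 1
  | .op _ e₁ e₂ => e₁.cw + e₂.cw + e₁.wt + e₂.wt + 1

/-- All cells hold numbers of at most `S` bits. -/
def Bdd (S : ℕ) (μ : Mem) : Prop := ∀ a, μ a < 2 ^ S

theorem Bdd.size_le {S : ℕ} {μ : Mem} (h : Bdd S μ) (a : ℕ) : Nat.size (μ a) ≤ S :=
  Nat.size_le.mpr (h a)

theorem Bdd.update {S : ℕ} {μ : Mem} (h : Bdd S μ) (a : ℕ) {v : ℕ} (hv : v < 2 ^ S) :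
    Bdd S (Function.update μ a v) := by
  intro b
  by_cases hb : b = a
  · subst hb; simpa using hv
  · simpa [Function.update_of_ne hb] using h b

theorem size_add_le (x y : ℕ) : Nat.size (x + y) ≤ Nat.size x + Nat.size y + 1 := by
  rw [Nat.size_le]
  have hx := Nat.lt_size_self x
  have hy := Nat.lt_size_self y
  have h1 : 2 ^ x.size ≤ 2 ^ (x.size + y.size) := Nat.pow_le_pow_right (by norm_num) (by omega)
  have h2 : 2 ^ y.size ≤ 2 ^ (x.size + y.size) := Nat.pow_le_pow_right (by norm_num) (by omega)
  rw [pow_succ]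
  omega

theorem size_mul_le (x y : ℕ) : Nat.size (x * y) ≤ Nat.size x + Nat.size y := by
  rw [Nat.size_le, pow_add]
  exact Nat.mul_lt_mul'' (Nat.lt_size_self x) (Nat.lt_size_self y)

theorem size_le_self (x : ℕ) : Nat.size x ≤ x := Nat.size_le.mpr Nat.lt_two_pow_self

theorem BinOp.size_eval_le (o : BinOp) (x y : ℕ) :
    Nat.size (o.eval x y) ≤ Nat.size x + Nat.size y + 1 := by
  cases o
  · exact size_add_le x y
  · exact (Nat.size_le_size (Nat.sub_le x y)).trans (by omega)
  · exact (size_mul_le x y).trans (by omega)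
  · exact (Nat.size_le_size (Nat.div_le_self x y)).trans (by omega)
  · exact (Nat.size_le_size (Nat.mod_le x y)).trans (by omega)
  · simp only [BinOp.eval]
    split_ifs
    · simp
    · simp

theorem Expr.size_eval_le {S : ℕ} {μ : Mem} (h : Bdd S μ) (e : Expr) :
    Nat.size (e.eval μ) ≤ e.wt * (S + 1) := by
  induction e with
  | const c => simp only [Expr.eval, Expr.wt]; nlinarith [Nat.zero_le (c.size * S)]
  | load a _ => simp only [Expr.eval, Expr.wt]; nlinarith [h.size_le (a.eval μ), Nat.zero_le (a.wt * (S+1))]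
  | size e ih => exact (size_le_self _).trans ih
  | op o e₁ e₂ ih₁ ih₂ =>
    simp only [Expr.eval, Expr.wt]
    have := o.size_eval_le (e₁.eval μ) (e₂.eval μ)
    nlinarith

theorem Expr.cost_le {S : ℕ} {μ : Mem} (h : Bdd S μ) (e : Expr) :
    e.cost μ ≤ e.cw * (S + 1) := by
  induction e with
  | const c => simp only [Expr.cost, Expr.cw]; nlinarith [Nat.zero_le (c.size * S)]
  | load a ih =>
    simp only [Expr.cost, Expr.cw]
    nlinarith [h.size_le (a.eval μ), a.size_eval_le h]
  | size e ih => simp only [Expr.cost, Expr.cw]; nlinarith [e.size_eval_le h]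
  | op o e₁ e₂ ih₁ ih₂ =>
    simp only [Expr.cost, Expr.cw]
    nlinarith [e₁.size_eval_le h, e₂.size_eval_le h]

/-- A bound on the running time of a program all of whose cells have at most `S` bits, and all
of whose loop counts, numbers of coins, precisions and block lengths are at most `N`. -/
def Prog.bound (S N : ℕ) : Prog → ℕ
  | .skip => 1
  | .store a v => (a.cw + v.cw + a.wt + 1) * (S + 1)
  | .seq P Q => P.bound S N + Q.bound S N
  | .ite c P Q => (c.cw + 1) * (S + 1) + P.bound S N + Q.bound S N
  | .loop c P => (c.cw + 1) * (S + 1) + N * (P.bound S N + 1)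
  | .rand a b => (a.cw + b.cw + a.wt + 1) * (S + 1) + N
  | .approx _ a b => (a.cw + b.cw + a.wt + 1) * (S + 1) + N
  | .query s l d => (s.cw + l.cw + d.cw + 1) * (S + 1) +
      2 * (N * ((s.wt + d.wt + 1) * (S + 1) + N + 1))

/-- One number serves both as coefficient and as exponent. Sums, and the extra factor `N` of each
loop, are absorbed by enlarging it, so structural induction goes through. -/
theorem Prog.exists_bound_le (P : Prog) :
    ∃ C : ℕ, ∀ S N, P.bound S N ≤ C * (S + N + 1) ^ C := by
  have key : ∀ S N a b : ℕ, a ≤ b → (S + N + 1) ^ a ≤ (S + N + 1) ^ b := fun S N a b h =>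
    Nat.pow_le_pow_right (by omega) h
  have lin : ∀ S N w C : ℕ, 1 ≤ C → w * (S + 1) ≤ w * (S + N + 1) ^ C := fun S N w C hC =>
    Nat.mul_le_mul_left _
      ((by rw [pow_one]; omega : S + 1 ≤ (S + N + 1) ^ 1).trans (key S N 1 C hC))
  induction P with
  | skip => exact ⟨1, fun S N => by simp [Prog.bound]⟩
  | store a v =>
    refine ⟨a.cw + v.cw + a.wt + 1, fun S N => lin _ _ _ _ (by omega)⟩
  | seq P Q ihP ihQ =>
    obtain ⟨C, hC⟩ := ihP
    obtain ⟨C', hC'⟩ := ihQ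
    refine ⟨C + C', fun S N => ?_⟩
    simp only [Prog.bound]
    have h1 := (hC S N).trans (Nat.mul_le_mul_left C (key S N C (C + C') (by omega)))
    have h2 := (hC' S N).trans (Nat.mul_le_mul_left C' (key S N C' (C + C') (by omega)))
    nlinarith
  | ite c P Q ihP ihQ =>
    obtain ⟨C, hC⟩ := ihP
    obtain ⟨C', hC'⟩ := ihQ
    refine ⟨c.cw + 1 + C + C', fun S N => ?_⟩
    simp only [Prog.bound]
    have h0 := lin S N (c.cw + 1) (c.cw + 1 + C + C') (by omega)
    have h1 := (hC S N).trans (Nat.mul_le_mul_left C (key S N C (c.cw + 1 + C + C') (by omega)))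
    have h2 := (hC' S N).trans (Nat.mul_le_mul_left C' (key S N C' (c.cw + 1 + C + C') (by omega)))
    nlinarith
  | loop c P ihP =>
    obtain ⟨C, hC⟩ := ihP
    refine ⟨c.cw + 1 + C + 1, fun S N => ?_⟩
    simp only [Prog.bound]
    have h0 := lin S N (c.cw + 1) (c.cw + 1 + C + 1) (by omega)
    have h1 : N * (P.bound S N + 1) ≤ (C + 1) * (S + N + 1) ^ (c.cw + 1 + C + 1) := by
      calc N * (P.bound S N + 1) ≤ (S + N + 1) * (C * (S + N + 1) ^ C + (S + N + 1) ^ C) :=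
            Nat.mul_le_mul (by omega) (Nat.add_le_add (hC S N) (Nat.one_le_pow _ _ (by omega)))
        _ = (C + 1) * (S + N + 1) ^ (C + 1) := by ring
        _ ≤ _ := Nat.mul_le_mul_left _ (key S N _ _ (by omega))
    nlinarith
  | rand a b =>
    refine ⟨a.cw + b.cw + a.wt + 1 + 1, fun S N => ?_⟩
    simp only [Prog.bound]
    have h0 := lin S N (a.cw + b.cw + a.wt + 1) (a.cw + b.cw + a.wt + 1 + 1) (by omega)
    have h1 := key S N 1 (a.cw + b.cw + a.wt + 1 + 1) (by omega)
    rw [pow_one] at h1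
    nlinarith
  | approx i a b =>
    refine ⟨a.cw + b.cw + a.wt + 1 + 1, fun S N => ?_⟩
    simp only [Prog.bound]
    have h0 := lin S N (a.cw + b.cw + a.wt + 1) (a.cw + b.cw + a.wt + 1 + 1) (by omega)
    have h1 := key S N 1 (a.cw + b.cw + a.wt + 1 + 1) (by omega)
    rw [pow_one] at h1
    nlinarith
  | query s l d =>
    refine ⟨(s.cw + l.cw + d.cw + 1) + 2 * (s.wt + d.wt + 2), fun S N => ?_⟩
    simp only [Prog.bound]
    have h0 := lin S N (s.cw + l.cw + d.cw + 1) ((s.cw + l.cw + d.cw + 1) + 2 * (s.wt + d.wt + 2))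
      (by omega)
    have h1 : 2 * (N * ((s.wt + d.wt + 1) * (S + 1) + N + 1)) ≤
        (2 * (s.wt + d.wt + 2)) *
          (S + N + 1) ^ ((s.cw + l.cw + d.cw + 1) + 2 * (s.wt + d.wt + 2)) := by
      calc 2 * (N * ((s.wt + d.wt + 1) * (S + 1) + N + 1))
          ≤ 2 * ((S + N + 1) * ((s.wt + d.wt + 1) * (S + N + 1) + (S + N + 1))) := by
            have h : (s.wt + d.wt + 1) * (S + 1) ≤ (s.wt + d.wt + 1) * (S + N + 1) :=
              Nat.mul_le_mul_left _ (by omega)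
            exact Nat.mul_le_mul_left 2 (Nat.mul_le_mul (by omega) (by omega))
        _ = 2 * (s.wt + d.wt + 2) * (S + N + 1) ^ 2 := by ring
        _ ≤ _ := Nat.mul_le_mul_left _ (key S N _ _ (by omega))
    nlinarith

/-! ### A weakest precondition calculus for deterministic programs -/

section WP

variable {r : Fin 3 → ℝ} {𝒪 : Oracle} {S N : ℕ}

/-- From a memory `μ` of bounded cells, the program `P` deterministically reaches a memory of
bounded cells with the property `Q`, within the time `P.bound S N`. -/
def wp (r : Fin 3 → ℝ) (𝒪 : Oracle) (S N : ℕ) (P : Prog) (Q : Mem → Prop) (μ : Mem) : Prop :=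
  Bdd S μ → ∃ μ', Q μ' ∧ Bdd S μ' ∧ ∀ t c, ∃ t', t' ≤ t + P.bound S N ∧
    P.exec r 𝒪 ⟨μ, t, c⟩ = PMF.pure ⟨μ', t', c⟩

theorem wp_mono {P : Prog} {Q Q' : Mem → Prop} {μ : Mem} (h : wp r 𝒪 S N P Q μ)
    (hQ : ∀ μ', Q μ' → Q' μ') : wp r 𝒪 S N P Q' μ := by
  intro hb
  obtain ⟨μ', h1, h2, h3⟩ := h hb
  exact ⟨μ', hQ _ h1, h2, h3⟩

theorem wp_skip {Q : Mem → Prop} {μ : Mem} (h : Q μ) : wp r 𝒪 S N .skip Q μ := fun hb =>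
  ⟨μ, h, hb, fun t _ => ⟨t + 1, le_rfl, rfl⟩⟩

theorem wp_store {a v : Expr} {Q : Mem → Prop} {μ : Mem}
    (hv : Bdd S μ → v.eval μ < 2 ^ S) (h : Q (Function.update μ (a.eval μ) (v.eval μ))) :
    wp r 𝒪 S N (.store a v) Q μ := by
  intro hb
  refine ⟨_, h, hb.update _ (hv hb), fun t c => ⟨_, ?_, rfl⟩⟩
  have h1 := a.cost_le hb
  have h2 := v.cost_le hb
  have h3 := a.size_eval_le hb
  have h4 : Nat.size (v.eval μ) ≤ S := Nat.size_le.mpr (hv hb)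
  simp only [State.tick, Prog.bound]
  nlinarith

theorem wp_seq {P R : Prog} {Q : Mem → Prop} {μ : Mem}
    (h : wp r 𝒪 S N P (fun μ' => wp r 𝒪 S N R Q μ') μ) : wp r 𝒪 S N (.seq P R) Q μ := by
  intro hb
  obtain ⟨μ₁, h1, hb1, h2⟩ := h hb
  obtain ⟨μ₂, h3, hb2, h4⟩ := h1 hb1
  refine ⟨μ₂, h3, hb2, fun t c => ?_⟩
  obtain ⟨t₁, ht1, he1⟩ := h2 t c
  obtain ⟨t₂, ht2, he2⟩ := h4 t₁ c
  refine ⟨t₂, ?_, ?_⟩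
  · simp only [Prog.bound]; omega
  · simp only [Prog.exec, he1, PMF.pure_bind, he2]

theorem wp_ite {c : Expr} {P R : Prog} {Q : Mem → Prop} {μ : Mem}
    (h1 : c.eval μ ≠ 0 → wp r 𝒪 S N P Q μ) (h2 : c.eval μ = 0 → wp r 𝒪 S N R Q μ) :
    wp r 𝒪 S N (.ite c P R) Q μ := by
  intro hb
  have hc := c.cost_le hb
  by_cases h : c.eval μ = 0
  · obtain ⟨μ', hq, hb', he⟩ := h2 h hb
    refine ⟨μ', hq, hb', fun t d => ?_⟩
    obtain ⟨t', ht, he⟩ := he (t + (c.cost μ + 1)) d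
    refine ⟨t', ?_, ?_⟩
    · simp only [Prog.bound]; nlinarith
    · simpa [Prog.exec, h, State.tick] using he
  · obtain ⟨μ', hq, hb', he⟩ := h1 h hb
    refine ⟨μ', hq, hb', fun t d => ?_⟩
    obtain ⟨t', ht, he⟩ := he (t + (c.cost μ + 1)) d
    refine ⟨t', ?_, ?_⟩
    · simp only [Prog.bound]; nlinarith
    · simpa [Prog.exec, h, State.tick] using he

/-- `iterate` peels off the first round, but invariants are carried forward and need the last one.
-/
theorem iterate_succ' (f : State → PMF State) (M : ℕ) (σ : State) :
    iterate f (M + 1) σ = (iterate f M σ).bind f := by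
  induction M generalizing σ with
  | zero => simp [iterate]
  | succ M ih =>
    rw [iterate]
    conv_rhs => rw [iterate]
    rw [PMF.bind_bind]
    congr 1
    funext τ
    exact ih τ

/-- The count is evaluated once, in `μ`, so the body may overwrite the cells it is computed from;
`finish` relies on this. -/
theorem wp_loop {e : Expr} {P : Prog} {Q : Mem → Prop} {μ : Mem} (J : ℕ → Mem → Prop)
    (hN : e.eval μ ≤ N) (h0 : J 0 μ)
    (hstep : ∀ i < e.eval μ, ∀ μ', J i μ' → wp r 𝒪 S N P (J (i + 1)) μ')
    (hQ : ∀ μ', J (e.eval μ) μ' → Q μ') : wp r 𝒪 S N (.loop e P) Q μ := by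
  intro hb
  have key : ∀ M ≤ e.eval μ, ∃ μ', J M μ' ∧ Bdd S μ' ∧ ∀ t c, ∃ t',
      t' ≤ t + M * (P.bound S N + 1) ∧
      iterate (fun τ => P.exec r 𝒪 (τ.tick 1)) M ⟨μ, t, c⟩ = PMF.pure ⟨μ', t', c⟩ := by
    intro M
    induction M with
    | zero => exact fun _ => ⟨μ, h0, hb, fun t c => ⟨t, by simp, rfl⟩⟩
    | succ M ih =>
      intro hM
      obtain ⟨μ₁, hJ, hb1, he⟩ := ih (by omega)
      obtain ⟨μ₂, hJ2, hb2, he2⟩ := hstep M (by omega) μ₁ hJ hb1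
      refine ⟨μ₂, hJ2, hb2, fun t c => ?_⟩
      obtain ⟨t₁, ht1, he1⟩ := he t c
      obtain ⟨t₂, ht2, he2⟩ := he2 (t₁ + 1) c
      refine ⟨t₂, ?_, ?_⟩
      · rw [add_mul]; omega
      · rw [iterate_succ', he1, PMF.pure_bind]; exact he2
  obtain ⟨μ', hJ, hb', he⟩ := key _ le_rfl
  refine ⟨μ', hQ _ hJ, hb', fun t c => ?_⟩
  obtain ⟨t', ht, he⟩ := he (t + (e.cost μ + 1)) c
  refine ⟨t', ?_, he⟩
  have h1 := e.cost_le hb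
  have h2 : e.eval μ * (P.bound S N + 1) ≤ N * (P.bound S N + 1) := Nat.mul_le_mul_right _ hN
  simp only [Prog.bound]
  nlinarith

theorem wp_approx {i : Fin 3} {a b : Expr} {Q : Mem → Prop} {μ : Mem} (hN : b.eval μ ≤ N)
    (hv : ⌊2 ^ b.eval μ * r i⌋₊ < 2 ^ S)
    (h : Q (Function.update μ (a.eval μ) ⌊2 ^ b.eval μ * r i⌋₊)) :
    wp r 𝒪 S N (.approx i a b) Q μ := by
  intro hb
  refine ⟨_, h, hb.update _ hv, fun t c => ⟨_, ?_, rfl⟩⟩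
  have h1 := a.cost_le hb
  have h2 := b.cost_le hb
  have h3 := a.size_eval_le hb
  have h4 := Nat.size_le.mpr hv
  simp only [State.tick, Prog.bound]
  nlinarith

/-- Repeat `P` with the counter in the cell `c` running from `0` on. -/
def Prog.for (c : ℕ) (e : Expr) (P : Prog) : Prog :=
  .seq (.store (.const c) (.const 0))
    (.loop e (.seq P (.store (.const c) (.op .add (.load (.const c)) (.const 1)))))

/-- The invariant `J i` speaks of the memory in which the counter already equals `i`. Hence the body
has to leave the counter alone and to establish `J (i + 1)` for the memory after the increment. -/
theorem wp_for {c : ℕ} {e : Expr} {P : Prog} {Q : Mem → Prop} {μ : Mem} (M : ℕ)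
    (J : ℕ → Mem → Prop) (hM : e.eval (Function.update μ c 0) = M) (hN : M ≤ N) (hS : M < 2 ^ S)
    (h0 : J 0 (Function.update μ c 0))
    (hstep : ∀ i < M, ∀ μ', μ' c = i → J i μ' →
      wp r 𝒪 S N P (fun μ'' => μ'' c = i ∧ J (i + 1) (Function.update μ'' c (i + 1))) μ')
    (hQ : ∀ μ', J M μ' → Q μ') : wp r 𝒪 S N (.for c e P) Q μ := by
  refine wp_seq (wp_store (fun _ => by simp [Expr.eval]) ?_)
  refine wp_loop (fun i μ' => μ' c = i ∧ J i μ') ?_ ?_ ?_ ?_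
  · simpa [Expr.eval, hM] using hN
  · simpa [Expr.eval] using h0
  · intro i hi μ' hJ
    have hi' : i < M := by simpa [Expr.eval, hM] using hi
    refine wp_seq (wp_mono (hstep i hi' μ' hJ.1 hJ.2) ?_)
    rintro μ'' ⟨h1, h2⟩
    refine wp_store (fun _ => ?_) ?_
    · simp only [Expr.eval, BinOp.eval, h1]; omega
    · simpa [Expr.eval, BinOp.eval, h1] using h2
  · intro μ' hJ
    exact hQ _ (by simpa [Expr.eval, hM] using hJ.2)

end WP

/-! ### Random coins and oracle calls -/

theorem exec_rand {S N : ℕ} (r : Fin 3 → ℝ) (𝒪 : Oracle) {a b : Expr} {μ : Mem} (hb : Bdd S μ)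
    (hN : b.eval μ ≤ N) (hS : b.eval μ ≤ S) (t c : ℕ) :
    ∃ t' : Fin (2 ^ b.eval μ) → ℕ, (∀ v, t' v ≤ t + (Prog.rand a b).bound S N) ∧
      (Prog.rand a b).exec r 𝒪 ⟨μ, t, c⟩ =
        (PMF.uniformOfFintype (Fin (2 ^ b.eval μ))).map
          fun v => ⟨Function.update μ (a.eval μ) v, t' v, c⟩ := by
  refine ⟨fun v => t + (a.cost μ + b.cost μ + b.eval μ) +
    (Nat.size (a.eval μ) + Nat.size (v : ℕ) + 1), fun v => ?_, by
      simp only [Prog.exec, State.tick, State.write]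
      -- In `Prog.exec` the passage from `Fin` to `ℕ` is a coercion of the whole distribution, that
      -- is, a bind with `PMF.pure`.
      change PMF.map _ (PMF.bind (PMF.uniformOfFintype (Fin (2 ^ b.eval μ))) fun a => PMF.pure (a : ℕ)) = _
      rw [PMF.map_bind, ← PMF.bind_pure_comp]
      simp only [PMF.pure_map, Function.comp_def]⟩
  have h1 := a.cost_le hb
  have h2 := b.cost_le hb
  have h3 := a.size_eval_le hb
  have h4 : Nat.size (v : ℕ) ≤ S := (Nat.size_le.mpr v.2).trans hS
  simp only [Prog.bound]
  nlinarith

theorem State.mem_writeList (σ : State) (a : ℕ) (l : List ℕ) (x : ℕ) :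
    (σ.writeList a l).mem x = if a ≤ x ∧ x < a + l.length then l.getD (x - a) 0 else σ.mem x := by
  induction l generalizing σ a with
  | nil => simp [State.writeList]
  | cons v l ih =>
    rw [State.writeList, ih]
    simp only [List.length_cons, State.write]
    by_cases h : x = a
    · subst h; simp
    · rw [Function.update_of_ne h]
      by_cases h1 : a ≤ x
      · obtain ⟨d, rfl⟩ : ∃ d, x = a + 1 + d := ⟨x - (a + 1), by omega⟩
        rw [show a + 1 + d - (a + 1) = d by omega, show a + 1 + d - a = d + 1 by omega,
          List.getD_cons_succ]
        exact if_congr (by omega) rfl rfl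
      · rw [if_neg (by omega), if_neg (by omega)]

theorem State.queries_writeList (σ : State) (a : ℕ) (l : List ℕ) :
    (σ.writeList a l).queries = σ.queries := by
  induction l generalizing σ a with
  | nil => rfl
  | cons v l ih => rw [State.writeList, ih]; rfl

theorem State.time_writeList_le {B : ℕ} (σ : State) (a : ℕ) (l : List ℕ)
    (h : ∀ i < l.length, Nat.size (a + i) + Nat.size (l.getD i 0) + 1 ≤ B) :
    (σ.writeList a l).time ≤ σ.time + l.length * B := by
  induction l generalizing σ a with
  | nil => simp [State.writeList]
  | cons v l ih =>
    rw [State.writeList]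
    have h0 := h 0 (by simp)
    simp only [add_zero, List.getD_cons_zero] at h0
    refine (ih (σ.write a v) (a + 1) fun i hi => ?_).trans ?_
    · have := h (i + 1) (by simpa using hi)
      rwa [List.getD_cons_succ, show a + (i + 1) = a + 1 + i by ring] at this
    · simp only [State.write, List.length_cons, add_mul, one_mul]
      omega

/-- The memory after an answer `l` has been written into the cells from `a` on. -/
def writeBlock (μ : Mem) (a : ℕ) (l : List ℕ) : Mem := fun x =>
  if a ≤ x ∧ x < a + l.length then l.getD (x - a) 0 else μ x

theorem Bdd.writeBlock {S : ℕ} {μ : Mem} (h : Bdd S μ) (a : ℕ) {l : List ℕ}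
    (hl : ∀ x ∈ l, x < 2 ^ S) : Bdd S (writeBlock μ a l) := by
  intro x
  unfold LPN.writeBlock
  split_ifs with hx
  · rw [List.getD_eq_getElem _ _ (by omega)]
    exact hl _ (List.getElem_mem _)
  · exact h x

/-- Writing the answer takes time that depends on it, and an arbitrary oracle may answer at any
length. The time is thus a function of the answer, bounded only for answers that fit. -/
theorem exec_query {S N : ℕ} (r : Fin 3 → ℝ) (𝒪 : Oracle) {s l d : Expr} {μ : Mem}
    (hb : Bdd S μ) (hN : l.eval μ ≤ N) (t c : ℕ) :
    ∃ t' : List ℕ → ℕ,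
      (∀ w : List ℕ, w.length ≤ N → (∀ x ∈ w, x < 2 ^ S) →
        t' w ≤ t + (Prog.query s l d).bound S N) ∧
      (Prog.query s l d).exec r 𝒪 ⟨μ, t, c⟩ =
        (𝒪 (μ.block (s.eval μ) (l.eval μ))).map
          fun w => ⟨writeBlock μ (d.eval μ) w, t' w, c + 1⟩ := by
  refine ⟨fun w => (State.writeList ⟨μ, t + (s.cost μ + l.cost μ + d.cost μ +
    μ.blockCost (s.eval μ) (l.eval μ) + 1), c + 1⟩ (d.eval μ) w).time, fun w hw hws => ?_, ?_⟩
  · have h1 := s.cost_le hb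
    have h2 := l.cost_le hb
    have h3 := d.cost_le hb
    have h4 := s.size_eval_le hb
    have h5 := d.size_eval_le hb
    set B := (s.wt + d.wt + 1) * (S + 1) + N + 1 with hB
    have h6 : μ.blockCost (s.eval μ) (l.eval μ) ≤ N * B := by
      unfold Mem.blockCost
      refine (Finset.sum_le_card_nsmul _ _ B fun i hi => ?_).trans ?_
      · have hi : i < l.eval μ := by simpa using hi
        have := size_add_le (s.eval μ) i
        have := size_le_self i
        have := hb.size_le (s.eval μ + i)
        rw [hB]
        nlinarith [Nat.zero_le (d.wt * (S + 1))]
      · simpa using Nat.mul_le_mul_right B hN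
    have h7 := State.time_writeList_le (B := B) ⟨μ, t + (s.cost μ + l.cost μ + d.cost μ +
      μ.blockCost (s.eval μ) (l.eval μ) + 1), c + 1⟩ (d.eval μ) w (fun i hi => by
        have := size_add_le (d.eval μ) i
        have := size_le_self i
        have h8 : Nat.size (w.getD i 0) ≤ S := by
          rw [Nat.size_le, List.getD_eq_getElem _ _ hi]
          exact hws _ (List.getElem_mem _)
        rw [hB]
        nlinarith [Nat.zero_le (s.wt * (S + 1))])
    have h8 : w.length * B ≤ N * B := Nat.mul_le_mul_right B hw
    simp only [Prog.bound]
    simp only at h7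
    nlinarith
  · simp only [Prog.exec, State.tick]
    congr 1
    funext w
    have hm : ∀ τ : State, τ = ⟨τ.mem, τ.time, τ.queries⟩ := fun τ => rfl
    rw [hm (State.writeList _ _ _)]
    congr 1
    · funext x; exact State.mem_writeList _ _ _ _
    · exact State.queries_writeList _ _ _


/-! ### Notation for expressions -/

instance : Add Expr := ⟨.op .add⟩
instance : Sub Expr := ⟨.op .sub⟩
instance : Mul Expr := ⟨.op .mul⟩
instance : Div Expr := ⟨.op .div⟩
instance : Mod Expr := ⟨.op .mod⟩
instance (c : ℕ) : OfNat Expr c := ⟨.const c⟩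

/-- `1` if the first value is less than the second one, and `0` otherwise. -/
def Expr.lt (e f : Expr) : Expr := .op .lt e f

/-- `1` if the two values agree, and `0` otherwise. -/
def Expr.eqv (e f : Expr) : Expr := 1 - (e.lt f + f.lt e)

/-- The value of `a` if those of `e` and `f` agree, and otherwise that of `b`. -/
def Expr.sel (e f a b : Expr) : Expr := e.eqv f * a + (1 - e.eqv f) * b

/-- The content of a cell with a fixed address. -/
def reg (c : ℕ) : Expr := .load (.const c)

/-- The address of the `i`-th cell of the segment `s`; the length of segments is in the cell
`4`. -/
def seg (s : ℕ) (i : Expr) : Expr := .const s * reg 4 + i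

section Eval

variable (μ : Mem) (e f a b : Expr) (c : ℕ)

@[simp] theorem eval_add : (e + f).eval μ = e.eval μ + f.eval μ := id rfl
@[simp] theorem eval_sub : (e - f).eval μ = e.eval μ - f.eval μ := id rfl
@[simp] theorem eval_mul : (e * f).eval μ = e.eval μ * f.eval μ := id rfl
@[simp] theorem eval_div : (e / f).eval μ = e.eval μ / f.eval μ := id rfl
@[simp] theorem eval_mod : (e % f).eval μ = e.eval μ % f.eval μ := id rfl
@[simp] theorem eval_ofNat : (ofNat(c) : Expr).eval μ = c := id rfl
@[simp] theorem eval_zero : (0 : Expr).eval μ = 0 := id rfl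
@[simp] theorem eval_one : (1 : Expr).eval μ = 1 := id rfl
@[simp] theorem eval_const : (Expr.const c).eval μ = c := id rfl
@[simp] theorem eval_reg : (reg c).eval μ = μ c := id rfl
@[simp] theorem eval_load : (Expr.load e).eval μ = μ (e.eval μ) := id rfl
@[simp] theorem eval_size : (Expr.size e).eval μ = Nat.size (e.eval μ) := id rfl
@[simp] theorem eval_lt : (e.lt f).eval μ = if e.eval μ < f.eval μ then 1 else 0 := id rfl
@[simp] theorem eval_seg : (seg c e).eval μ = c * μ 4 + e.eval μ := id rfl

-- Expressions have no conditional, so tests and selections are arithmetic with indicators. At most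
-- one of the two strict comparisons equals `1`.
@[simp] theorem eval_eqv : (e.eqv f).eval μ = if e.eval μ = f.eval μ then 1 else 0 := by
  simp only [Expr.eqv, eval_sub, eval_add, eval_lt]
  simp only [eval_one]
  split_ifs <;> omega

@[simp] theorem eval_sel :
    (Expr.sel e f a b).eval μ = if e.eval μ = f.eval μ then a.eval μ else b.eval μ := by
  simp only [Expr.sel, eval_sub, eval_add, eval_mul, eval_eqv]
  simp only [eval_one]
  split_ifs <;> simp

end Eval

/-! ### Two kinds of loops -/

section Loops

variable {r : Fin 3 → ℝ} {𝒪 : Oracle} {S N : ℕ}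

/-- When cell `B + i` is about to be written, it and the later cells still have their contents in
`μ`. So `f i` may depend on the old value there, which covers updates in place. -/
theorem wp_fill {c : ℕ} {cnt base val : Expr} {Q : Mem → Prop} {μ : Mem} (M B : ℕ) (f : ℕ → ℕ)
    (hM : cnt.eval (Function.update μ c 0) = M) (hN : M ≤ N) (hS : M < 2 ^ S) (hc : c < B)
    (hf : Bdd S μ → ∀ i < M, f i < 2 ^ S)
    (hstep : ∀ i < M, ∀ μ', μ' c = i → (∀ a, a ≠ c → ¬(B ≤ a ∧ a < B + i) → μ' a = μ a) →
      base.eval μ' = B + i ∧ val.eval μ' = f i)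
    (hQ : ∀ μ', (∀ i < M, μ' (B + i) = f i) →
      (∀ a, a ≠ c → ¬(B ≤ a ∧ a < B + M) → μ' a = μ a) → Q μ') :
    wp r 𝒪 S N (.for c cnt (.store base val)) Q μ := by
  intro hb
  refine wp_for M (fun i μ' => (∀ t < i, μ' (B + t) = f t) ∧
    ∀ a, a ≠ c → ¬(B ≤ a ∧ a < B + i) → μ' a = μ a) hM hN hS ?_ ?_ ?_ hb
  · exact ⟨fun t ht => absurd ht (by omega), fun a ha _ => Function.update_of_ne ha _ _⟩
  · rintro i hi μ' hci ⟨h1, h2⟩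
    obtain ⟨e1, e2⟩ := hstep i hi μ' hci h2
    refine wp_store (fun _ => by rw [e2]; exact hf hb i hi) ?_
    rw [e1, e2]
    refine ⟨by rw [Function.update_of_ne (by omega)]; exact hci, fun t ht => ?_, fun a ha ha' => ?_⟩
    · rw [Function.update_of_ne (by omega)]
      by_cases hti : t = i
      · subst hti; simp
      · rw [Function.update_of_ne (by omega)]; exact h1 t (by omega)
    · rw [Function.update_of_ne ha, Function.update_of_ne (by omega)]
      exact h2 a ha (by omega)
  · rintro μ' ⟨h1, h2⟩
    exact hQ μ' h1 h2

/-- Reducing modulo `q` in every round keeps the accumulator within `S` bits; the exact value is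
only claimed in `ZMod q`. -/
theorem wp_acc {c d : ℕ} {cnt val md : Expr} {Q : Mem → Prop} {μ : Mem} (M q : ℕ) (f : ℕ → ℕ)
    (hM : cnt.eval (Function.update μ c 0) = M) (hN : M ≤ N) (hS : M < 2 ^ S) (hcd : c ≠ d)
    (hq : 0 < q) (hqS : Bdd S μ → q ≤ 2 ^ S) (h0 : μ d < q)
    (hstep : ∀ i < M, ∀ μ', μ' c = i → (∀ a, a ≠ c → a ≠ d → μ' a = μ a) →
      md.eval μ' = q ∧ val.eval μ' = f i)
    (hQ : ∀ μ', μ' d < q → (μ' d : ZMod q) = μ d + ∑ i ∈ Finset.range M, (f i : ZMod q) →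
      (∀ a, a ≠ c → a ≠ d → μ' a = μ a) → Q μ') :
    wp r 𝒪 S N (.for c cnt (.store (.const d) ((reg d + val) % md))) Q μ := by
  intro hb
  refine wp_for M (fun i μ' => μ' d < q ∧
    (μ' d : ZMod q) = μ d + ∑ i ∈ Finset.range i, (f i : ZMod q) ∧
    ∀ a, a ≠ c → a ≠ d → μ' a = μ a) hM hN hS ?_ ?_ ?_ hb
  · refine ⟨?_, ?_, fun a ha _ => Function.update_of_ne ha _ _⟩ <;>
      simp [Function.update_of_ne hcd.symm, h0]
  · rintro i hi μ' hci ⟨h1, h2, h3⟩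
    obtain ⟨e1, e2⟩ := hstep i hi μ' hci h3
    have hlt := Nat.mod_lt (μ' d + f i) hq
    refine wp_store (fun _ => ?_) ?_
    · simp only [eval_mod, eval_add, eval_reg, e1, e2]
      exact lt_of_lt_of_le hlt (hqS hb)
    · simp only [eval_mod, eval_add, eval_reg, e1, e2, eval_const]
      refine ⟨by rw [Function.update_of_ne hcd]; exact hci, ?_, ?_, fun a ha ha' => ?_⟩
      · simpa [Function.update_of_ne hcd.symm] using hlt
      · rw [Function.update_of_ne hcd.symm, Function.update_self, ZMod.natCast_mod,
          Finset.sum_range_succ, ← add_assoc, ← h2]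
        push_cast; rfl
      · rw [Function.update_of_ne ha, Function.update_of_ne ha']
        exact h3 a ha ha'
  · rintro μ' ⟨h1, h2, h3⟩
    exact hQ μ' h1 h2 h3

end Loops

/-! ### The program -/

/-- The number of random digits that one trial uses. -/
def numDigits (n m k : ℕ) : ℕ := m * k + k * n + m * (k * n)

/-- The length of the memory segments. -/
def segLen (n m k : ℕ) : ℕ := 32 + (m * n + m + (numDigits n m k + m))

/-- The expression for `numDigits`. -/
def digitsExpr : Expr := reg 2 * reg 3 + reg 3 * reg 1 + reg 2 * (reg 3 * reg 1)

/-- The expression for `segLen`. -/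
def segExpr : Expr := 32 + (reg 2 * reg 1 + reg 2 + (digitsExpr + reg 2))

/-- Extract the random digits of the number in the cell `11`. -/
def unpack : Prog :=
  -- Segment 1 holds the input. Segment 2 holds noise, secret, matrix and right hand side of the
  -- query. Segment 3 holds the oracle's answer, 4 the candidate, 5 the best candidate. Cell 10 is
  -- the planted position, 11 the random number, 12 and 13 are counters, 14 an accumulator, 15 a
  -- violation count.
  .for 12 digitsExpr
    (.seq
      -- From index `mk` on the threshold is at least `P`, so the coin always succeeds: secret and
      -- matrix entries are uniform, while noise entries survive with bias `h / P`.
      (.store (seg 2 (reg 12)) (reg 11 % reg 0 *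
        Expr.lt (reg 11 / reg 0 % reg 5) (reg 6 + reg 5 * Expr.lt (reg 2 * reg 3) (reg 12 + 1))))
      (.store 11 (reg 11 / reg 0 / reg 5)))

/-- Overwrite one block of the random matrix by the given one. -/
def plant : Prog :=
  .for 12 (reg 2 * (reg 3 * reg 1))
    (.store (seg 2 (reg 2 * reg 3 + reg 3 * reg 1 + reg 12))
      (Expr.sel (reg 12 % (reg 3 * reg 1) / reg 1) (reg 10)
        (.load (seg 1 (reg 12 / (reg 3 * reg 1) * reg 1 + reg 12 % (reg 3 * reg 1) % reg 1)))
        (.load (seg 2 (reg 2 * reg 3 + reg 3 * reg 1 + reg 12)))))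

/-- Delete the noise that belongs to the planted block. -/
def mask : Prog :=
  -- The planted block brings its own noise, which is already part of `b`.
  .for 12 (reg 2 * reg 3)
    (.store (seg 2 (reg 12))
      (Expr.sel (reg 12 % reg 3) (reg 10) 0 (.load (seg 2 (reg 12)))))

/-- Compute the right hand side of the query. -/
def samples : Prog :=
  .for 12 (reg 2)
    (.seq (.store (.const 14) (.load (seg 1 (reg 2 * reg 1 + reg 12))))
    (.seq
      (.for 13 (reg 3) (.store (.const 14)
        ((reg 14 + .load (seg 2 (reg 12 * reg 3 + reg 13))) % reg 0)))
    (.seq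
      (.for 13 (reg 3 * reg 1) (.store (.const 14)
        ((reg 14 + .load (seg 2 (reg 2 * reg 3 + reg 3 * reg 1 +
            (reg 12 * (reg 3 * reg 1) + reg 13))) *
          .load (seg 2 (reg 2 * reg 3 + reg 13))) % reg 0)))
      (.store (seg 2 (digitsExpr + reg 12)) (reg 14)))))

/-- Prepare the query from the random number in the cell `11`. -/
def prepare : Prog :=
  .seq (.store 10 (reg 11 % reg 3)) (.seq (.store 11 (reg 11 / reg 3))
    (.seq unpack (.seq plant (.seq mask samples))))

/-- Call the oracle. -/
def ask : Prog :=
  .query (seg 2 (reg 2 * reg 3 + reg 3 * reg 1)) (reg 2 * (reg 3 * reg 1) + reg 2) (seg 3 0)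

/-- Extract the candidate secret from the answer of the oracle. -/
def candidate : Prog :=
  .for 12 (reg 1) (.store (seg 4 (reg 12))
    ((.load (seg 3 (reg 10 * reg 1 + reg 12)) +
      (reg 0 - .load (seg 2 (reg 2 * reg 3 + (reg 10 * reg 1 + reg 12))))) % reg 0))

/-- Count the samples that the candidate violates. -/
def evaluate : Prog :=
  .seq (.store (.const 15) 0)
    (.for 12 (reg 2)
      (.seq (.store (.const 14) 0)
      (.seq
        (.for 13 (reg 1) (.store (.const 14)
          ((reg 14 + .load (seg 1 (reg 12 * reg 1 + reg 13)) * .load (seg 4 (reg 13))) % reg 0)))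
        (.store (.const 15) (reg 15 +
          (1 - Expr.eqv (reg 14) (.load (seg 1 (reg 2 * reg 1 + reg 12)))))))))

/-- Keep the candidate if it is better than all the previous ones. -/
def keepBest : Prog :=
  .ite (Expr.lt (reg 15) (reg 9))
    (.seq (.store (.const 9) (reg 15))
      (.for 12 (reg 1) (.store (seg 5 (reg 12)) (.load (seg 4 (reg 12))))))
    .skip

/-- Process the answer of the oracle. -/
def assess : Prog := .seq candidate (.seq evaluate keepBest)

/-- One oracle call, with its preparation and the assessment of the answer. -/
def trial : Prog := .seq (.rand 11 (reg 8)) (.seq prepare (.seq ask assess))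

/-- Copy the input away from the first cells. -/
def moveInput : Prog :=
  .loop (reg 2 * reg 1 + reg 2)
    -- The cells from 4 on still contain the input. The segment length is therefore recomputed from
    -- `n, m, k` each time, and the counter lives at `2 * segLen`, beyond the input, where the
    -- memory is zero at the start.
    (.seq (.store (segExpr + .load (2 * segExpr)) (.load (4 + .load (2 * segExpr))))
      (.store (2 * segExpr) (.load (2 * segExpr) + 1)))

/-- The expression for the precision of the approximations. -/
def precExpr : Expr := 2 * reg 2 + reg 3 + reg 1 * .size (reg 0)

/-- Compute the constants. -/
def setup : Prog :=
  .seq moveInput (.seq (.store (.const 4) segExpr) (.seq (.store (.const 5) 1)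
    (.seq (.loop precExpr (.store (.const 5) (reg 5 * 2)))
    (.seq (.approx 0 (.const 6) precExpr) (.seq (.approx 2 (.const 7) precExpr)
    -- `P / ⌊Pε⌋ + 1` exceeds `1/ε` when `⌊Pε⌋` is positive, so there are at least `16k/ε` trials.
    -- Their joint failure probability is about `exp(-k)`, which the lower bound on `k` makes small
    -- against `δ`; hence `δ` is never read.
    (.seq (.store (.const 7) (16 * reg 3 * (reg 5 / reg 7 + 1)))
    (.seq (.store (.const 8) (digitsExpr * .size (reg 0 * reg 5) + .size (reg 3) + 2))
      (.store (.const 9) (reg 2 + 1)))))))))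

/-- Copy the result into the first cells. -/
def finish : Prog :=
  -- The output cells include the cells 0 and 1 that serve as pointers. The copy therefore runs
  -- downwards and fills these two at the very end.
  .seq (.store (.const 0) (seg 5 (reg 1))) (.seq (.store (.const 1) (seg 5 0))
    (.seq (.loop (reg 0 - reg 1)
      (.seq (.store (.const 0) (reg 0 - 1))
        (.ite (Expr.lt (reg 1 + 1) (reg 0)) (.store (reg 0 - reg 1) (.load (reg 0))) .skip)))
      (.seq (.store (.const 1) (.load (reg 1 + 1))) (.store (.const 0) (.load (reg 0))))))

/-- The reduction. -/
def reduction : Prog := .seq setup (.seq (.loop (reg 7) trial) finish)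


/-! ### What the parts of the program do -/

/-- The cells that a trial does not change hold the parameters and the input `inp`. -/
structure Env (q n m k P h L : ℕ) (inp : ℕ → ℕ) (μ : Mem) : Prop where
  c0 : μ 0 = q
  c1 : μ 1 = n
  c2 : μ 2 = m
  c3 : μ 3 = k
  c4 : μ 4 = segLen n m k
  c5 : μ 5 = P
  c6 : μ 6 = h
  c8 : μ 8 = L
  input : ∀ i < m * n + m, μ (segLen n m k + i) = inp i

theorem le_segLen (n m k : ℕ) :
    segLen n m k = 32 + (m * n + m + (m * k + k * n + m * (k * n) + m)) := rfl

/-- `Env` looks only at cells below 9 and at segment 1, and everything a trial writes lies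
elsewhere. The record in cell 9 is deliberately outside. -/
theorem Env.congr {q n m k P h L : ℕ} {inp : ℕ → ℕ} {μ μ' : Mem} (H : Env q n m k P h L inp μ)
    (hμ : ∀ a < 2 * segLen n m k, a < 9 ∨ segLen n m k ≤ a → μ' a = μ a) :
    Env q n m k P h L inp μ' := by
  have hU := le_segLen n m k
  have h9 : ∀ a < 9, μ' a = μ a := fun a ha => hμ a (by omega) (by omega)
  refine ⟨?_, ?_, ?_, ?_, ?_, ?_, ?_, ?_, fun i hi => ?_⟩
  · rw [h9 0 (by omega)]; exact H.c0
  · rw [h9 1 (by omega)]; exact H.c1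
  · rw [h9 2 (by omega)]; exact H.c2
  · rw [h9 3 (by omega)]; exact H.c3
  · rw [h9 4 (by omega)]; exact H.c4
  · rw [h9 5 (by omega)]; exact H.c5
  · rw [h9 6 (by omega)]; exact H.c6
  · rw [h9 8 (by omega)]; exact H.c8
  · rw [hμ _ (by omega) (by omega)]; exact H.input i hi

/-- The `i`-th random element extracted from `x`: below the index `w` it is a uniform element
multiplied by a coin of bias `h / P`, and from `w` on it is a uniform element. -/
def digit (q P h w x i : ℕ) : ℕ :=
  x / (q * P) ^ i % q * if x / (q * P) ^ i / q % P < h + P * (if w < i + 1 then 1 else 0)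
    then 1 else 0

theorem digit_lt {q : ℕ} (hq : 0 < q) (P h w x i : ℕ) : digit q P h w x i < q := by
  unfold digit
  have := Nat.mod_lt (x / (q * P) ^ i) hq
  split_ifs <;> omega

/-- The matrix of the query made from `x`. -/
def plantedMatrix (q n m k P h : ℕ) (inp : ℕ → ℕ) (pos x t : ℕ) : ℕ :=
  if t % (k * n) / n = pos then inp (t / (k * n) * n + t % (k * n) % n)
  else digit q P h (m * k) x (m * k + k * n + t)

/-- The noise added to the query made from `x`. -/
def maskedNoise (q m k P h pos x t : ℕ) : ℕ :=
  if t % k = pos then 0 else digit q P h (m * k) x t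

/-- The secret added to the query made from `x`. -/
def shiftSecret (q m k P h x t : ℕ) : ℕ := digit q P h (m * k) x (m * k + t)

section Specs

variable {r : Fin 3 → ℝ} {𝒪 : Oracle} {S N : ℕ} {q n m k P h L : ℕ} {inp : ℕ → ℕ}
  {Q : Mem → Prop} {μ : Mem}

theorem wp_unpack (hN : segLen n m k ≤ N) (hS : segLen n m k ≤ S) (hq : 0 < q)
    (H : Env q n m k P h L inp μ) {x : ℕ} (hx : μ 11 = x)
    (hQ : ∀ μ', (∀ i < numDigits n m k,
        μ' (2 * segLen n m k + i) = digit q P h (m * k) x i) →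
      (∀ a, a ≠ 11 → a ≠ 12 →
        ¬(2 * segLen n m k ≤ a ∧ a < 2 * segLen n m k + numDigits n m k) → μ' a = μ a) → Q μ') :
    wp r 𝒪 S N unpack Q μ := by
  have hU := le_segLen n m k
  have hD : numDigits n m k = m * k + k * n + m * (k * n) := rfl
  set U := segLen n m k with hUdef
  have hS' : numDigits n m k < 2 ^ S := lt_of_le_of_lt (by omega) Nat.lt_two_pow_self
  intro hb
  have hx' := hb 11
  have hqS : q < 2 ^ S := H.c0 ▸ hb 0
  refine wp_for (numDigits n m k) (fun i μ' => μ' 11 = x / (q * P) ^ i ∧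
    (∀ t < i, μ' (2 * U + t) = digit q P h (m * k) x t) ∧
    ∀ a, a ≠ 11 → a ≠ 12 → ¬(2 * U ≤ a ∧ a < 2 * U + i) → μ' a = μ a) ?_ (by omega) hS'
    ?_ ?_ ?_ hb
  · simp [digitsExpr, Function.update_of_ne, H.c1, H.c2, H.c3, numDigits]
  · refine ⟨by simp [Function.update_of_ne, hx], fun t ht => absurd ht (by omega),
      fun a _ ha _ => Function.update_of_ne ha _ _⟩
  · rintro i hi μ' hci ⟨h1, h2, h3⟩
    have hE : Env q n m k P h L inp μ' := H.congr fun a ha ha' =>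
      h3 a (by omega) (by omega) (by omega)
    have e : (reg 11 % reg 0 * Expr.lt (reg 11 / reg 0 % reg 5)
        (reg 6 + reg 5 * Expr.lt (reg 2 * reg 3) (reg 12 + 1))).eval μ' =
        digit q P h (m * k) x i := by
      simp only [digit, eval_mul, eval_mod, eval_div, eval_add, eval_lt, eval_reg, eval_one, hE.c0,
        hE.c5, hE.c6, hE.c2, hE.c3, hci, h1]
    refine wp_seq (wp_store (fun _ => by rw [e]; exact (digit_lt hq ..).trans hqS) ?_)
    · have e' : (seg 2 (reg 12)).eval μ' = 2 * U + i := by simp [hE.c4, hci, hUdef]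
      rw [e, e']
      have e3 : ∀ a < 2 * U, Function.update μ' (2 * U + i) (digit q P h (m * k) x i) a = μ' a :=
        fun a ha => Function.update_of_ne (by omega) _ _
      have e4 : (reg 11 / reg 0 / reg 5).eval
          (Function.update μ' (2 * U + i) (digit q P h (m * k) x i)) =
          x / (q * P) ^ (i + 1) := by
        simp only [eval_div, eval_reg]
        rw [e3 _ (by omega), e3 _ (by omega), e3 _ (by omega), h1, hE.c0, hE.c5,
          Nat.div_div_eq_div_mul, Nat.div_div_eq_div_mul, pow_succ]
      refine wp_store (fun _ => ?_) ?_
      · rw [e4]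
        exact lt_of_le_of_lt (Nat.div_le_self _ _) (hx ▸ hx')
      · rw [e4]
        simp only [eval_ofNat]
        refine ⟨?_, ?_, fun t ht => ?_, fun a ha ha' ha'' => ?_⟩
        · rw [Function.update_of_ne (by omega), e3 _ (by omega)]; exact hci
        · rw [Function.update_of_ne (by omega), Function.update_self]
        · rw [Function.update_of_ne (by omega), Function.update_of_ne (by omega)]
          by_cases hti : t = i
          · subst hti; simp
          · rw [Function.update_of_ne (by omega)]; exact h2 t (by omega)
        · rw [Function.update_of_ne ha', Function.update_of_ne ha,
            Function.update_of_ne (by omega)]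
          exact h3 a ha ha' (by omega)
  · rintro μ' ⟨-, h2, h3⟩
    exact hQ μ' h2 h3

theorem div_mul_add_mod_lt {n m k t : ℕ} (ht : t < m * (k * n)) :
    t / (k * n) * n + t % (k * n) % n < m * n := by
  have hn : 0 < n := by
    rcases Nat.eq_zero_or_pos n with rfl | h
    · simp at ht
    · exact h
  have hkn : 0 < k * n := by
    rcases Nat.eq_zero_or_pos (k * n) with h | h
    · rw [h] at ht; simp at ht
    · exact h
  have h1 : t / (k * n) < m := by rw [Nat.div_lt_iff_lt_mul hkn]; exact ht
  have h2 := Nat.mod_lt (t % (k * n)) hn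
  nlinarith

/-- Entry `t` of the `m × kn` matrix lies in row `t / (kn)` and column `t % (kn)`. The column
belongs to block `t % (kn) / n` and is column `t % (kn) % n` within it. -/
theorem wp_plant (hN : segLen n m k ≤ N) (hS : segLen n m k ≤ S)
    (H : Env q n m k P h L inp μ)
    (hQ : ∀ μ', (∀ t < m * (k * n), μ' (2 * segLen n m k + (m * k + k * n + t)) =
        if t % (k * n) / n = μ 10 then inp (t / (k * n) * n + t % (k * n) % n)
        else μ (2 * segLen n m k + (m * k + k * n + t))) →
      (∀ a, a ≠ 12 → ¬(2 * segLen n m k + (m * k + k * n) ≤ a ∧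
        a < 2 * segLen n m k + (m * k + k * n + m * (k * n))) → μ' a = μ a) → Q μ') :
    wp r 𝒪 S N plant Q μ := by
  have hU := le_segLen n m k
  set U := segLen n m k with hUdef
  have hS' : m * (k * n) < 2 ^ S := lt_of_le_of_lt (by omega) Nat.lt_two_pow_self
  refine wp_fill (m * (k * n)) (2 * U + (m * k + k * n)) (fun t =>
    if t % (k * n) / n = μ 10 then inp (t / (k * n) * n + t % (k * n) % n)
        else μ (2 * U + (m * k + k * n + t))) ?_ (by omega) hS' (by omega) ?_ ?_ ?_
  · simp [Function.update_of_ne, H.c1, H.c2, H.c3]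
  · intro hb t ht
    split_ifs
    · have := div_mul_add_mod_lt ht
      rw [← H.input _ (by omega)]; exact hb _
    · exact hb _
  · intro i hi μ' hci hμ'
    have hE : Env q n m k P h L inp μ' := H.congr fun a ha ha' =>
      hμ' a (by omega) (by omega)
    refine ⟨by simp [hE.c1, hE.c2, hE.c3, hE.c4, hci, ← hUdef]; omega, ?_⟩
    have e10 := hμ' 10 (by omega) (by omega)
    have eold := hμ' (2 * U + (m * k + k * n + i)) (by omega) (by omega)
    have := div_mul_add_mod_lt hi
    have ein := hE.input (i / (k * n) * n + i % (k * n) % n) (by omega)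
    simp only [eval_sel, eval_mul, eval_mod, eval_div, eval_add, eval_reg, eval_load, eval_seg,
      hE.c1, hE.c2, hE.c3, hE.c4, hci, ← hUdef, e10, eold, one_mul]
    rw [← hUdef] at ein
    rw [ein]
  · intro μ' h1 h2
    refine hQ μ' (fun t ht => ?_) (fun a ha ha' => h2 a ha (by omega))
    rw [← h1 t ht, add_assoc, add_assoc, add_assoc]

theorem wp_mask (hN : segLen n m k ≤ N) (hS : segLen n m k ≤ S)
    (H : Env q n m k P h L inp μ)
    (hQ : ∀ μ', (∀ t < m * k, μ' (2 * segLen n m k + t) =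
        if t % k = μ 10 then 0 else μ (2 * segLen n m k + t)) →
      (∀ a, a ≠ 12 → ¬(2 * segLen n m k ≤ a ∧ a < 2 * segLen n m k + m * k) → μ' a = μ a) →
      Q μ') :
    wp r 𝒪 S N mask Q μ := by
  have hU := le_segLen n m k
  set U := segLen n m k with hUdef
  have hS' : m * k < 2 ^ S := lt_of_le_of_lt (by omega) Nat.lt_two_pow_self
  refine wp_fill (m * k) (2 * U) (fun t => if t % k = μ 10 then 0 else μ (2 * U + t))
    ?_ (by omega) hS' (by omega) ?_ ?_ hQ
  · simp [Function.update_of_ne, H.c2, H.c3]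
  · intro hb t ht
    split_ifs
    · positivity
    · exact hb _
  · intro i hi μ' hci hμ'
    have hE : Env q n m k P h L inp μ' := H.congr fun a ha ha' =>
      hμ' a (by omega) (by omega)
    refine ⟨by simp [hE.c4, hci, ← hUdef], ?_⟩
    have e10 := hμ' 10 (by omega) (by omega)
    have eold := hμ' (2 * U + i) (by omega) (by omega)
    simp [hE.c3, hE.c4, hci, ← hUdef, e10, eold]

theorem wp_samples (hN : segLen n m k ≤ N) (hS : segLen n m k ≤ S) (hq : 0 < q)
    (hinp : ∀ i, inp i < q) (H : Env q n m k P h L inp μ)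
    (hQ : ∀ μ', (∀ i < m, μ' (2 * segLen n m k + (numDigits n m k + i)) < q ∧
        (μ' (2 * segLen n m k + (numDigits n m k + i)) : ZMod q) = inp (m * n + i) +
          ∑ j ∈ Finset.range k, (μ (2 * segLen n m k + (i * k + j)) : ZMod q) +
          ∑ j ∈ Finset.range (k * n),
            (μ (2 * segLen n m k + (m * k + k * n + (i * (k * n) + j))) : ZMod q) *
              μ (2 * segLen n m k + (m * k + j))) →
      (∀ a, a ≠ 12 → a ≠ 13 → a ≠ 14 → ¬(2 * segLen n m k + numDigits n m k ≤ a ∧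
        a < 2 * segLen n m k + (numDigits n m k + m)) → μ' a = μ a) → Q μ') :
    wp r 𝒪 S N samples Q μ := by
  have hU := le_segLen n m k
  have hD : numDigits n m k = m * k + k * n + m * (k * n) := rfl
  set U := segLen n m k with hUdef
  have hlt : ∀ x ≤ U, x < 2 ^ S := fun x hx => lt_of_le_of_lt (by omega) Nat.lt_two_pow_self
  intro hb0
  have hqS : q < 2 ^ S := H.c0 ▸ hb0 0
  refine wp_for m (fun i μ' => (∀ t < i, μ' (2 * U + (numDigits n m k + t)) < q ∧
        (μ' (2 * U + (numDigits n m k + t)) : ZMod q) = inp (m * n + t) +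
          ∑ j ∈ Finset.range k, (μ (2 * U + (t * k + j)) : ZMod q) +
          ∑ j ∈ Finset.range (k * n),
            (μ (2 * U + (m * k + k * n + (t * (k * n) + j))) : ZMod q) *
              μ (2 * U + (m * k + j))) ∧
      (∀ a, a ≠ 12 → a ≠ 13 → a ≠ 14 → ¬(2 * U + numDigits n m k ≤ a ∧
        a < 2 * U + (numDigits n m k + i)) → μ' a = μ a))
    (by simp [Function.update_of_ne, H.c2]) (by omega) (hlt _ (by omega)) ?_ ?_ ?_ hb0
  · exact ⟨fun t ht => absurd ht (by omega), fun a ha _ _ _ => Function.update_of_ne ha _ _⟩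
  · rintro i hi μ' hci ⟨h1, h2⟩
    have hE : Env q n m k P h L inp μ' := H.congr fun a ha ha' =>
      h2 a (by omega) (by omega) (by omega) (by omega)
    have hik : i * k + k ≤ m * k := by
      have := Nat.mul_le_mul_right k (show i + 1 ≤ m from hi); rwa [add_mul, one_mul] at this
    have hikn : i * (k * n) + k * n ≤ m * (k * n) := by
      have := Nat.mul_le_mul_right (k * n) (show i + 1 ≤ m from hi); rwa [add_mul, one_mul] at this
    have hk : k ≤ m * k := by
      have := Nat.mul_le_mul_right k (show 1 ≤ m by omega); rwa [one_mul] at this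
    have ein := hE.input (m * n + i) (by omega)
    rw [← hUdef] at ein
    refine wp_seq (wp_store (fun hb => by rw [eval_load]; exact hb _) ?_)
    simp only [eval_const, eval_load, eval_seg, eval_add, eval_mul, eval_reg, hE.c1, hE.c2, hE.c4,
      hci, one_mul, ← hUdef, ein]
    set μ₁ := Function.update μ' 14 (inp (m * n + i)) with hμ₁
    have hm1 : ∀ a, a ≠ 14 → μ₁ a = μ' a := fun a ha => Function.update_of_ne ha _ _
    have hm1' : μ₁ 14 = inp (m * n + i) := Function.update_self _ _ _
    refine wp_seq (wp_acc k q (fun j => μ (2 * U + (i * k + j)))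
      (by simp [Function.update_of_ne, hm1, hE.c3]) (by omega) (hlt _ (by omega))
      (by omega) hq (fun _ => hqS.le) (by rw [hm1']; exact hinp _) ?_ ?_)
    · intro j hj ν hcj hν
      have hν' : ∀ a, a ≠ 13 → a ≠ 14 → ν a = μ' a := fun a h1 h2 => by
        rw [hν a h1 h2, hm1 a h2]
      have hEν : Env q n m k P h L inp ν := hE.congr fun a ha ha' => hν' a (by omega) (by omega)
      refine ⟨by simp [hEν.c0], ?_⟩
      have e12 : ν 12 = i := by rw [hν' 12 (by omega) (by omega)]; exact hci
      simp only [eval_load, eval_seg, eval_add, eval_mul, eval_reg, hEν.c4, hEν.c3, e12, hcj,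
        ← hUdef]
      rw [hν' _ (by omega) (by omega), h2 _ (by omega) (by omega) (by omega) (by omega)]
    intro μ₂ hlt2 hval2 hfr2
    have hm2 : ∀ a, a ≠ 13 → a ≠ 14 → μ₂ a = μ' a := fun a h1 h2 => by
      rw [hfr2 a h1 h2, hm1 a h2]
    have hE2 : Env q n m k P h L inp μ₂ := hE.congr fun a ha ha' => hm2 a (by omega) (by omega)
    refine wp_seq (wp_acc (k * n) q (fun j => μ (2 * U + (m * k + k * n + (i * (k * n) + j))) *
        μ (2 * U + (m * k + j)))
      (by simp [Function.update_of_ne, hE2.c1, hE2.c3]) (by omega) (hlt _ (by omega))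
      (by omega) hq (fun _ => hqS.le) hlt2 ?_ ?_)
    · intro j hj ν hcj hν
      have hν' : ∀ a, a ≠ 13 → a ≠ 14 → ν a = μ' a := fun a h1 h2 => by
        rw [hν a h1 h2, hm2 a h1 h2]
      have hEν : Env q n m k P h L inp ν := hE.congr fun a ha ha' => hν' a (by omega) (by omega)
      refine ⟨by simp [hEν.c0], ?_⟩
      have e12 : ν 12 = i := by rw [hν' 12 (by omega) (by omega)]; exact hci
      simp only [eval_load, eval_seg, eval_add, eval_mul, eval_reg, hEν.c4, hEν.c3, hEν.c2,
        hEν.c1, e12, hcj, ← hUdef]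
      rw [hν' _ (by omega) (by omega), h2 _ (by omega) (by omega) (by omega) (by omega),
        hν' _ (by omega) (by omega), h2 _ (by omega) (by omega) (by omega) (by omega)]
    intro μ₃ hlt3 hval3 hfr3
    have hm3 : ∀ a, a ≠ 13 → a ≠ 14 → μ₃ a = μ' a := fun a h1 h2 => by
      rw [hfr3 a h1 h2, hm2 a h1 h2]
    have hE3 : Env q n m k P h L inp μ₃ := hE.congr fun a ha ha' => hm3 a (by omega) (by omega)
    have e12 : μ₃ 12 = i := by rw [hm3 12 (by omega) (by omega)]; exact hci
    refine wp_store (fun hb => by rw [eval_reg]; exact hb _) ?_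
    have ead : (seg 2 (digitsExpr + reg 12)).eval μ₃ = 2 * U + (numDigits n m k + i) := by
      simp [digitsExpr, hE3.c1, hE3.c2, hE3.c3, hE3.c4, e12, hUdef, numDigits]
    rw [ead, eval_reg]
    refine ⟨by rw [Function.update_of_ne (by omega)]; exact e12, fun t ht => ?_,
      fun a ha ha1 ha2 ha3 => ?_⟩
    · rw [Function.update_of_ne (by omega)]
      by_cases hti : t = i
      · subst hti
        rw [Function.update_self]
        refine ⟨hlt3, ?_⟩
        rw [hval3, hval2, hm1']
        simp
      · rw [Function.update_of_ne (by omega), hm3 _ (by omega) (by omega)]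
        exact h1 t (by omega)
    · rw [Function.update_of_ne ha, Function.update_of_ne (by omega), hm3 a ha1 ha2]
      exact h2 a ha ha1 ha2 (by omega)
  · rintro μ' ⟨h1, h2⟩
    exact hQ μ' h1 h2

end Specs


/-! ### Preparing a query and assessing its answer -/

section Specs

variable {r : Fin 3 → ℝ} {𝒪 : Oracle} {S N : ℕ} {q n m k P h L : ℕ} {inp : ℕ → ℕ}
  {Q : Mem → Prop} {μ : Mem}

/-- A single random number `v` supplies everything: its remainder modulo `k` is the planted
position, its quotient the random digits. -/
theorem wp_prepare (hN : segLen n m k ≤ N) (hS : segLen n m k ≤ S) (hq : 0 < q)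
    (hinp : ∀ i, inp i < q) (H : Env q n m k P h L inp μ) {v : ℕ} (hv : μ 11 = v)
    (hQ : ∀ μ', μ' 10 = v % k →
      (∀ t < k * n, μ' (2 * segLen n m k + (m * k + t)) = shiftSecret q m k P h (v / k) t) →
      (∀ t < m * (k * n), μ' (2 * segLen n m k + (m * k + k * n + t)) =
        plantedMatrix q n m k P h inp (v % k) (v / k) t) →
      (∀ i < m, μ' (2 * segLen n m k + (numDigits n m k + i)) < q ∧
        (μ' (2 * segLen n m k + (numDigits n m k + i)) : ZMod q) = inp (m * n + i) +
          ∑ j ∈ Finset.range k, (maskedNoise q m k P h (v % k) (v / k) (i * k + j) : ZMod q) +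
          ∑ j ∈ Finset.range (k * n),
            (plantedMatrix q n m k P h inp (v % k) (v / k) (i * (k * n) + j) : ZMod q) *
              shiftSecret q m k P h (v / k) j) →
      (∀ a, a < 10 ∨ (segLen n m k ≤ a ∧ a < 2 * segLen n m k) ∨ 3 * segLen n m k ≤ a →
        μ' a = μ a) → Q μ') :
    wp r 𝒪 S N prepare Q μ := by
  have hU := le_segLen n m k
  have hD : numDigits n m k = m * k + k * n + m * (k * n) := rfl
  set U := segLen n m k with hUdef
  intro hb
  have hv' : v < 2 ^ S := hv ▸ hb 11
  refine wp_seq (wp_store (fun _ => ?_) (wp_seq (wp_store (fun _ => ?_) ?_))) hb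
  · simp only [eval_mod, eval_reg, hv]
    exact lt_of_le_of_lt (Nat.mod_le _ _) hv'
  · simp only [eval_mod, eval_div, eval_reg, eval_ofNat, hv]
    rw [Function.update_of_ne (by omega), hv]
    exact lt_of_le_of_lt (Nat.div_le_self _ _) hv'
  simp only [eval_mod, eval_div, eval_reg, eval_ofNat, hv, H.c3]
  rw [Function.update_of_ne (by omega), hv, Function.update_of_ne (by omega), H.c3]
  set μ₁ := Function.update (Function.update μ 10 (v % k)) 11 (v / k) with hμ₁
  have f1 : ∀ a, a ≠ 10 → a ≠ 11 → μ₁ a = μ a := fun a h1 h2 => by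
    rw [hμ₁, Function.update_of_ne h2, Function.update_of_ne h1]
  have p1 : μ₁ 10 = v % k := by
    rw [hμ₁, Function.update_of_ne (by omega), Function.update_self]
  have x1 : μ₁ 11 = v / k := Function.update_self _ _ _
  have E1 : Env q n m k P h L inp μ₁ := H.congr fun a _ _ => f1 a (by omega) (by omega)
  refine wp_seq (wp_unpack hN hS hq E1 x1 fun μ₂ g2 f2 => ?_)
  rw [← hUdef] at g2 f2
  have E2 : Env q n m k P h L inp μ₂ := E1.congr fun a _ _ =>
    f2 a (by omega) (by omega) (by omega)
  have p2 : μ₂ 10 = v % k := by rw [f2 10 (by omega) (by omega) (by omega), p1]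
  refine wp_seq (wp_plant hN hS E2 fun μ₃ g3 f3 => ?_)
  rw [← hUdef] at g3 f3
  have E3 : Env q n m k P h L inp μ₃ := E2.congr fun a _ _ => f3 a (by omega) (by omega)
  have p3 : μ₃ 10 = v % k := by rw [f3 10 (by omega) (by omega), p2]
  refine wp_seq (wp_mask hN hS E3 fun μ₄ g4 f4 => ?_)
  rw [← hUdef] at g4 f4
  have E4 : Env q n m k P h L inp μ₄ := E3.congr fun a _ _ => f4 a (by omega) (by omega)
  have p4 : μ₄ 10 = v % k := by rw [f4 10 (by omega) (by omega), p3]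
  have noise4 : ∀ t < m * k, μ₄ (2 * U + t) = maskedNoise q m k P h (v % k) (v / k) t := by
    intro t ht
    rw [g4 t ht, p3, f3 _ (by omega) (by omega), g2 t (by omega), maskedNoise]
  have sec4 : ∀ t < k * n, μ₄ (2 * U + (m * k + t)) = shiftSecret q m k P h (v / k) t := by
    intro t ht
    rw [f4 _ (by omega) (by omega), f3 _ (by omega) (by omega), g2 _ (by omega), shiftSecret]
  have mat4 : ∀ t < m * (k * n), μ₄ (2 * U + (m * k + k * n + t)) =
      plantedMatrix q n m k P h inp (v % k) (v / k) t := by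
    intro t ht
    rw [f4 _ (by omega) (by omega), g3 t ht, p2, g2 _ (by omega), plantedMatrix]
  refine wp_samples hN hS hq hinp E4 fun μ₅ g5 f5 => ?_
  rw [← hUdef] at g5 f5
  refine hQ μ₅ ?_ ?_ ?_ ?_ ?_
  · rw [f5 10 (by omega) (by omega) (by omega) (by omega), p4]
  · intro t ht
    rw [f5 _ (by omega) (by omega) (by omega) (by omega), sec4 t ht]
  · intro t ht
    rw [f5 _ (by omega) (by omega) (by omega) (by omega), mat4 t ht]
  · intro i hi
    refine ⟨(g5 i hi).1, ?_⟩
    rw [(g5 i hi).2]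
    have hik : i * k + k ≤ m * k := by
      have := Nat.mul_le_mul_right k (show i + 1 ≤ m from hi); rwa [add_mul, one_mul] at this
    have hikn : i * (k * n) + k * n ≤ m * (k * n) := by
      have := Nat.mul_le_mul_right (k * n) (show i + 1 ≤ m from hi); rwa [add_mul, one_mul] at this
    congr 1
    · congr 1
      refine Finset.sum_congr rfl fun j hj => ?_
      rw [Finset.mem_range] at hj
      rw [noise4 _ (by omega)]
    · refine Finset.sum_congr rfl fun j hj => ?_
      rw [Finset.mem_range] at hj
      rw [mat4 _ (by omega), sec4 _ hj]
  · intro a ha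
    rw [f5 a (by omega) (by omega) (by omega) (by omega), f4 a (by omega) (by omega),
      f3 a (by omega) (by omega), f2 a (by omega) (by omega) (by omega),
      f1 a (by omega) (by omega)]

/-- The number of samples of the input `inp` that the vector `z` violates. -/
def violations (q n m : ℕ) (inp : ℕ → ℕ) (z : ℕ → ZMod q) : ℕ :=
  ∑ i ∈ Finset.range m,
    if ∑ j ∈ Finset.range n, (inp (i * n + j) : ZMod q) * z j = inp (m * n + i) then 0 else 1

/-- This lets the program test equations over `ZMod q` by comparing reduced representatives. -/
theorem natCast_inj_of_lt {q a b : ℕ} (ha : a < q) (hb : b < q) :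
    (a : ZMod q) = b ↔ a = b := by
  rw [ZMod.natCast_eq_natCast_iff, Nat.ModEq, Nat.mod_eq_of_lt ha, Nat.mod_eq_of_lt hb]

theorem wp_evaluate (hN : segLen n m k ≤ N) (hS : segLen n m k ≤ S) (hq : 0 < q) (hk : 0 < k)
    (hinp : ∀ i, inp i < q) (H : Env q n m k P h L inp μ)
    (hQ : ∀ μ', μ' 15 = violations q n m inp (fun j => (μ (4 * segLen n m k + j) : ZMod q)) →
      (∀ a, a < 12 ∨ 16 ≤ a → μ' a = μ a) → Q μ') :
    wp r 𝒪 S N evaluate Q μ := by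
  have hU := le_segLen n m k
  have hnk : n ≤ k * n := Nat.le_mul_of_pos_left n hk
  set U := segLen n m k with hUdef
  have hlt : ∀ x ≤ U, x < 2 ^ S := fun x hx => lt_of_le_of_lt (by omega) Nat.lt_two_pow_self
  intro hb0
  have hqS : q < 2 ^ S := H.c0 ▸ hb0 0
  refine wp_seq (wp_store (fun _ => by simp) ?_) hb0
  simp only [eval_const, eval_zero]
  have f1 : ∀ a, a ≠ 15 → Function.update μ 15 0 a = μ a := fun a ha =>
    Function.update_of_ne ha _ _
  set μ₁ := Function.update μ 15 0 with hμ₁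
  have E1 : Env q n m k P h L inp μ₁ := H.congr fun a _ _ => f1 a (by omega)
  refine wp_for m (fun i μ' => μ' 15 =
    (∑ i ∈ Finset.range i, if ∑ j ∈ Finset.range n,
      (inp (i * n + j) : ZMod q) * (μ (4 * U + j) : ZMod q) = inp (m * n + i) then 0 else 1) ∧
      ∀ a, a < 12 ∨ 16 ≤ a → μ' a = μ a)
    (by simp [Function.update_of_ne, E1.c2]) (by omega) (hlt _ (by omega)) ?_ ?_ ?_
  · refine ⟨by rw [Function.update_of_ne (by omega)]; simp [hμ₁], fun a ha => ?_⟩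
    rw [Function.update_of_ne (by omega), f1 a (by omega)]
  · rintro i hi μ' hci ⟨h1, h2⟩
    have hE : Env q n m k P h L inp μ' := H.congr fun a ha ha' => h2 a (by omega)
    have hin : i * n + n ≤ m * n := by
      have := Nat.mul_le_mul_right n (show i + 1 ≤ m from hi); rwa [add_mul, one_mul] at this
    have hnm : n ≤ m * n := by omega
    have ein := hE.input (m * n + i) (by omega)
    rw [← hUdef] at ein
    refine wp_seq (wp_store (fun _ => by simp) ?_)
    simp only [eval_const, eval_zero]
    set μ₂ := Function.update μ' 14 0 with hμ₂
    have f2 : ∀ a, a ≠ 14 → μ₂ a = μ' a := fun a ha => Function.update_of_ne ha _ _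
    refine wp_seq (wp_acc n q (fun j => inp (i * n + j) * μ (4 * U + j))
      (by simp [Function.update_of_ne, f2, hE.c1]) (by omega) (hlt _ (by omega))
      (by omega) hq (fun _ => hqS.le) (by simpa [hμ₂] using hq) ?_ ?_)
    · intro j hj ν hcj hν
      have hν' : ∀ a, a ≠ 13 → a ≠ 14 → ν a = μ' a := fun a h1 h2 => by
        rw [hν a h1 h2, f2 a h2]
      have hEν : Env q n m k P h L inp ν := hE.congr fun a ha ha' => hν' a (by omega) (by omega)
      refine ⟨by simp [hEν.c0], ?_⟩
      have e12 : ν 12 = i := by rw [hν' 12 (by omega) (by omega)]; exact hci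
      have ein' := hEν.input (i * n + j) (by omega)
      rw [← hUdef] at ein'
      simp only [eval_load, eval_seg, eval_add, eval_mul, eval_reg, hEν.c4, hEν.c1, e12, hcj,
        ← hUdef, one_mul, ein']
      rw [hν' _ (by omega) (by omega), h2 _ (by omega)]
    intro μ₃ hlt3 hval3 hfr3
    have hm3 : ∀ a, a ≠ 13 → a ≠ 14 → μ₃ a = μ' a := fun a h1 h2 => by
      rw [hfr3 a h1 h2, f2 a h2]
    have hE3 : Env q n m k P h L inp μ₃ := hE.congr fun a ha ha' => hm3 a (by omega) (by omega)
    have e12 : μ₃ 12 = i := by rw [hm3 12 (by omega) (by omega)]; exact hci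
    have e15 : μ₃ 15 = μ' 15 := hm3 15 (by omega) (by omega)
    have hval : (reg 15 + (1 - Expr.eqv (reg 14)
        (.load (seg 1 (reg 2 * reg 1 + reg 12))))).eval μ₃ =
        ∑ i ∈ Finset.range (i + 1), if ∑ j ∈ Finset.range n,
          (inp (i * n + j) : ZMod q) * (μ (4 * U + j) : ZMod q) = inp (m * n + i)
            then 0 else 1 := by
      have ein3 := hE3.input (m * n + i) (by omega)
      rw [← hUdef] at ein3
      simp only [eval_add, eval_sub, eval_reg, eval_one, eval_eqv, eval_load, eval_seg, eval_mul,
        hE3.c1, hE3.c2, hE3.c4, e12, one_mul, ← hUdef, ein3]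
      rw [Finset.sum_range_succ, e15, h1]
      congr 1
      have : (μ₃ 14 : ZMod q) = ∑ j ∈ Finset.range n,
          (inp (i * n + j) : ZMod q) * (μ (4 * U + j) : ZMod q) := by
        rw [hval3]; simp [hμ₂]
      simp only [← this, natCast_inj_of_lt hlt3 (hinp _)]
      split_ifs <;> rfl
    have hle : (∑ i ∈ Finset.range (i + 1), if ∑ j ∈ Finset.range n,
          (inp (i * n + j) : ZMod q) * (μ (4 * U + j) : ZMod q) = inp (m * n + i)
            then 0 else 1) ≤ i + 1 := by
      refine (Finset.sum_le_card_nsmul _ _ 1 fun _ _ => ?_).trans (by simp)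
      split_ifs <;> simp
    refine wp_store (fun _ => by rw [hval]; exact hlt _ (by omega)) ?_
    rw [hval, eval_const]
    refine ⟨by rw [Function.update_of_ne (by omega)]; exact e12, ?_, fun a ha => ?_⟩
    · rw [Function.update_of_ne (by omega), Function.update_self]
    · rw [Function.update_of_ne (by omega), Function.update_of_ne (by omega),
        hm3 a (by omega) (by omega)]
      exact h2 a ha
  · rintro μ' ⟨h1, h2⟩
    exact hQ μ' h1 h2

theorem wp_candidate (hN : segLen n m k ≤ N) (hS : segLen n m k ≤ S) (hq : 0 < q)
    (H : Env q n m k P h L inp μ) (hpos : μ 10 < k)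
    (hsec : ∀ t < k * n, μ (2 * segLen n m k + (m * k + t)) < q)
    (hQ : ∀ μ', (∀ j < n, (μ' (4 * segLen n m k + j) : ZMod q) =
        μ (3 * segLen n m k + (μ 10 * n + j)) -
          μ (2 * segLen n m k + (m * k + (μ 10 * n + j)))) →
      (∀ a, a ≠ 12 → ¬(4 * segLen n m k ≤ a ∧ a < 4 * segLen n m k + n) → μ' a = μ a) → Q μ') :
    wp r 𝒪 S N candidate Q μ := by
  have hU := le_segLen n m k
  have hnk : n ≤ k * n := Nat.le_mul_of_pos_left n (by omega)
  have hposn : μ 10 * n + n ≤ k * n := by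
    have := Nat.mul_le_mul_right n (show μ 10 + 1 ≤ k from hpos); rwa [add_mul, one_mul] at this
  set U := segLen n m k with hUdef
  intro hb
  have hqS : q < 2 ^ S := H.c0 ▸ hb 0
  refine wp_fill n (4 * U) (fun j => (μ (3 * U + (μ 10 * n + j)) +
      (q - μ (2 * U + (m * k + (μ 10 * n + j))))) % q)
    (by simp [Function.update_of_ne, H.c1]) (by omega)
    (lt_of_le_of_lt (by omega) Nat.lt_two_pow_self) (by omega) ?_ ?_ ?_ hb
  · exact fun _ i _ => (Nat.mod_lt _ hq).trans hqS
  · intro i hi μ' hci hμ'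
    have hE : Env q n m k P h L inp μ' := H.congr fun a ha ha' =>
      hμ' a (by omega) (by omega)
    have e10 := hμ' 10 (by omega) (by omega)
    refine ⟨by simp [hE.c4, hci, ← hUdef], ?_⟩
    simp only [eval_mod, eval_add, eval_sub, eval_load, eval_seg, eval_mul, eval_reg, hE.c0,
      hE.c1, hE.c2, hE.c3, hE.c4, e10, hci, ← hUdef]
    rw [hμ' _ (by omega) (by omega), hμ' _ (by omega) (by omega)]
  · intro μ' h1 h2
    refine hQ μ' (fun j hj => ?_) h2
    -- The shift is below `q`, so the truncated difference `q - shift` is a true one and represents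
    -- its negative.
    rw [h1 j hj, ZMod.natCast_mod, Nat.cast_add, Nat.cast_sub (hsec _ (by omega)).le]
    simp [sub_eq_add_neg]

theorem wp_keepBest (hN : segLen n m k ≤ N) (hS : segLen n m k ≤ S) (hk : 0 < k)
    (H : Env q n m k P h L inp μ)
    (hQ : ∀ μ', (if μ 15 < μ 9 then μ' 9 = μ 15 ∧
          ∀ j < n, μ' (5 * segLen n m k + j) = μ (4 * segLen n m k + j)
        else μ' = μ) →
      (∀ a < 5 * segLen n m k, a ≠ 9 → a ≠ 12 → μ' a = μ a) → Q μ') :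
    wp r 𝒪 S N keepBest Q μ := by
  have hU := le_segLen n m k
  have hnk : n ≤ k * n := Nat.le_mul_of_pos_left n hk
  set U := segLen n m k with hUdef
  refine wp_ite (fun hc => ?_) (fun hc => wp_skip ?_)
  · have hlt : μ 15 < μ 9 := by
      by_contra hcon; exact hc (by simp only [eval_lt, eval_reg, if_neg hcon])
    refine wp_seq (wp_store (fun hb => by rw [eval_reg]; exact hb _) ?_)
    rw [eval_const, eval_reg]
    set μ₁ := Function.update μ 9 (μ 15) with hμ₁
    have f1 : ∀ a, a ≠ 9 → μ₁ a = μ a := fun a ha => Function.update_of_ne ha _ _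
    refine wp_fill n (5 * U) (fun j => μ (4 * U + j))
      (by simp [Function.update_of_ne, f1, H.c1]) (by omega)
      (lt_of_le_of_lt (by omega) Nat.lt_two_pow_self) (by omega) ?_ ?_ ?_
    · intro hb i _
      rw [← f1 _ (by omega)]; exact hb _
    · intro i hi μ' hci hμ'
      have e4 : μ' 4 = U := by rw [hμ' 4 (by omega) (by omega), f1 4 (by omega), H.c4]
      refine ⟨by simp [e4, hci], ?_⟩
      simp only [eval_load, eval_seg, eval_reg, e4, hci]
      rw [hμ' _ (by omega) (by omega), f1 _ (by omega)]
    · intro μ' h1 h2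
      refine hQ μ' ?_ fun a ha h9 h12 => ?_
      · rw [if_pos hlt]
        exact ⟨by rw [h2 9 (by omega) (by omega), hμ₁, Function.update_self], h1⟩
      · rw [h2 a h12 (by omega), f1 a h9]
  · have hlt : ¬ μ 15 < μ 9 := by
      intro hcon; simp only [eval_lt, eval_reg, if_pos hcon] at hc; omega
    exact hQ μ (by rw [if_neg hlt]) fun _ _ _ _ => rfl

/-- The effect of a trial on the best candidate, when the new candidate is `z`. -/
def Updates (q n m k : ℕ) (inp : ℕ → ℕ) (z : ℕ → ZMod q) (μ μ' : Mem) : Prop :=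
  if violations q n m inp z < μ 9 then μ' 9 = violations q n m inp z ∧
      ∀ j < n, (μ' (5 * segLen n m k + j) : ZMod q) = z j
    else μ' 9 = μ 9 ∧ ∀ j < n, μ' (5 * segLen n m k + j) = μ (5 * segLen n m k + j)

theorem violations_congr {z z' : ℕ → ZMod q} (hz : ∀ j < n, z j = z' j) :
    violations q n m inp z = violations q n m inp z' := by
  unfold violations
  refine Finset.sum_congr rfl fun i _ => ?_
  rw [Finset.sum_congr rfl fun j hj => by rw [hz j (Finset.mem_range.mp hj)]]

theorem wp_assess (hN : segLen n m k ≤ N) (hS : segLen n m k ≤ S) (hq : 0 < q)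
    (hinp : ∀ i, inp i < q) (H : Env q n m k P h L inp μ) (hpos : μ 10 < k)
    (hsec : ∀ t < k * n, μ (2 * segLen n m k + (m * k + t)) < q)
    (hQ : ∀ μ', Env q n m k P h L inp μ' → μ' 7 = μ 7 →
      Updates q n m k inp (fun j => (μ (3 * segLen n m k + (μ 10 * n + j)) : ZMod q) -
          μ (2 * segLen n m k + (m * k + (μ 10 * n + j)))) μ μ' → Q μ') :
    wp r 𝒪 S N assess Q μ := by
  have hU := le_segLen n m k
  have hnk : n ≤ k * n := Nat.le_mul_of_pos_left n (by omega)
  have hk : 0 < k := by omega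
  refine wp_seq (wp_candidate hN hS hq H hpos hsec fun μ₁ g1 f1 => ?_)
  have E1 : Env q n m k P h L inp μ₁ := H.congr fun a _ _ => f1 a (by omega) (by omega)
  refine wp_seq (wp_evaluate hN hS hq hk hinp E1 fun μ₂ g2 f2 => ?_)
  have E2 : Env q n m k P h L inp μ₂ := E1.congr fun a _ _ => f2 a (by omega)
  refine wp_keepBest hN hS hk E2 fun μ₃ g3 f3 => ?_
  have E3 : Env q n m k P h L inp μ₃ := E2.congr fun a _ _ =>
    f3 a (by omega) (by omega) (by omega)
  refine hQ μ₃ E3 ?_ ?_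
  · rw [f3 7 (by omega) (by omega) (by omega), f2 7 (by omega), f1 7 (by omega) (by omega)]
  · have hv : μ₂ 15 = violations q n m inp (fun j =>
        (μ (3 * segLen n m k + (μ 10 * n + j)) : ZMod q) -
          μ (2 * segLen n m k + (m * k + (μ 10 * n + j)))) := by
      rw [g2]
      exact violations_congr g1
    have h9 : μ₂ 9 = μ 9 := by rw [f2 9 (by omega), f1 9 (by omega) (by omega)]
    unfold Updates
    rw [← hv, ← h9]
    split_ifs at g3 ⊢ with hc
    · refine ⟨g3.1, fun j hj => ?_⟩
      rw [g3.2 j hj, f2 _ (by omega), g1 j hj]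
    · subst g3
      refine ⟨rfl, fun j hj => ?_⟩
      rw [f2 _ (by omega), f1 _ (by omega) (by omega)]

end Specs


/-! ### Initialisation and output -/

section Specs

variable {r : Fin 3 → ℝ} {𝒪 : Oracle} {S N : ℕ} {q n m k P h L : ℕ} {inp : ℕ → ℕ}
  {Q : Mem → Prop} {μ : Mem}

/-- The precision of the approximations of the real parameters. -/
def prec (q n m k : ℕ) : ℕ := 2 * m + k + n * Nat.size q

/-- The number of coins that one trial tosses. -/
def numCoins (q n m k P : ℕ) : ℕ := numDigits n m k * Nat.size (q * P) + Nat.size k + 2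

theorem eval_segExpr (h1 : μ 1 = n) (h2 : μ 2 = m) (h3 : μ 3 = k) :
    segExpr.eval μ = segLen n m k := by
  simp [segExpr, digitsExpr, h1, h2, h3, segLen, numDigits]

theorem wp_moveInput (hN : segLen n m k ≤ N) (hS : segLen n m k ≤ S) (h1 : μ 1 = n)
    (h2 : μ 2 = m) (h3 : μ 3 = k) (hinp : ∀ i < m * n + m, μ (4 + i) = inp i)
    (h0 : ∀ a, 4 + (m * n + m) ≤ a → μ a = 0)
    (hQ : ∀ μ', (∀ a < 4, μ' a = μ a) →
      (∀ i < m * n + m, μ' (segLen n m k + i) = inp i) → Q μ') :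
    wp r 𝒪 S N moveInput Q μ := by
  have hU := le_segLen n m k
  set U := segLen n m k with hUdef
  have hlt : ∀ x ≤ U, x < 2 ^ S := fun x hx => lt_of_le_of_lt (by omega) Nat.lt_two_pow_self
  have hc : (reg 2 * reg 1 + reg 2).eval μ = m * n + m := by simp [h1, h2]
  refine wp_loop (fun i μ' => (∀ a < U, μ' a = μ a) ∧ μ' (2 * U) = i ∧
    ∀ t < i, μ' (U + t) = inp t) (by omega) ?_ ?_ ?_
  · exact ⟨fun _ _ => rfl, h0 _ (by omega), fun t ht => absurd ht (by omega)⟩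
  · rintro i hi μ' ⟨g1, g2, g3⟩
    rw [hc] at hi
    have e : ∀ ν : Mem, (∀ a < U, ν a = μ a) → segExpr.eval ν = U := fun ν hν =>
      eval_segExpr (by rw [hν 1 (by omega), h1]) (by rw [hν 2 (by omega), h2])
        (by rw [hν 3 (by omega), h3])
    have ev : (Expr.load (4 + .load (2 * segExpr))).eval μ' = inp i := by
      simp only [eval_load, eval_add, eval_mul, eval_ofNat, e μ' g1, g2]
      rw [g1 _ (by omega), hinp i hi]
    have ea : (segExpr + .load (2 * segExpr)).eval μ' = U + i := by
      simp only [eval_load, eval_add, eval_mul, eval_ofNat, e μ' g1, g2]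
    refine wp_seq (wp_store (fun hb => by rw [eval_load]; exact hb _) ?_)
    rw [ea, ev]
    have g1' : ∀ a < U, Function.update μ' (U + i) (inp i) a = μ a := fun a ha => by
      rw [Function.update_of_ne (by omega), g1 a ha]
    have ev' : (Expr.load (2 * segExpr) + 1).eval (Function.update μ' (U + i) (inp i)) =
        i + 1 := by
      simp only [eval_load, eval_add, eval_mul, eval_ofNat, e _ g1']
      rw [Function.update_of_ne (by omega), g2]
    refine wp_store (fun _ => by rw [ev']; exact hlt _ (by omega)) ?_
    rw [ev']
    simp only [eval_mul, eval_ofNat, e _ g1']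
    refine ⟨fun a ha => ?_, Function.update_self _ _ _, fun t ht => ?_⟩
    · rw [Function.update_of_ne (by omega), g1' a ha]
    · rw [Function.update_of_ne (by omega)]
      by_cases hti : t = i
      · subst hti; exact Function.update_self _ _ _
      · rw [Function.update_of_ne (by omega)]; exact g3 t (by omega)
  · rintro μ' ⟨g1, -, g3⟩
    rw [hc] at g3
    exact hQ μ' (fun a ha => g1 a (by omega)) g3

theorem floor_mul_le {x : ℝ} (hx : x ≤ 1) (p : ℕ) : ⌊(2 : ℝ) ^ p * x⌋₊ ≤ 2 ^ p := by
  have : (2 : ℝ) ^ p * x ≤ ((2 ^ p : ℕ) : ℝ) := by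
    push_cast
    exact mul_le_of_le_one_right (by positivity) hx
  calc _ ≤ ⌊((2 ^ p : ℕ) : ℝ)⌋₊ := Nat.floor_le_floor this
    _ = 2 ^ p := Nat.floor_natCast _

/-- The number of trials. -/
noncomputable def numTrials (q n m k : ℕ) (ε : ℝ) : ℕ :=
  16 * k * (2 ^ prec q n m k / ⌊(2 : ℝ) ^ prec q n m k * ε⌋₊ + 1)

theorem wp_setup (hN : segLen n m k ≤ N) (hS : segLen n m k ≤ S) (h0 : μ 0 = q) (h1 : μ 1 = n)
    (h2 : μ 2 = m) (h3 : μ 3 = k) (hinp : ∀ i < m * n + m, μ (4 + i) = inp i)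
    (hz : ∀ a, 4 + (m * n + m) ≤ a → μ a = 0) (hr0 : r 0 ≤ 1) (hr2 : r 2 ≤ 1)
    (hpN : prec q n m k ≤ N) (hpS : prec q n m k < S)
    (hT : numTrials q n m k (r 2) < 2 ^ S)
    (hL : numCoins q n m k (2 ^ prec q n m k) < 2 ^ S)
    (hQ : ∀ μ', Env q n m k (2 ^ prec q n m k) ⌊(2 : ℝ) ^ prec q n m k * r 0⌋₊
        (numCoins q n m k (2 ^ prec q n m k)) inp μ' → μ' 7 = numTrials q n m k (r 2) →
      μ' 9 = m + 1 → Q μ') :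
    wp r 𝒪 S N setup Q μ := by
  have hU := le_segLen n m k
  set U := segLen n m k with hUdef
  have hlt : ∀ x ≤ U, x < 2 ^ S := fun x hx => lt_of_le_of_lt (by omega) Nat.lt_two_pow_self
  set p := prec q n m k with hp
  have hpow : ∀ x ≤ 2 ^ p, x < 2 ^ S := fun x hx =>
    lt_of_le_of_lt hx (Nat.pow_lt_pow_right (by norm_num) hpS)
  refine wp_seq (wp_moveInput hN hS h1 h2 h3 hinp hz fun μ₁ f1 g1 => ?_)
  rw [← hUdef] at g1
  have e10 : μ₁ 0 = q := by rw [f1 0 (by omega), h0]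
  have e11 : μ₁ 1 = n := by rw [f1 1 (by omega), h1]
  have e12 : μ₁ 2 = m := by rw [f1 2 (by omega), h2]
  have e13 : μ₁ 3 = k := by rw [f1 3 (by omega), h3]
  have eseg := eval_segExpr e11 e12 e13
  refine wp_seq (wp_store (fun _ => by rw [eseg]; exact hlt _ le_rfl) ?_)
  rw [eseg, eval_const, ← hUdef]
  refine wp_seq (wp_store (fun _ => by rw [eval_one]; exact hlt _ (by omega)) ?_)
  rw [eval_const, eval_one]
  set μ₂ := Function.update (Function.update μ₁ 4 U) 5 1 with hμ₂
  have f2 : ∀ a, a ≠ 4 → a ≠ 5 → μ₂ a = μ₁ a := fun a ha hb => by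
    rw [hμ₂, Function.update_of_ne hb, Function.update_of_ne ha]
  have eprec : ∀ ν : Mem, (∀ a < 4, ν a = μ a) → precExpr.eval ν = p := fun ν hν => by
    simp only [precExpr, eval_add, eval_mul, eval_ofNat, eval_reg, eval_size, hν 0 (by omega),
      hν 1 (by omega), hν 2 (by omega), hν 3 (by omega), h0, h1, h2, h3, hp, prec]
  have f2' : ∀ a < 4, μ₂ a = μ a := fun a ha => by rw [f2 a (by omega) (by omega), f1 a ha]
  refine wp_seq (wp_loop (fun i μ' => μ' 5 = 2 ^ i ∧ ∀ a, a ≠ 5 → μ' a = μ₂ a)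
    (by rw [eprec _ f2']; exact hpN) ?_ ?_ ?_)
  · exact ⟨by simp [hμ₂], fun _ _ => rfl⟩
  · rintro i hi μ' ⟨g, f⟩
    rw [eprec _ f2'] at hi
    have ev : (reg 5 * 2).eval μ' = 2 ^ (i + 1) := by simp [g, pow_succ]
    refine wp_store (fun _ => ?_) ?_
    · rw [ev]; exact hpow _ (Nat.pow_le_pow_right (by norm_num) hi)
    · rw [ev, eval_const]
      exact ⟨Function.update_self _ _ _, fun a ha => by rw [Function.update_of_ne ha, f a ha]⟩
  rw [eprec _ f2']
  rintro μ₃ ⟨g3, f3⟩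
  have f3' : ∀ a < 4, μ₃ a = μ a := fun a ha => by rw [f3 a (by omega), f2' a ha]
  refine wp_seq (wp_approx (by rw [eprec _ f3']; exact hpN) ?_ ?_)
  · rw [eprec _ f3']; exact hpow _ (floor_mul_le hr0 p)
  rw [eprec _ f3', eval_const]
  set μ₄ := Function.update μ₃ 6 ⌊(2 : ℝ) ^ p * r 0⌋₊ with hμ₄
  have f4 : ∀ a, a ≠ 6 → μ₄ a = μ₃ a := fun a ha => Function.update_of_ne ha _ _
  have f4' : ∀ a < 4, μ₄ a = μ a := fun a ha => by rw [f4 a (by omega), f3' a ha]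
  refine wp_seq (wp_approx (by rw [eprec _ f4']; exact hpN) ?_ ?_)
  · rw [eprec _ f4']; exact hpow _ (floor_mul_le hr2 p)
  rw [eprec _ f4', eval_const]
  set μ₅ := Function.update μ₄ 7 ⌊(2 : ℝ) ^ p * r 2⌋₊ with hμ₅
  have f5 : ∀ a, a ≠ 7 → μ₅ a = μ₄ a := fun a ha => Function.update_of_ne ha _ _
  have e55 : μ₅ 5 = 2 ^ p := by rw [f5 5 (by omega), f4 5 (by omega), g3]
  have f5' : ∀ a < 4, μ₅ a = μ a := fun a ha => by rw [f5 a (by omega), f4' a ha]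
  have eT : (16 * reg 3 * (reg 5 / reg 7 + 1)).eval μ₅ = numTrials q n m k (r 2) := by
    simp only [eval_mul, eval_div, eval_add, eval_reg, eval_ofNat, e55,
      f5' 3 (by omega), h3, numTrials, ← hp]
    rw [hμ₅, Function.update_self]
  refine wp_seq (wp_store (fun _ => by rw [eT]; exact hT) ?_)
  rw [eT, eval_const]
  set μ₆ := Function.update μ₅ 7 (numTrials q n m k (r 2)) with hμ₆
  have f6 : ∀ a, a ≠ 7 → μ₆ a = μ₅ a := fun a ha => Function.update_of_ne ha _ _
  have f6' : ∀ a < 4, μ₆ a = μ a := fun a ha => by rw [f6 a (by omega), f5' a ha]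
  have eL : (digitsExpr * .size (reg 0 * reg 5) + .size (reg 3) + 2).eval μ₆ =
      numCoins q n m k (2 ^ p) := by
    simp only [eval_mul, eval_size, eval_add, eval_reg, eval_ofNat, digitsExpr,
      f6' 0 (by omega), f6' 1 (by omega), f6' 2 (by omega), f6' 3 (by omega), f6 5 (by omega),
      e55, h0, h1, h2, h3, numCoins, numDigits]
  refine wp_seq (wp_store (fun _ => by rw [eL]; exact hL) ?_)
  rw [eL, eval_const]
  set μ₇ := Function.update μ₆ 8 (numCoins q n m k (2 ^ p)) with hμ₇
  have f7 : ∀ a, a ≠ 8 → μ₇ a = μ₆ a := fun a ha => Function.update_of_ne ha _ _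
  have f7' : ∀ a < 4, μ₇ a = μ a := fun a ha => by rw [f7 a (by omega), f6' a ha]
  have e9 : (reg 2 + 1).eval μ₇ = m + 1 := by
    simp only [eval_add, eval_reg, eval_one, f7' 2 (by omega), h2]
  refine wp_store (fun _ => by rw [e9]; exact hlt _ (by omega)) ?_
  rw [e9, eval_const]
  have f8 : ∀ a, a ≠ 9 → Function.update μ₇ 9 (m + 1) a = μ₇ a := fun a ha =>
    Function.update_of_ne ha _ _
  have far : ∀ a, 9 < a → Function.update μ₇ 9 (m + 1) a = μ₁ a := fun a ha => by
    rw [f8 a (by omega), f7 a (by omega), f6 a (by omega), f5 a (by omega), f4 a (by omega),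
      f3 a (by omega), f2 a (by omega) (by omega)]
  have e4 : Function.update μ₇ 9 (m + 1) 4 = U := by
    rw [f8 4 (by omega), f7 4 (by omega), f6 4 (by omega), f5 4 (by omega), f4 4 (by omega),
      f3 4 (by omega), hμ₂, Function.update_of_ne (by omega), Function.update_self]
  have e5 : Function.update μ₇ 9 (m + 1) 5 = 2 ^ p := by
    rw [f8 5 (by omega), f7 5 (by omega), f6 5 (by omega), e55]
  have e6 : Function.update μ₇ 9 (m + 1) 6 = ⌊(2 : ℝ) ^ p * r 0⌋₊ := by
    rw [f8 6 (by omega), f7 6 (by omega), f6 6 (by omega), f5 6 (by omega), hμ₄,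
      Function.update_self]
  refine hQ _ ⟨?_, ?_, ?_, ?_, e4, e5, e6, ?_, ?_⟩ ?_ ?_
  · rw [f8 0 (by omega), f7' 0 (by omega), h0]
  · rw [f8 1 (by omega), f7' 1 (by omega), h1]
  · rw [f8 2 (by omega), f7' 2 (by omega), h2]
  · rw [f8 3 (by omega), f7' 3 (by omega), h3]
  · rw [f8 8 (by omega), hμ₇, Function.update_self]
  · intro i hi
    rw [far _ (by omega), ← hUdef, g1 i hi]
  · rw [f8 7 (by omega), f7 7 (by omega), hμ₆, Function.update_self]
  · exact Function.update_self _ _ _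

theorem wp_finish (hN : segLen n m k ≤ N) (hS : 6 * segLen n m k ≤ S) (hn : 0 < n) (hk : 0 < k)
    (H : Env q n m k P h L inp μ)
    (hQ : ∀ μ', (∀ j < n, μ' j = μ (5 * segLen n m k + j)) → Q μ') :
    wp r 𝒪 S N finish Q μ := by
  have hU := le_segLen n m k
  have hnk : n ≤ k * n := Nat.le_mul_of_pos_left n hk
  have e1 := H.c1
  have e4 := H.c4
  set U := segLen n m k with hUdef
  have hlt : ∀ x ≤ 6 * U, x < 2 ^ S := fun x hx => lt_of_le_of_lt (by omega) Nat.lt_two_pow_self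
  have ev0 : (seg 5 (reg 1)).eval μ = 5 * U + n := by simp [e1, e4]
  refine wp_seq (wp_store (fun _ => by rw [ev0]; exact hlt _ (by omega)) ?_)
  rw [ev0, eval_const]
  have ev1 : (seg 5 0).eval (Function.update μ 0 (5 * U + n)) = 5 * U := by
    rw [eval_seg, eval_zero, Function.update_of_ne (by omega), e4, add_zero]
  refine wp_seq (wp_store (fun _ => by rw [ev1]; exact hlt _ (by omega)) ?_)
  rw [ev1, eval_const]
  set μ₁ := Function.update (Function.update μ 0 (5 * U + n)) 1 (5 * U) with hμ₁
  have f1 : ∀ a, 2 ≤ a → μ₁ a = μ a := fun a ha => by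
    rw [hμ₁, Function.update_of_ne (by omega), Function.update_of_ne (by omega)]
  have e10 : μ₁ 0 = 5 * U + n := by
    rw [hμ₁, Function.update_of_ne (by omega), Function.update_self]
  have e11 : μ₁ 1 = 5 * U := Function.update_self _ _ _
  have ec : (reg 0 - reg 1).eval μ₁ = n := by
    rw [eval_sub, eval_reg, eval_reg, e10, e11]; omega
  -- After `i` rounds the output cells from `n - i` on are filled, except 0 and 1. The source stays
  -- intact because `n` is below the segment length.
  refine wp_seq (wp_loop (fun i μ' => μ' 0 = 5 * U + n - i ∧ μ' 1 = 5 * U ∧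
    (∀ j < n, 2 ≤ j → n - i ≤ j → μ' j = μ (5 * U + j)) ∧ ∀ a, 5 * U ≤ a → μ' a = μ a)
    (by rw [ec]; omega) ?_ ?_ ?_)
  · exact ⟨by rw [e10]; omega, e11, fun j hj _ hj' => absurd hj' (by omega),
      fun a ha => f1 a (by omega)⟩
  · rintro i hi μ' ⟨g0, g1, g2, g3⟩
    rw [ec] at hi
    have ev : (reg 0 - 1).eval μ' = 5 * U + n - (i + 1) := by
      rw [eval_sub, eval_reg, eval_one, g0]; omega
    refine wp_seq (wp_store (fun _ => by rw [ev]; exact hlt _ (by omega)) ?_)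
    rw [ev, eval_const]
    set μ₂ := Function.update μ' 0 (5 * U + n - (i + 1)) with hμ₂
    have f2 : ∀ a, a ≠ 0 → μ₂ a = μ' a := fun a ha => Function.update_of_ne ha _ _
    have e20 : μ₂ 0 = 5 * U + n - (i + 1) := Function.update_self _ _ _
    have e21 : μ₂ 1 = 5 * U := by rw [f2 1 (by omega), g1]
    refine wp_ite (fun hc => ?_) (fun hc => wp_skip ?_)
    · have hc' : 5 * U + 1 < 5 * U + n - (i + 1) := by
        by_contra hcon
        exact hc (by simp only [eval_lt, eval_add, eval_reg, eval_one, e20, e21, if_neg hcon])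
      refine wp_store (fun hb => by rw [eval_load]; exact hb _) ?_
      have ea : (reg 0 - reg 1).eval μ₂ = n - (i + 1) := by
        rw [eval_sub, eval_reg, eval_reg, e20, e21]; omega
      have ev' : (Expr.load (reg 0)).eval μ₂ = μ (5 * U + (n - (i + 1))) := by
        rw [eval_load, eval_reg, e20, f2 _ (by omega), g3 _ (by omega)]
        congr 1; omega
      rw [ea, ev']
      refine ⟨?_, ?_, fun j hj hj2 hji => ?_, fun a ha => ?_⟩
      · rw [Function.update_of_ne (by omega), e20]
      · rw [Function.update_of_ne (by omega), e21]
      · by_cases hjj : j = n - (i + 1)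
        · subst hjj; rw [Function.update_self]
        · rw [Function.update_of_ne hjj, f2 j (by omega), g2 j hj hj2 (by omega)]
      · rw [Function.update_of_ne (by omega), f2 a (by omega), g3 a ha]
    · have hc' : ¬ 5 * U + 1 < 5 * U + n - (i + 1) := by
        intro hcon
        simp only [eval_lt, eval_add, eval_reg, eval_one, e20, e21, if_pos hcon] at hc
        omega
      refine ⟨e20, e21, fun j hj hj2 hji => ?_, fun a ha => ?_⟩
      · rw [f2 j (by omega), g2 j hj hj2 (by omega)]
      · rw [f2 a (by omega), g3 a ha]
  rw [ec]
  rintro μ₃ ⟨g0, g1, g2, g3⟩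
  have ev : (Expr.load (reg 1 + 1)).eval μ₃ = μ (5 * U + 1) := by
    rw [eval_load, eval_add, eval_reg, eval_one, g1, g3 _ (by omega)]
  -- For `n = 1` this writes an irrelevant value into a cell outside the output.
  refine wp_seq (wp_store (fun hb => by rw [eval_load]; exact hb _) ?_)
  rw [ev, eval_const]
  have ev' : (Expr.load (reg 0)).eval (Function.update μ₃ 1 (μ (5 * U + 1))) = μ (5 * U) := by
    rw [eval_load, eval_reg, Function.update_of_ne (by omega : (0 : ℕ) ≠ 1), g0,
      Function.update_of_ne (by omega), g3 _ (by omega)]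
    congr 1; omega
  refine wp_store (fun hb => by rw [eval_load]; exact hb _) ?_
  rw [ev', eval_const]
  refine hQ _ fun j hj => ?_
  by_cases hj0 : j = 0
  · subst hj0; rw [Function.update_self, add_zero]
  rw [Function.update_of_ne hj0]
  by_cases hj1 : j = 1
  · subst hj1; rw [Function.update_self]
  rw [Function.update_of_ne hj1]
  exact g2 j hj (by omega) (by omega)

end Specs


/-! ### The law of one trial and its effect on the best candidate -/

section Trial

variable {r : Fin 3 → ℝ} {𝒪 : Oracle} {S N : ℕ} {q n m k P h L : ℕ} {inp : ℕ → ℕ} {μ : Mem}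

/-- The continuation of the program is understood only after answers that the oracle can actually
give. -/
theorem bind_congr_support {α β : Type*} (p : PMF α) {f g : α → PMF β}
    (hfg : ∀ a ∈ p.support, f a = g a) : p.bind f = p.bind g := by
  ext b
  rw [PMF.bind_apply, PMF.bind_apply]
  refine tsum_congr fun a => ?_
  by_cases ha : a ∈ p.support
  · rw [hfg a ha]
  · rw [(PMF.apply_eq_zero_iff p a).mpr ha, zero_mul, zero_mul]

/-- The right hand side of the query made from the random number `v`. -/
def queryRhs (q n m k P h : ℕ) (inp : ℕ → ℕ) (v i : ℕ) : ZMod q :=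
  inp (m * n + i) +
    ∑ j ∈ Finset.range k, (maskedNoise q m k P h (v % k) (v / k) (i * k + j) : ZMod q) +
    ∑ j ∈ Finset.range (k * n),
      (plantedMatrix q n m k P h inp (v % k) (v / k) (i * (k * n) + j) : ZMod q) *
        shiftSecret q m k P h (v / k) j

/-- The query made from the random number `v`. -/
def queryList (q n m k P h : ℕ) (inp : ℕ → ℕ) (v : ℕ) : List ℕ :=
  (List.range (m * (k * n) + m)).map fun i =>
    if i < m * (k * n) then plantedMatrix q n m k P h inp (v % k) (v / k) i
    else (queryRhs q n m k P h inp v (i - m * (k * n))).val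

/-- The candidate secret extracted from the answer `w` to the query made from `v`. -/
def candidateOf (q n m k P h v : ℕ) (w : List ℕ) (j : ℕ) : ZMod q :=
  (w.getD (v % k * n + j) 0 : ZMod q) - shiftSecret q m k P h (v / k) (v % k * n + j)

/-- The oracle answers queries of the right length with `l` numbers below `q`. -/
def Answers (𝒪 : Oracle) (q M l : ℕ) : Prop :=
  ∀ W : List ℕ, W.length = M → ∀ w ∈ (𝒪 W).support, w.length = l ∧ ∀ x ∈ w, x < q

/-- Matrix and right hand side are adjacent in segment 2, so the block sent out already has the
encoding the oracle expects. -/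
theorem block_eq_queryList (v : ℕ)
    (hmat : ∀ t < m * (k * n), μ (2 * segLen n m k + (m * k + k * n + t)) =
      plantedMatrix q n m k P h inp (v % k) (v / k) t)
    (hrhs : ∀ i < m, μ (2 * segLen n m k + (numDigits n m k + i)) < q ∧
      (μ (2 * segLen n m k + (numDigits n m k + i)) : ZMod q) = queryRhs q n m k P h inp v i) :
    μ.block (2 * segLen n m k + (m * k + k * n)) (m * (k * n) + m) =
      queryList q n m k P h inp v := by
  have hD : numDigits n m k = m * k + k * n + m * (k * n) := rfl
  unfold Mem.block queryList
  refine List.map_congr_left fun i hi => ?_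
  rw [List.mem_range] at hi
  split_ifs with h1
  · rw [← hmat i h1, add_assoc]
  · obtain ⟨g1, g2⟩ := hrhs (i - m * (k * n)) (by omega)
    rw [← g2, ZMod.val_natCast, Nat.mod_eq_of_lt g1, hD]
    congr 1
    omega

/-- With the coins fixed, the oracle's answer is the only randomness left, so the law of the final
state is an image of the law of the answer. -/
theorem exec_after_coins (hN : segLen n m k ≤ N) (hS : segLen n m k ≤ S) (hq : 0 < q)
    (hk : 0 < k) (hinp : ∀ i, inp i < q) (hA : Answers 𝒪 q (m * (k * n) + m) (k * n))
    (H : Env q n m k P h L inp μ) (hb : Bdd S μ) {v : ℕ} (hv : μ 11 = v) (t c : ℕ) :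
    ∃ F : List ℕ → State,
      (∀ w ∈ (𝒪 (queryList q n m k P h inp v)).support,
        Env q n m k P h L inp (F w).mem ∧ Bdd S (F w).mem ∧ (F w).mem 7 = μ 7 ∧
        Updates q n m k inp (candidateOf q n m k P h v w) μ (F w).mem ∧
        (F w).time ≤ t + (prepare.bound S N + (ask.bound S N + assess.bound S N)) ∧
        (F w).queries = c + 1) ∧
      (Prog.seq prepare (.seq ask assess)).exec r 𝒪 ⟨μ, t, c⟩ =
        (𝒪 (queryList q n m k P h inp v)).map F := by
  have hU := le_segLen n m k
  have hD : numDigits n m k = m * k + k * n + m * (k * n) := rfl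
  have hqS : q < 2 ^ S := H.c0 ▸ hb 0
  obtain ⟨μ₁, ⟨h10, hsec, hmat, hrhs, hfr⟩, hb₁, hex₁⟩ :=
    wp_prepare (r := r) (𝒪 := 𝒪) (Q := fun μ' => μ' 10 = v % k ∧
      (∀ t < k * n, μ' (2 * segLen n m k + (m * k + t)) = shiftSecret q m k P h (v / k) t) ∧
      (∀ t < m * (k * n), μ' (2 * segLen n m k + (m * k + k * n + t)) =
        plantedMatrix q n m k P h inp (v % k) (v / k) t) ∧
      (∀ i < m, μ' (2 * segLen n m k + (numDigits n m k + i)) < q ∧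
        (μ' (2 * segLen n m k + (numDigits n m k + i)) : ZMod q) =
          queryRhs q n m k P h inp v i) ∧
      (∀ a, a < 10 ∨ (segLen n m k ≤ a ∧ a < 2 * segLen n m k) ∨ 3 * segLen n m k ≤ a →
        μ' a = μ a)) hN hS hq hinp H hv (fun μ' g1 g2 g3 g4 g5 => ⟨g1, g2, g3, g4, g5⟩) hb
  have hpos : v % k < k := Nat.mod_lt _ hk
  have hposn : v % k * n + n ≤ k * n := by
    have := Nat.mul_le_mul_right n (show v % k + 1 ≤ k from hpos); rwa [add_mul, one_mul] at this
  have E₁ : Env q n m k P h L inp μ₁ := H.congr fun a _ _ => hfr a (by omega)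
  obtain ⟨t₁, ht₁, hex₁⟩ := hex₁ t c
  have hsrc : (seg 2 (reg 2 * reg 3 + reg 3 * reg 1)).eval μ₁ =
      2 * segLen n m k + (m * k + k * n) := by simp [E₁.c1, E₁.c2, E₁.c3, E₁.c4]
  have hlen : (reg 2 * (reg 3 * reg 1) + reg 2).eval μ₁ = m * (k * n) + m := by
    simp [E₁.c1, E₁.c2, E₁.c3]
  have hdst : (seg 3 0).eval μ₁ = 3 * segLen n m k := by simp [E₁.c4]
  obtain ⟨t', ht', hex₂⟩ := exec_query (S := S) (N := N) (s := seg 2 (reg 2 * reg 3 + reg 3 * reg 1))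
    (l := reg 2 * (reg 3 * reg 1) + reg 2) (d := seg 3 0) r 𝒪 hb₁ (by rw [hlen]; omega) t₁ c
  rw [hsrc, hlen, hdst, block_eq_queryList v hmat hrhs] at hex₂
  have key : ∀ w : List ℕ, ∃ σ : State, w ∈ (𝒪 (queryList q n m k P h inp v)).support →
      (Env q n m k P h L inp σ.mem ∧ Bdd S σ.mem ∧ σ.mem 7 = μ 7 ∧
        Updates q n m k inp (candidateOf q n m k P h v w) μ σ.mem ∧
        σ.time ≤ t + (prepare.bound S N + (ask.bound S N + assess.bound S N)) ∧
        σ.queries = c + 1) ∧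
      assess.exec r 𝒪 ⟨writeBlock μ₁ (3 * segLen n m k) w, t' w, c + 1⟩ = PMF.pure σ := by
    intro w
    by_cases hw : w ∈ (𝒪 (queryList q n m k P h inp v)).support
    swap
    -- Impossible answers get an arbitrary state, so that `choose` yields a total function.
    · exact ⟨⟨μ, t, c⟩, fun hw' => absurd hw' hw⟩
    obtain ⟨hwl, hwq⟩ := hA _ (by simp [queryList]) w hw
    have hb₂ : Bdd S (writeBlock μ₁ (3 * segLen n m k) w) :=
      hb₁.writeBlock _ fun x hx => (hwq x hx).trans hqS
    have hfr₂ : ∀ a, a < 3 * segLen n m k ∨ 4 * segLen n m k ≤ a →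
        writeBlock μ₁ (3 * segLen n m k) w a = μ₁ a := fun a ha => by
      rw [writeBlock, if_neg (by omega)]
    have E₂ : Env q n m k P h L inp (writeBlock μ₁ (3 * segLen n m k) w) :=
      E₁.congr fun a _ _ => hfr₂ a (by omega)
    have h10' : writeBlock μ₁ (3 * segLen n m k) w 10 = v % k := by
      rw [hfr₂ 10 (by omega), h10]
    have hsec' : ∀ t < k * n, writeBlock μ₁ (3 * segLen n m k) w
        (2 * segLen n m k + (m * k + t)) = shiftSecret q m k P h (v / k) t := fun t ht => by
      rw [hfr₂ _ (by omega), hsec t ht]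
    obtain ⟨μ₃, ⟨E₃, h7, hupd⟩, hb₃, hex₃⟩ := wp_assess (r := r) (𝒪 := 𝒪) (N := N)
      (Q := fun μ' => Env q n m k P h L inp μ' ∧ μ' 7 = μ 7 ∧
        Updates q n m k inp (candidateOf q n m k P h v w) μ μ')
      hN hS hq hinp E₂ (by rw [h10']; exact hpos)
      (fun t ht => by rw [hsec' t ht]; exact digit_lt hq ..) (fun μ' g1 g2 g3 => ⟨g1, by
        rw [g2, hfr₂ 7 (by omega), hfr 7 (by omega)], by
        have hz : ∀ j < n, (writeBlock μ₁ (3 * segLen n m k) w (3 * segLen n m k + (v % k * n + j)) :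
            ZMod q) - writeBlock μ₁ (3 * segLen n m k) w
              (2 * segLen n m k + (m * k + (v % k * n + j))) =
            candidateOf q n m k P h v w j := by
          intro j hj
          rw [hsec' _ (by omega), candidateOf]
          congr 2
          rw [writeBlock, if_pos (by omega)]
          congr 1
          omega
        rw [h10'] at g3
        unfold Updates at g3 ⊢
        rw [violations_congr hz, hfr₂ 9 (by omega), hfr 9 (by omega)] at g3
        split_ifs at g3 ⊢ with hc
        · exact ⟨g3.1, fun j hj => by rw [g3.2 j hj]; exact hz j hj⟩
        · refine ⟨g3.1, fun j hj => ?_⟩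
          rw [g3.2 j hj, hfr₂ _ (by omega), hfr _ (by omega)]⟩) hb₂
    obtain ⟨t₃, ht₃, hex₃⟩ := hex₃ (t' w) (c + 1)
    refine ⟨⟨μ₃, t₃, c + 1⟩, fun _ => ⟨⟨E₃, hb₃, h7, hupd, ?_, rfl⟩, hex₃⟩⟩
    have := ht' w (by omega) fun x hx => (hwq x hx).trans hqS
    have hask : (Prog.query (seg 2 (reg 2 * reg 3 + reg 3 * reg 1))
      (reg 2 * (reg 3 * reg 1) + reg 2) (seg 3 0)).bound S N = ask.bound S N := rfl
    dsimp only
    omega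
  choose F hF using key
  refine ⟨F, fun w hw => (hF w hw).1, ?_⟩
  have hask : ask.exec r 𝒪 ⟨μ₁, t₁, c⟩ = _ := hex₂
  simp only [Prog.exec, hex₁, PMF.pure_bind]
  rw [hask, PMF.bind_map, ← PMF.bind_pure_comp]
  exact bind_congr_support _ fun w hw => (hF w hw).2

theorem exec_trial (hN : segLen n m k ≤ N) (hS : segLen n m k ≤ S) (hq : 0 < q) (hk : 0 < k)
    (hinp : ∀ i, inp i < q) (hLN : L ≤ N) (hLS : L ≤ S)
    (hA : Answers 𝒪 q (m * (k * n) + m) (k * n))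
    (H : Env q n m k P h L inp μ) (hb : Bdd S μ) (t c : ℕ) :
    ∃ F : Fin (2 ^ L) → List ℕ → State,
      (∀ v : Fin (2 ^ L), ∀ w ∈ (𝒪 (queryList q n m k P h inp v)).support,
        Env q n m k P h L inp (F v w).mem ∧ Bdd S (F v w).mem ∧ (F v w).mem 7 = μ 7 ∧
        Updates q n m k inp (candidateOf q n m k P h v w) μ (F v w).mem ∧
        (F v w).time ≤ t + trial.bound S N ∧ (F v w).queries = c + 1) ∧
      trial.exec r 𝒪 ⟨μ, t, c⟩ = (PMF.uniformOfFintype (Fin (2 ^ L))).bind fun v =>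
        (𝒪 (queryList q n m k P h inp v)).map (F v) := by
  have hU := le_segLen n m k
  have hL : (reg 8).eval μ = L := H.c8
  subst hL
  obtain ⟨t', ht', hex⟩ := exec_rand (S := S) (N := N) r 𝒪 (a := 11) (b := reg 8) hb hLN hLS t c
  have key : ∀ v : Fin (2 ^ (reg 8).eval μ), ∃ F : List ℕ → State,
      (∀ w ∈ (𝒪 (queryList q n m k P h inp v)).support,
        Env q n m k P h ((reg 8).eval μ) inp (F w).mem ∧ Bdd S (F w).mem ∧ (F w).mem 7 = μ 7 ∧
        Updates q n m k inp (candidateOf q n m k P h v w) μ (F w).mem ∧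
        (F w).time ≤ t + trial.bound S N ∧ (F w).queries = c + 1) ∧
      (Prog.seq prepare (.seq ask assess)).exec r 𝒪 ⟨Function.update μ 11 v, t' v, c⟩ =
        (𝒪 (queryList q n m k P h inp v)).map F := by
    intro v
    have f : ∀ a, a ≠ 11 → Function.update μ 11 v a = μ a := fun a ha =>
      Function.update_of_ne ha _ _
    have E : Env q n m k P h ((reg 8).eval μ) inp (Function.update μ 11 v) :=
      H.congr fun a _ _ => f a (by omega)
    have hb' : Bdd S (Function.update μ 11 v) :=
      hb.update _ (v.2.trans_le (Nat.pow_le_pow_right (by norm_num) hLS))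
    obtain ⟨F, hF, hex'⟩ := exec_after_coins (r := r) hN hS hq hk hinp hA E hb'
      (Function.update_self _ _ _) (t' v) c
    refine ⟨F, fun w hw => ?_, hex'⟩
    obtain ⟨g1, g2, g3, g4, g5, g6⟩ := hF w hw
    refine ⟨g1, g2, by rw [g3, f 7 (by omega)], ?_, ?_, g6⟩
    · unfold Updates at g4 ⊢
      rw [f 9 (by omega)] at g4
      split_ifs at g4 ⊢
      · exact g4
      · exact ⟨g4.1, fun j hj => by rw [g4.2 j hj, f _ (by omega)]⟩
    · have := ht' v
      have h1 : trial.bound S N = (Prog.rand 11 (reg 8)).bound S N +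
        (prepare.bound S N + (ask.bound S N + assess.bound S N)) := rfl
      omega
  choose F hF hF' using key
  refine ⟨F, hF, ?_⟩
  have h1 : trial.exec r 𝒪 ⟨μ, t, c⟩ = ((Prog.rand 11 (reg 8)).exec r 𝒪 ⟨μ, t, c⟩).bind
    ((Prog.seq prepare (.seq ask assess)).exec r 𝒪) := rfl
  rw [h1, hex, PMF.bind_map]
  congr 1
  funext v
  exact hF' v

/-- The best candidate so far is `z`. -/
def Solved (q n m k : ℕ) (inp : ℕ → ℕ) (z : ℕ → ZMod q) (μ : Mem) : Prop :=
  μ 9 = violations q n m inp z ∧ ∀ j < n, (μ (5 * segLen n m k + j) : ZMod q) = z j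

/-- Either the best candidate so far is `z`, or `z` would be a better one. -/
def Improvable (q n m k : ℕ) (inp : ℕ → ℕ) (z : ℕ → ZMod q) (μ : Mem) : Prop :=
  Solved q n m k inp z μ ∨ violations q n m inp z < μ 9

/-- By `hz`, nothing with as few violations differs from `z` on the first `n` entries. So `z` can
only be replaced by itself, and `hI` guarantees that it is accepted when it is offered and not yet
stored. -/
theorem Updates.solved {z y : ℕ → ZMod q} {μ μ' : Mem} (hu : Updates q n m k inp y μ μ')
    (hz : ∀ y : ℕ → ZMod q, violations q n m inp y ≤ violations q n m inp z →
      ∀ j < n, y j = z j) (hI : Improvable q n m k inp z μ)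
    (hs : Solved q n m k inp z μ ∨ ∀ j < n, y j = z j) : Solved q n m k inp z μ' := by
  unfold Updates at hu
  rcases hs with hs | hs
  · split_ifs at hu with hc
    · have hy := hz y (by rw [← hs.1]; exact hc.le)
      exact ⟨by rw [hu.1]; exact violations_congr hy, fun j hj => by rw [hu.2 j hj, hy j hj]⟩
    · exact ⟨by rw [hu.1, hs.1], fun j hj => by rw [hu.2 j hj, hs.2 j hj]⟩
  · have hv := violations_congr (m := m) (inp := inp) hs
    rw [hv] at hu
    rcases hI with hI | hI
    · rw [if_neg (by rw [hI.1]; exact lt_irrefl _)] at hu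
      exact ⟨by rw [hu.1, hI.1], fun j hj => by rw [hu.2 j hj, hI.2 j hj]⟩
    · rw [if_pos hI] at hu
      exact ⟨hu.1, fun j hj => by rw [hu.2 j hj, hs j hj]⟩

/-- A candidate other than `z` has strictly more violations than `z`, so storing it leaves room for
`z`. -/
theorem Updates.improvable {z y : ℕ → ZMod q} {μ μ' : Mem} (hu : Updates q n m k inp y μ μ')
    (hz : ∀ y : ℕ → ZMod q, violations q n m inp y ≤ violations q n m inp z →
      ∀ j < n, y j = z j) (hI : Improvable q n m k inp z μ) : Improvable q n m k inp z μ' := by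
  by_cases hs : Solved q n m k inp z μ
  · exact .inl (hu.solved hz hI (.inl hs))
  by_cases hy : ∀ j < n, y j = z j
  · exact .inl (hu.solved hz hI (.inr hy))
  have hlt : violations q n m inp z < μ 9 := hI.resolve_left hs
  right
  unfold Updates at hu
  split_ifs at hu with hc
  · rw [hu.1]
    by_contra hcon
    exact hy (hz y (not_lt.mp hcon))
  · rw [hu.1]; exact hlt

/-- The probability that one trial finds the vector `z`. -/
noncomputable def hitProb (q n m k P h L : ℕ) (inp : ℕ → ℕ) (𝒪 : Oracle) (z : ℕ → ZMod q) :
    ENNReal :=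
  ∑ v : Fin (2 ^ L), ((2 : ENNReal) ^ L)⁻¹ * (𝒪 (queryList q n m k P h inp v)).toOuterMeasure
    {w | ∀ j < n, candidateOf q n m k P h v w j = z j}

theorem hitProb_le_exec_trial (hN : segLen n m k ≤ N) (hS : segLen n m k ≤ S) (hq : 0 < q)
    (hk : 0 < k) (hinp : ∀ i, inp i < q) (hLN : L ≤ N) (hLS : L ≤ S)
    (hA : Answers 𝒪 q (m * (k * n) + m) (k * n)) (H : Env q n m k P h L inp μ) (hb : Bdd S μ)
    {z : ℕ → ZMod q} (hz : ∀ y : ℕ → ZMod q,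
      violations q n m inp y ≤ violations q n m inp z → ∀ j < n, y j = z j)
    (hI : Improvable q n m k inp z μ) (t c : ℕ) :
    hitProb q n m k P h L inp 𝒪 z ≤
      (trial.exec r 𝒪 ⟨μ, t, c⟩).toOuterMeasure {σ | Solved q n m k inp z σ.mem} := by
  obtain ⟨F, hF, hex⟩ := exec_trial (r := r) hN hS hq hk hinp hLN hLS hA H hb t c
  rw [hex, PMF.toOuterMeasure_bind_apply, tsum_fintype, hitProb]
  refine Finset.sum_le_sum fun v _ => ?_
  rw [PMF.uniformOfFintype_apply, Fintype.card_fin, Nat.cast_pow, Nat.cast_ofNat]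
  rw [PMF.toOuterMeasure_map_apply]
  refine mul_le_mul_right (PMF.toOuterMeasure_mono _ ?_) _
  rintro w ⟨hw, hws⟩
  exact (hF v w hws).2.2.2.1.solved hz hI (.inr hw)

theorem mem_support_exec_trial (hN : segLen n m k ≤ N) (hS : segLen n m k ≤ S) (hq : 0 < q)
    (hk : 0 < k) (hinp : ∀ i, inp i < q) (hLN : L ≤ N) (hLS : L ≤ S)
    (hA : Answers 𝒪 q (m * (k * n) + m) (k * n)) (H : Env q n m k P h L inp μ) (hb : Bdd S μ)
    (t c : ℕ) {σ : State} (hσ : σ ∈ (trial.exec r 𝒪 ⟨μ, t, c⟩).support) :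
    Env q n m k P h L inp σ.mem ∧ Bdd S σ.mem ∧ σ.time ≤ t + trial.bound S N ∧
      σ.queries = c + 1 ∧ ∃ y, Updates q n m k inp y μ σ.mem := by
  obtain ⟨F, hF, hex⟩ := exec_trial (r := r) hN hS hq hk hinp hLN hLS hA H hb t c
  rw [hex, PMF.mem_support_bind_iff] at hσ
  obtain ⟨v, -, hσ⟩ := hσ
  rw [PMF.mem_support_map_iff] at hσ
  obtain ⟨w, hw, rfl⟩ := hσ
  obtain ⟨g1, g2, -, g4, g5, g6⟩ := hF v w hw
  exact ⟨g1, g2, g5, g6, _, g4⟩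

end Trial

/-! ### Repetition -/

theorem toOuterMeasure_compl {α : Type*} (p : PMF α) (s : Set α) :
    p.toOuterMeasure sᶜ = 1 - p.toOuterMeasure s := by
  have h1 : p.toOuterMeasure s ≤ 1 := by
    rw [← (p.toOuterMeasure_apply_eq_one_iff Set.univ).mpr (Set.subset_univ _)]
    exact p.toOuterMeasure_mono fun _ _ => trivial
  refine ENNReal.eq_sub_of_add_eq (ne_top_of_le_ne_top ENNReal.one_ne_top h1) ?_
  rw [PMF.toOuterMeasure_apply, PMF.toOuterMeasure_apply, ← ENNReal.tsum_add, ← p.tsum_coe]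
  refine tsum_congr fun a => ?_
  by_cases ha : a ∈ s <;> simp [ha]

theorem iterate_invariant (f : State → PMF State) (J : ℕ → State → Prop) {M : ℕ}
    (hJ : ∀ i < M, ∀ σ, J i σ → ∀ τ ∈ (f σ).support, J (i + 1) τ) {σ : State} (h0 : J 0 σ) :
    ∀ τ ∈ (iterate f M σ).support, J M τ := by
  induction M with
  | zero =>
    intro τ hτ
    rw [iterate, PMF.mem_support_pure_iff] at hτ
    exact hτ ▸ h0
  | succ M ih =>
    intro τ hτ
    rw [iterate_succ', PMF.mem_support_bind_iff] at hτ
    obtain ⟨ρ, hρ, hτ⟩ := hτ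
    exact hJ M (by omega) ρ (ih (fun i hi => hJ i (by omega)) ρ hρ) τ hτ

/-- `G` persists once reached, so failing at the end means failing in every round. The bound `ρ`
holds from every state with the invariant, whatever happened before, so no independence is needed.
-/
theorem iterate_failure (f : State → PMF State) (I G : State → Prop) (ρ : ENNReal)
    (hI : ∀ σ, I σ → ∀ τ ∈ (f σ).support, I τ ∧ (G σ → G τ))
    (hρ : ∀ σ, I σ → ρ ≤ (f σ).toOuterMeasure {τ | G τ}) (M : ℕ) {σ : State} (hσ : I σ) :
    (iterate f M σ).toOuterMeasure {τ | G τ}ᶜ ≤ (1 - ρ) ^ M := by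
  induction M generalizing σ with
  | zero =>
    rw [toOuterMeasure_compl, pow_zero]
    exact tsub_le_self
  | succ M ih =>
    rw [iterate, PMF.toOuterMeasure_bind_apply]
    calc ∑' τ, f σ τ * (iterate f M τ).toOuterMeasure {τ | G τ}ᶜ
        ≤ ∑' τ, ({τ | G τ}ᶜ.indicator (f σ) τ) * (1 - ρ) ^ M := by
          refine ENNReal.tsum_le_tsum fun τ => ?_
          by_cases hτ : τ ∈ (f σ).support
          swap
          · rw [(PMF.apply_eq_zero_iff _ τ).mpr hτ, zero_mul]; exact zero_le
          have hIτ := (hI σ hσ τ hτ).1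
          by_cases hG : G τ
          -- Success in the first round already settles the matter, because `G` is absorbing.
          · have h0 : (iterate f M τ).toOuterMeasure {τ | G τ}ᶜ = 0 := by
              rw [PMF.toOuterMeasure_apply_eq_zero_iff, Set.disjoint_compl_right_iff_subset]
              intro τ' hτ'
              exact (iterate_invariant f (fun _ τ => I τ ∧ G τ) (fun _ _ ν hν τ hτ =>
                ⟨(hI ν hν.1 τ hτ).1, (hI ν hν.1 τ hτ).2 hν.2⟩) ⟨hIτ, hG⟩ τ' hτ').2
            rw [h0, mul_zero]; exact zero_le
          · rw [Set.indicator_of_mem (by simpa using hG)]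
            exact mul_le_mul_right (ih hIτ) _
      _ = (f σ).toOuterMeasure {τ | G τ}ᶜ * (1 - ρ) ^ M := by
          rw [ENNReal.tsum_mul_right, PMF.toOuterMeasure_apply]
      _ ≤ (1 - ρ) * (1 - ρ) ^ M := by
          refine mul_le_mul_left ?_ _
          rw [toOuterMeasure_compl]
          exact tsub_le_tsub_left (hρ σ hσ) 1
      _ = (1 - ρ) ^ (M + 1) := by rw [pow_succ, mul_comm]

/-! ### The whole program -/

section Reduction

variable {r : Fin 3 → ℝ} {𝒪 : Oracle} {S N : ℕ} {q n m k : ℕ} {inp : ℕ → ℕ} {μ : Mem}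

theorem violations_le (z : ℕ → ZMod q) : violations q n m inp z ≤ m := by
  refine (Finset.sum_le_card_nsmul _ _ 1 fun _ _ => ?_).trans (by simp)
  split_ifs <;> simp

/-- The resources that suffice for the reduction. -/
structure Fits (q n m k : ℕ) (ε : ℝ) (S N : ℕ) : Prop where
  segN : segLen n m k ≤ N
  segS : 6 * segLen n m k ≤ S
  precN : prec q n m k ≤ N
  precS : prec q n m k < S
  coinsN : numCoins q n m k (2 ^ prec q n m k) ≤ N
  coinsS : numCoins q n m k (2 ^ prec q n m k) ≤ S
  trialsN : numTrials q n m k ε ≤ N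
  trialsS : numTrials q n m k ε ≤ S

/-- `hitProb` does not depend on the memory left by earlier trials, so one lower bound serves all
rounds. -/
theorem exec_reduction (hF : Fits q n m k (r 2) S N) (hq : 0 < q) (hn : 0 < n) (hk : 0 < k)
    (hinp : ∀ i, inp i < q) (hA : Answers 𝒪 q (m * (k * n) + m) (k * n))
    (hb : Bdd S μ) (h0 : μ 0 = q) (h1 : μ 1 = n)
    (h2 : μ 2 = m) (h3 : μ 3 = k) (hμ : ∀ i < m * n + m, μ (4 + i) = inp i)
    (hz : ∀ a, 4 + (m * n + m) ≤ a → μ a = 0) (hr0 : r 0 ≤ 1) (hr2 : r 2 ≤ 1) :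
    (∀ σ ∈ (reduction.exec r 𝒪 ⟨μ, 0, 0⟩).support,
      σ.time ≤ reduction.bound S N ∧ σ.queries = numTrials q n m k (r 2)) ∧
    ∀ z : ℕ → ZMod q, (∀ y : ℕ → ZMod q,
      violations q n m inp y ≤ violations q n m inp z → ∀ j < n, y j = z j) →
      (reduction.exec r 𝒪 ⟨μ, 0, 0⟩).toOuterMeasure {σ | ∀ j < n, (σ.mem j : ZMod q) = z j}ᶜ ≤
        (1 - hitProb q n m k (2 ^ prec q n m k) ⌊(2 : ℝ) ^ prec q n m k * r 0⌋₊
          (numCoins q n m k (2 ^ prec q n m k)) inp 𝒪 z) ^ numTrials q n m k (r 2) := by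
  have hsS : segLen n m k ≤ S := by have := hF.segS; omega
  set P := 2 ^ prec q n m k with hP
  set h := ⌊(2 : ℝ) ^ prec q n m k * r 0⌋₊ with hh
  set L := numCoins q n m k P with hL
  set T := numTrials q n m k (r 2) with hT
  obtain ⟨μ₁, ⟨E₁, h7, h9⟩, hb₁, hex₁⟩ := wp_setup (r := r) (𝒪 := 𝒪) (N := N)
    (Q := fun μ' => Env q n m k P h L inp μ' ∧ μ' 7 = T ∧ μ' 9 = m + 1) hF.segN hsS h0 h1 h2 h3 hμ
    hz hr0 hr2 hF.precN hF.precS (lt_of_le_of_lt hF.trialsS Nat.lt_two_pow_self)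
    (lt_of_le_of_lt hF.coinsS Nat.lt_two_pow_self) (fun μ' g1 g2 g3 => ⟨g1, g2, g3⟩) hb
  obtain ⟨t₁, ht₁, hex₁⟩ := hex₁ 0 0
  set f : State → PMF State := fun τ => trial.exec r 𝒪 (τ.tick 1) with hf
  set σ₁ : State := ⟨μ₁, t₁ + ((reg 7).cost μ₁ + 1), 0⟩ with hσ₁
  have hex : reduction.exec r 𝒪 ⟨μ, 0, 0⟩ = (iterate f T σ₁).bind (finish.exec r 𝒪) := by
    have e : reduction.exec r 𝒪 ⟨μ, 0, 0⟩ = (setup.exec r 𝒪 ⟨μ, 0, 0⟩).bind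
      fun σ => (iterate f ((reg 7).eval σ.mem) (σ.tick ((reg 7).cost σ.mem + 1))).bind
        (finish.exec r 𝒪) := rfl
    rw [e, hex₁, PMF.pure_bind]
    simp only [eval_reg, h7]
    rfl
  have hstep : ∀ σ : State, Env q n m k P h L inp σ.mem → Bdd S σ.mem →
      ∀ τ ∈ (f σ).support, Env q n m k P h L inp τ.mem ∧ Bdd S τ.mem ∧
        τ.time ≤ σ.time + 1 + trial.bound S N ∧ τ.queries = σ.queries + 1 ∧
        ∃ y, Updates q n m k inp y σ.mem τ.mem := fun σ hE hb τ hτ =>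
    mem_support_exec_trial (r := r) hF.segN hsS hq hk hinp hF.coinsN hF.coinsS hA hE hb
      (σ.time + 1) σ.queries hτ
  have hfin : ∀ σ : State, Env q n m k P h L inp σ.mem → Bdd S σ.mem → ∃ μ' t',
      t' ≤ σ.time + finish.bound S N ∧ (∀ j < n, μ' j = σ.mem (5 * segLen n m k + j)) ∧
      finish.exec r 𝒪 σ = PMF.pure ⟨μ', t', σ.queries⟩ := by
    intro σ hE hb
    obtain ⟨μ', hμ', -, hex⟩ := wp_finish (r := r) (𝒪 := 𝒪) (N := N)
      (Q := fun μ' => ∀ j < n, μ' j = σ.mem (5 * segLen n m k + j)) hF.segN hF.segS hn hk hE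
      (fun _ h => h) hb
    obtain ⟨t', ht', hex⟩ := hex σ.time σ.queries
    exact ⟨μ', t', ht', hμ', hex⟩
  have hinv := iterate_invariant f (M := T) (σ := σ₁) (fun i τ => Env q n m k P h L inp τ.mem ∧
    Bdd S τ.mem ∧ τ.time ≤ σ₁.time + i * (trial.bound S N + 1) ∧ τ.queries = i)
    (fun i _ σ hσ τ hτ => by
      obtain ⟨g1, g2, g3, g4, -⟩ := hstep σ hσ.1 hσ.2.1 τ hτ
      refine ⟨g1, g2, ?_, by rw [g4, hσ.2.2.2]⟩
      have := hσ.2.2.1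
      rw [add_mul]; omega) ⟨E₁, hb₁, by simp, rfl⟩
  refine ⟨fun σ hσ => ?_, fun z hz' => ?_⟩
  · rw [hex, PMF.mem_support_bind_iff] at hσ
    obtain ⟨τ, hτ, hσ⟩ := hσ
    obtain ⟨g1, g2, g3, g4⟩ := hinv τ hτ
    obtain ⟨μ', t', ht', -, he⟩ := hfin τ g1 g2
    rw [he, PMF.mem_support_pure_iff] at hσ
    subst hσ
    refine ⟨?_, g4⟩
    have hb1 : reduction.bound S N = setup.bound S N +
      (((reg 7).cw + 1) * (S + 1) + N * (trial.bound S N + 1) + finish.bound S N) := rfl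
    have hc := (reg 7).cost_le hb₁
    have hTN : T * (trial.bound S N + 1) ≤ N * (trial.bound S N + 1) :=
      Nat.mul_le_mul_right _ hF.trialsN
    have : σ₁.time = t₁ + ((reg 7).cost μ₁ + 1) := rfl
    dsimp only
    rw [hb1]
    nlinarith
  · have hfail := iterate_failure f (fun τ => Env q n m k P h L inp τ.mem ∧ Bdd S τ.mem ∧
      Improvable q n m k inp z τ.mem) (fun τ => Solved q n m k inp z τ.mem)
      (hitProb q n m k P h L inp 𝒪 z) (fun σ hσ τ hτ => by
        obtain ⟨g1, g2, -, -, y, hy⟩ := hstep σ hσ.1 hσ.2.1 τ hτ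
        exact ⟨⟨g1, g2, hy.improvable hz' hσ.2.2⟩, fun hs => hy.solved hz' hσ.2.2 (.inl hs)⟩)
      (fun σ hσ => hitProb_le_exec_trial (r := r) hF.segN hsS hq hk hinp hF.coinsN hF.coinsS hA
        hσ.1 hσ.2.1 hz' hσ.2.2 (σ.time + 1) σ.queries) T (σ := σ₁)
      -- The initial record `m + 1` is worse than any vector, so `z` is an improvement at the start.
      ⟨E₁, hb₁, .inr (by rw [show σ₁.mem 9 = m + 1 from h9]; exact Nat.lt_succ_of_le (violations_le z))⟩
    refine le_trans ?_ hfail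
    rw [hex, PMF.toOuterMeasure_bind_apply, PMF.toOuterMeasure_apply]
    refine ENNReal.tsum_le_tsum fun τ => ?_
    by_cases hτ : τ ∈ (iterate f T σ₁).support
    swap
    · rw [(PMF.apply_eq_zero_iff _ τ).mpr hτ, zero_mul]; exact zero_le
    obtain ⟨g1, g2, -, -⟩ := hinv τ hτ
    obtain ⟨μ', t', -, hμ', he⟩ := hfin τ g1 g2
    rw [he, PMF.toOuterMeasure_pure_apply]
    by_cases hs : Solved q n m k inp z τ.mem
    · rw [if_neg, mul_zero]
      · exact zero_le
      · simp only [Set.mem_compl_iff, Set.mem_ofPred_eq, not_not]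
        exact fun j hj => by rw [hμ' j hj, hs.2 j hj]
    · rw [Set.indicator_of_mem (by simpa using hs)]
      refine mul_le_of_le_one_right zero_le ?_
      split_ifs <;> simp

end Reduction


/-! ### A direct product lemma -/

section DirectProduct

variable {ι X : Type*} [Fintype ι] [DecidableEq ι]

/-- Stated without division, so that weights may vanish. -/
theorem prod_update_mul (w : X → ℝ) (y : ι → X) (i : ι) (x : X) :
    (∏ j, w (Function.update y i x j)) * w (y i) = (∏ j, w (y j)) * w x := by
  rw [← Finset.mul_prod_erase _ _ (Finset.mem_univ i),
    ← Finset.mul_prod_erase _ (fun j => w (y j)) (Finset.mem_univ i), Function.update_self]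
  have : ∏ j ∈ Finset.univ.erase i, w (Function.update y i x j) =
      ∏ j ∈ Finset.univ.erase i, w (y j) :=
    Finset.prod_congr rfl fun j hj => by rw [Function.update_of_ne (Finset.ne_of_mem_erase hj)]
  rw [this]
  ring

variable [Fintype X]

/-- Exchanging `x` with `y i` is an involution of `X × (ι → X)` that preserves the weight. -/
theorem sum_prod_update (w : X → ℝ) (hw : ∑ x, w x = 1) (g : (ι → X) → ℝ) (i : ι) :
    ∑ x, w x * ∑ y : ι → X, (∏ j, w (y j)) * g (Function.update y i x) =
      ∑ y : ι → X, (∏ j, w (y j)) * g y := by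
  have h1 : ∑ x, w x * ∑ y : ι → X, (∏ j, w (y j)) * g (Function.update y i x) =
      ∑ p : X × (ι → X), ((∏ j, w (p.2 j)) * w p.1) * g (Function.update p.2 i p.1) := by
    rw [Fintype.sum_prod_type]
    refine Finset.sum_congr rfl fun x _ => ?_
    rw [Finset.mul_sum]
    exact Finset.sum_congr rfl fun y _ => by ring
  have h2 : ∑ y : ι → X, (∏ j, w (y j)) * g y =
      ∑ p : X × (ι → X), ((∏ j, w (p.2 j)) * w p.1) * g p.2 := by
    rw [Fintype.sum_prod_type_right]
    refine Finset.sum_congr rfl fun y _ => ?_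
    simp only
    rw [← Finset.sum_mul, ← Finset.mul_sum, hw, mul_one]
  rw [h1, h2]
  let T : X × (ι → X) → X × (ι → X) := fun p => (p.2 i, Function.update p.2 i p.1)
  have hT : Function.Involutive T := fun p => by simp [T]
  refine Fintype.sum_equiv hT.toPerm _ _ fun p => ?_
  simp only [Function.Involutive.coe_toPerm, T]
  rw [prod_update_mul]

/-- The weight of the points `x` for which `f` is small on average when a random coordinate of a
random tuple is replaced by `x`. -/
theorem sum_planted_small [Nonempty ι] (w : X → ℝ) (hw0 : ∀ x, 0 ≤ w x) (hw : ∑ x, w x = 1)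
    (f : (ι → X) → ℝ) (hf0 : ∀ y, 0 ≤ f y) (hf1 : ∀ y, f y ≤ 1) {ε δ : ℝ} (hε : 0 < ε)
    (hε1 : ε ≤ 1) (hδ : 0 < δ) (hk : 192 / δ * Real.log (8 / ε) < Fintype.card ι)
    (hf : ε ≤ ∑ y : ι → X, (∏ j, w (y j)) * f y) (B : X → Prop) [DecidablePred B]
    (hB : ∀ x, B x → (∑ i : ι, ∑ y : ι → X, (∏ j, w (y j)) * f (Function.update y i x)) ≤
      Fintype.card ι * (ε / 8)) :
    ∑ x, (if B x then w x else 0) ≤ δ / 2 := by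
  by_contra! hcon
  set μ := ∑ x, (if B x then w x else 0) with hμ
  set k : ℝ := (Fintype.card ι : ℝ) with hkdef
  have hlog : 0 < Real.log (8 / ε) := Real.log_pos (by rw [lt_div_iff₀ hε]; linarith)
  have hk0 : 0 < k := by rw [hkdef]; exact_mod_cast Fintype.card_pos
  have hμ0 : 0 < μ := lt_trans (by positivity) hcon
  have hμ1 : μ ≤ 1 := by
    rw [hμ, ← hw]
    refine Finset.sum_le_sum fun x _ => ?_
    split_ifs
    · exact le_rfl
    · exact hw0 x
  -- A quarter of the expected number `μk` of coordinates in `B`.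
  set a := μ * k / 4 with ha
  have ha0 : 0 < a := by positivity
  have hW0 : ∀ y : ι → X, 0 ≤ ∏ j, w (y j) := fun y => Finset.prod_nonneg fun j _ => hw0 _
  let c : (ι → X) → ℝ := fun y => ∑ i, if B (y i) then 1 else 0
  let b : (ι → X) → ℝ := fun y => ∏ i, if B (y i) then (1 / 2 : ℝ) else 1
  -- Tuples with at least `a` coordinates in `B` are paid for by the first term, the others by the
  -- Chernoff weight `exp(a - c y) ≥ 1`. In `b` the factor `exp(-1)` is relaxed to `1/2`.
  have hpt : ∀ y, f y ≤ f y * c y / a + Real.exp a * b y := by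
    intro y
    have hb : Real.exp (-c y) ≤ b y := by
      simp only [c, b]
      rw [← Finset.sum_neg_distrib, Real.exp_sum]
      refine Finset.prod_le_prod (fun _ _ => (Real.exp_pos _).le) fun i _ => ?_
      split_ifs
      · have := Real.exp_one_gt_d9
        rw [Real.exp_neg, one_div]
        exact inv_anti₀ (by norm_num) (by linarith)
      · simp
    have hb0 : 0 ≤ b y := (Real.exp_pos _).le.trans hb
    have hc0 : 0 ≤ c y := Finset.sum_nonneg fun i _ => by split_ifs <;> norm_num
    by_cases hca : a ≤ c y
    · have : f y ≤ f y * c y / a := by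
        rw [le_div_iff₀ ha0]
        exact mul_le_mul_of_nonneg_left hca (hf0 y)
      have : 0 ≤ Real.exp a * b y := by positivity
      linarith
    · push Not at hca
      have h1 : 1 ≤ Real.exp a * b y := by
        calc 1 ≤ Real.exp (a - c y) := Real.one_le_exp (by linarith)
          _ = Real.exp a * Real.exp (-c y) := by rw [← Real.exp_add]; rfl
          _ ≤ _ := mul_le_mul_of_nonneg_left hb (Real.exp_pos _).le
      have : 0 ≤ f y * c y / a := by have := hf0 y; positivity
      linarith [hf1 y]
  -- Resampling coordinate `i` turns `y i` into an independent point `x`; summing over `i` for fixed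
  -- `x` in `B` gives the quantity that `hB` bounds.
  have hsum1 : ∑ y : ι → X, (∏ j, w (y j)) * (f y * c y) ≤ k * μ * (ε / 8) := by
    calc ∑ y : ι → X, (∏ j, w (y j)) * (f y * c y)
        = ∑ i, ∑ y : ι → X, (∏ j, w (y j)) * (f y * if B (y i) then 1 else 0) := by
          rw [Finset.sum_comm]
          exact Finset.sum_congr rfl fun y _ => by simp only [c]; rw [Finset.mul_sum, Finset.mul_sum]
      _ = ∑ i, ∑ x, w x * ∑ y : ι → X, (∏ j, w (y j)) *
            (f (Function.update y i x) * if B x then 1 else 0) := by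
          refine Finset.sum_congr rfl fun i _ => ?_
          rw [← sum_prod_update w hw (fun y => f y * if B (y i) then 1 else 0) i]
          simp
      _ = ∑ x, (if B x then w x else 0) *
            ∑ i, ∑ y : ι → X, (∏ j, w (y j)) * f (Function.update y i x) := by
          rw [Finset.sum_comm]
          refine Finset.sum_congr rfl fun x _ => ?_
          rw [← Finset.mul_sum]
          split_ifs <;> simp
      _ ≤ ∑ x, (if B x then w x else 0) * (k * (ε / 8)) := by
          refine Finset.sum_le_sum fun x _ => ?_
          split_ifs with hx
          · exact mul_le_mul_of_nonneg_left (hB x hx) (hw0 x)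
          · simp
      _ = k * μ * (ε / 8) := by rw [← Finset.sum_mul]; ring
  have hsum2 : ∑ y : ι → X, (∏ j, w (y j)) * b y ≤ Real.exp (-(μ * k / 2)) := by
    have h1 : ∑ y : ι → X, (∏ j, w (y j)) * b y =
        (∑ x, w x * if B x then (1 / 2 : ℝ) else 1) ^ Fintype.card ι := by
      simp only [b, ← Finset.prod_mul_distrib]
      rw [← Finset.card_univ, ← Finset.prod_const, Finset.prod_univ_sum, Fintype.piFinset_univ]
    have h2 : ∑ x, w x * (if B x then (1 / 2 : ℝ) else 1) = 1 - μ / 2 := by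
      calc ∑ x, w x * (if B x then (1 / 2 : ℝ) else 1)
          = ∑ x, (w x - (if B x then w x else 0) / 2) :=
            Finset.sum_congr rfl fun x _ => by split_ifs <;> ring
        _ = 1 - μ / 2 := by rw [Finset.sum_sub_distrib, hw, hμ, Finset.sum_div]
    rw [h1, h2]
    calc (1 - μ / 2) ^ Fintype.card ι ≤ (Real.exp (-(μ / 2))) ^ Fintype.card ι := by
          refine pow_le_pow_left₀ (by linarith) ?_ _
          have := Real.add_one_le_exp (-(μ / 2))
          linarith
      _ = Real.exp (-(μ * k / 2)) := by
          rw [← Real.exp_nat_mul, hkdef]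
          congr 1; ring
  have htot : ε ≤ ε / 2 + Real.exp (-a) := by
    calc ε ≤ ∑ y : ι → X, (∏ j, w (y j)) * f y := hf
      _ ≤ ∑ y : ι → X, (∏ j, w (y j)) * (f y * c y / a + Real.exp a * b y) :=
          Finset.sum_le_sum fun y _ => mul_le_mul_of_nonneg_left (hpt y) (hW0 y)
      _ = (∑ y : ι → X, (∏ j, w (y j)) * (f y * c y)) / a +
            Real.exp a * ∑ y : ι → X, (∏ j, w (y j)) * b y := by
          rw [Finset.sum_div, Finset.mul_sum, ← Finset.sum_add_distrib]
          exact Finset.sum_congr rfl fun y _ => by ring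
      _ ≤ k * μ * (ε / 8) / a + Real.exp a * Real.exp (-(μ * k / 2)) := by
          gcongr
      _ = ε / 2 + Real.exp (-a) := by
          rw [← Real.exp_add, ha]
          congr 1
          · field_simp; norm_num
          · congr 1; ring
  -- `a ≥ δk/8 > 24 log(8/ε)`, much more than needed.
  have hexp : Real.exp (-a) ≤ ε / 8 := by
    have h1 : Real.log (8 / ε) ≤ a := by
      have h2 : 192 * Real.log (8 / ε) < δ * k := by
        rw [div_mul_eq_mul_div, div_lt_iff₀ hδ] at hk
        linarith
      have h3 : δ / 2 * k ≤ μ * k := by gcongr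
      rw [ha]
      linarith
    calc Real.exp (-a) ≤ Real.exp (-Real.log (8 / ε)) := Real.exp_le_exp.mpr (by linarith)
      _ = ε / 8 := by rw [Real.exp_neg, Real.exp_log (by positivity), inv_div]
  linarith

end DirectProduct

/-! ### Images of product distributions -/

/-- The image of a product distribution under coordinatewise maps is the product of the images. Laws
are compared through test functions; indicators recover the point masses. -/
theorem sum_prod_map {ι α β : Type*} [Fintype ι] [DecidableEq ι] [Fintype α] [Fintype β]
    [DecidableEq β]
    (u : ι → α → ℝ) (τ : ι → α → β) (v : ι → β → ℝ)
    (h : ∀ i, ∀ G : β → ℝ, ∑ a, u i a * G (τ i a) = ∑ b, v i b * G b) (Φ : (ι → β) → ℝ) :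
    ∑ g : ι → α, (∏ i, u i (g i)) * Φ (fun i => τ i (g i)) =
      ∑ g : ι → β, (∏ i, v i (g i)) * Φ g := by
  have hv : ∀ i b, v i b = ∑ a, u i a * if τ i a = b then 1 else 0 := fun i b => by
    rw [h i fun b' => if b' = b then 1 else 0]
    simp
  calc ∑ g : ι → α, (∏ i, u i (g i)) * Φ (fun i => τ i (g i))
      = ∑ g : ι → α, ∑ g' : ι → β, (∏ i, (u i (g i) * if τ i (g i) = g' i then 1 else 0)) *
          Φ g' := by
        refine Finset.sum_congr rfl fun g _ => ?_
        rw [Finset.sum_eq_single (fun i => τ i (g i))]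
        · simp
        · intro g' _ hg'
          obtain ⟨i, hi⟩ : ∃ i, τ i (g i) ≠ g' i := by
            by_contra! hcon
            exact hg' (funext fun i => (hcon i).symm)
          rw [Finset.prod_eq_zero (Finset.mem_univ i) (by rw [if_neg hi, mul_zero]), zero_mul]
        · exact fun hcon => absurd (Finset.mem_univ _) hcon
    _ = ∑ g' : ι → β, (∏ i, v i (g' i)) * Φ g' := by
        rw [Finset.sum_comm]
        refine Finset.sum_congr rfl fun g' _ => ?_
        rw [← Finset.sum_mul]
        congr 1
        simp only [hv]
        rw [Finset.prod_univ_sum, Fintype.piFinset_univ]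

/-! ### The noise distribution -/

section Noise

variable {q : ℕ}

theorem berMass_nonneg {η : ℝ} (h0 : 0 ≤ η) (h1 : η ≤ 1) (x : ZMod q) : 0 ≤ berMass q η x := by
  have : 0 ≤ η / q := by positivity
  unfold berMass
  split_ifs <;> linarith

theorem berMass_one (x : ZMod q) : berMass q 1 x = 1 / q := by simp [berMass]

variable [Fact q.Prime]

theorem sum_berMass_mul (η : ℝ) (G : ZMod q → ℝ) :
    ∑ x, berMass q η x * G x = (1 - η) * G 0 + η / q * ∑ x, G x := by
  have : ∀ x : ZMod q, berMass q η x * G x = (if x = 0 then (1 - η) * G x else 0) +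
      η / q * G x := fun x => by
    unfold berMass
    split_ifs <;> ring
  simp only [this, Finset.sum_add_distrib, Finset.sum_ite_eq', Finset.mem_univ, if_true,
    Finset.mul_sum]

/-- Adding a uniform element makes any independent sum uniform, so the sum is fixed to `0` only if
both variables are, with probability `(1 - η)(1 - θ)`. -/
theorem sum_berMass_convolution (η θ : ℝ) (G : ZMod q → ℝ) :
    ∑ x, berMass q η x * ∑ y, berMass q θ y * G (x + y) =
      ∑ x, berMass q (1 - (1 - η) * (1 - θ)) x * G x := by
  have hq : (q : ℝ) ≠ 0 := Nat.cast_ne_zero.mpr (Fact.out (p := q.Prime)).ne_zero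
  have h1 : ∀ x : ZMod q, ∑ y, G (x + y) = ∑ y, G y := fun x =>
    Fintype.sum_equiv (Equiv.addLeft x) _ _ fun y => rfl
  simp only [sum_berMass_mul, h1, add_zero, Finset.sum_add_distrib, Finset.sum_const,
    ← Finset.mul_sum, Finset.card_univ, ZMod.card, nsmul_eq_mul]
  field_simp
  ring

theorem sum_berMass_sum (η : ℝ) (k : ℕ) (G : ZMod q → ℝ) :
    ∑ a : Fin k → ZMod q, (∏ j, berMass q η (a j)) * G (∑ j, a j) =
      ∑ x, berMass q (1 - (1 - η) ^ k) x * G x := by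
  induction k generalizing G with
  | zero => simp [sum_berMass_mul]
  | succ k ih =>
    rw [← (Fin.consEquiv fun _ => ZMod q).sum_comp, Fintype.sum_prod_type]
    simp only [Fin.consEquiv_apply, Fin.prod_univ_succ, Fin.sum_univ_succ, Fin.cons_zero,
      Fin.cons_succ, mul_assoc, ← Finset.mul_sum]
    have hx : ∀ x : ZMod q, ∑ a : Fin k → ZMod q, (∏ j, berMass q η (a j)) * G (x + ∑ j, a j) =
        ∑ y, berMass q (1 - (1 - η) ^ k) y * G (x + y) := fun x => ih fun y => G (x + y)
    simp only [hx]
    rw [sum_berMass_convolution, pow_succ']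
    congr 1; funext x; congr 2; ring

end Noise


/-! ### Weights of noise and of codewords -/

section Coding

variable {q : ℕ} [Fact q.Prime] {m n : ℕ}

theorem pow_hammingNorm (t : ℝ) (v : Fin m → ZMod q) :
    t ^ hammingNorm v = ∏ i, if v i = 0 then 1 else t := by
  rw [hammingNorm, Finset.prod_ite]
  simp

theorem two_le_cast : (2 : ℝ) ≤ q := by exact_mod_cast (Fact.out (p := q.Prime)).two_le

theorem sum_ite_zero (t : ℝ) : ∑ x : ZMod q, (if x = 0 then 1 else t) = 1 + (q - 1) * t := by
  have : ∀ x : ZMod q, (if x = 0 then 1 else t) = (if x = 0 then 1 - t else 0) + t := fun x => by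
    split_ifs <;> ring
  simp only [this, Finset.sum_add_distrib, Finset.sum_ite_eq', Finset.mem_univ, if_true,
    Finset.sum_const, Finset.card_univ, ZMod.card, nsmul_eq_mul]
  ring

/-- Markov's inequality for `2 ^ weight`, whose mean is at most `(1 + η)^m ≤ exp(ηm)`. The constant
comes from `2 log 2 - 1 > 1/3`. -/
theorem sum_heavy_noise {η : ℝ} (h0 : 0 ≤ η) (h1 : η ≤ 1) :
    ∑ e : Fin m → ZMod q, (if 2 * η * m < hammingNorm e then ∏ i, berMass q η (e i) else 0) ≤
      Real.exp (-(η * m / 3)) := by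
  have hq := two_le_cast (q := q)
  have hlog := Real.log_two_gt_d9
  calc ∑ e : Fin m → ZMod q, (if 2 * η * m < hammingNorm e then ∏ i, berMass q η (e i) else 0)
      ≤ ∑ e : Fin m → ZMod q, (∏ i, berMass q η (e i) * if e i = 0 then 1 else 2) *
          Real.exp (-(2 * η * m * Real.log 2)) := by
        refine Finset.sum_le_sum fun e _ => ?_
        have hM : 0 ≤ ∏ i, berMass q η (e i) :=
          Finset.prod_nonneg fun i _ => berMass_nonneg h0 h1 _
        rw [Finset.prod_mul_distrib, ← pow_hammingNorm]
        split_ifs with h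
        · rw [mul_assoc]
          refine le_mul_of_one_le_right hM ?_
          have : (2 : ℝ) ^ hammingNorm e = Real.exp (hammingNorm e * Real.log 2) := by
            rw [Real.exp_nat_mul, Real.exp_log (by norm_num)]
          rw [this, ← Real.exp_add]
          refine Real.one_le_exp ?_
          nlinarith
        · positivity
    _ = (∑ x : ZMod q, berMass q η x * if x = 0 then 1 else 2) ^ m *
          Real.exp (-(2 * η * m * Real.log 2)) := by
        rw [← Finset.sum_mul]
        congr 1
        conv_rhs => rw [← Fintype.card_fin m, ← Finset.card_univ, ← Finset.prod_const]
        rw [Finset.prod_univ_sum, Fintype.piFinset_univ]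
    _ ≤ Real.exp (η * m) * Real.exp (-(2 * η * m * Real.log 2)) := by
        refine mul_le_mul_of_nonneg_right ?_ (Real.exp_pos _).le
        rw [sum_berMass_mul, sum_ite_zero]
        calc ((1 - η) * (if (0 : ZMod q) = 0 then 1 else 2) + η / q * (1 + (q - 1) * 2)) ^ m
            ≤ (Real.exp η) ^ m := by
              have h2 : η / q * (1 + (q - 1) * 2) ≤ 2 * η := by
                rw [div_mul_eq_mul_div, div_le_iff₀ (by linarith)]
                nlinarith
              have h3 : 0 ≤ η / q * (1 + (q - 1) * 2) := by
                have : (0 : ℝ) ≤ 1 + (q - 1) * 2 := by linarith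
                positivity
              rw [if_pos rfl]
              refine pow_le_pow_left₀ (by linarith) ?_ _
              linarith [Real.add_one_le_exp η]
          _ = Real.exp (η * m) := by rw [← Real.exp_nat_mul, mul_comm]
    _ ≤ Real.exp (-(η * m / 3)) := by
        rw [← Real.exp_add]
        refine Real.exp_le_exp.mpr ?_
        have : 0 ≤ η * m := by positivity
        nlinarith

theorem entropy_mul_log (ρ : ℝ) : entropy q ρ * Real.log q =
    ρ * Real.log (q - 1) - ρ * Real.log ρ - (1 - ρ) * Real.log (1 - ρ) := by
  have hq := two_le_cast (q := q)
  have : Real.log q ≠ 0 := (Real.log_pos (by linarith)).ne'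
  unfold entropy Real.logb
  field_simp

/-- Gibbs' inequality: `1 - H_q(ρ)` is, in base `q`, the divergence from the uniform law of the law
with mass `1 - ρ` at zero and `ρ` spread evenly elsewhere. It is strict because `(1 - ρ) q > 1`. -/
theorem entropy_lt_one {ρ : ℝ} (h0 : 0 < ρ) (h1 : ρ < 1 / 2) : entropy q ρ < 1 := by
  have hq := two_le_cast (q := q)
  have hlog : 0 < Real.log q := Real.log_pos (by linarith)
  have key : entropy q ρ * Real.log q < Real.log q := by
    rw [entropy_mul_log]
    have e1 : Real.log ((q - 1) / (ρ * q)) = Real.log (q - 1) - (Real.log ρ + Real.log q) := by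
      rw [Real.log_div (by linarith) (by positivity), Real.log_mul h0.ne' (by positivity)]
    have e2 : Real.log (1 / ((1 - ρ) * q)) = -(Real.log (1 - ρ) + Real.log q) := by
      rw [one_div, Real.log_inv, Real.log_mul (by linarith) (by positivity)]
    have l1 : Real.log ((q - 1) / (ρ * q)) ≤ (q - 1) / (ρ * q) - 1 :=
      Real.log_le_sub_one_of_pos (div_pos (by linarith) (by positivity))
    have l2 : Real.log (1 / ((1 - ρ) * q)) < 1 / ((1 - ρ) * q) - 1 := by
      have hpos : 0 < (1 - ρ) * q := mul_pos (by linarith) (by linarith)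
      refine Real.log_lt_sub_one_of_pos (by positivity) ?_
      rw [one_div, inv_ne_one]
      nlinarith
    have m1 : ρ * Real.log ((q - 1) / (ρ * q)) ≤ (q - 1) / q - ρ := by
      calc _ ≤ ρ * ((q - 1) / (ρ * q) - 1) := mul_le_mul_of_nonneg_left l1 h0.le
        _ = _ := by field_simp
    have m2 : (1 - ρ) * Real.log (1 / ((1 - ρ) * q)) < 1 / q - (1 - ρ) := by
      have hρ : 0 < 1 - ρ := by linarith
      calc _ < (1 - ρ) * (1 / ((1 - ρ) * q) - 1) := mul_lt_mul_of_pos_left l2 hρ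
        _ = _ := by field_simp
    have m3 : ((q : ℝ) - 1) / q + 1 / q = 1 := by field_simp; ring
    rw [e1] at m1
    rw [e2] at m2
    nlinarith
  nlinarith

/-- On the ball `1 ≤ t ^ (weight - ρm)` for any `t ≤ 1`. The optimal `t` makes the sum over all
vectors exactly `q ^ (m H_q(ρ))`. -/
theorem card_ball_le {ρ : ℝ} (h0 : 0 < ρ) (h1 : ρ < 1 / 2) :
    ∑ v : Fin m → ZMod q, (if (hammingNorm v : ℝ) ≤ ρ * m then (1 : ℝ) else 0) ≤
      Real.exp (m * (entropy q ρ * Real.log q)) := by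
  have hq := two_le_cast (q := q)
  have hq1 : (0 : ℝ) < q - 1 := by linarith
  have hρ : 0 < 1 - ρ := by linarith
  set t : ℝ := ρ / ((q - 1) * (1 - ρ)) with ht
  have ht0 : 0 < t := by positivity
  have ht1 : t ≤ 1 := by
    rw [ht, div_le_one (by positivity)]
    nlinarith
  have hlt : Real.log t ≤ 0 := Real.log_nonpos ht0.le ht1
  calc ∑ v : Fin m → ZMod q, (if (hammingNorm v : ℝ) ≤ ρ * m then (1 : ℝ) else 0)
      ≤ ∑ v : Fin m → ZMod q, (∏ i, if v i = 0 then 1 else t) *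
          Real.exp (-(ρ * m * Real.log t)) := by
        refine Finset.sum_le_sum fun v _ => ?_
        rw [← pow_hammingNorm]
        split_ifs with h
        · have : t ^ hammingNorm v = Real.exp (hammingNorm v * Real.log t) := by
            rw [Real.exp_nat_mul, Real.exp_log ht0]
          rw [this, ← Real.exp_add]
          refine Real.one_le_exp ?_
          nlinarith
        · positivity
    _ = (1 + (q - 1) * t) ^ m * Real.exp (-(ρ * m * Real.log t)) := by
        rw [← Finset.sum_mul, ← sum_ite_zero]
        congr 1
        conv_rhs => rw [← Fintype.card_fin m, ← Finset.card_univ, ← Finset.prod_const]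
        rw [Finset.prod_univ_sum, Fintype.piFinset_univ]
    _ = Real.exp (m * (entropy q ρ * Real.log q)) := by
        have e1 : 1 + (q - 1) * t = Real.exp (-Real.log (1 - ρ)) := by
          rw [Real.exp_neg, Real.exp_log hρ, ht]
          field_simp
          ring
        have e2 : Real.log t = Real.log ρ - (Real.log (q - 1) + Real.log (1 - ρ)) := by
          rw [ht, Real.log_div h0.ne' (by positivity), Real.log_mul hq1.ne' hρ.ne']
        rw [e1, ← Real.exp_nat_mul, ← Real.exp_add, entropy_mul_log, e2]
        congr 1
        ring

/-- Translating `a` in a coordinate where `z` is nonzero shifts the inner product by any prescribed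
amount, so all values are equally frequent. -/
theorem sum_dotProduct {z : Fin n → ZMod q} (hz : z ≠ 0) (G : ZMod q → ℝ) :
    ∑ a : Fin n → ZMod q, 1 / (q : ℝ) ^ n * G (a ⬝ᵥ z) = ∑ b, 1 / (q : ℝ) * G b := by
  obtain ⟨c, hc⟩ := Function.ne_iff.mp hz
  rw [Pi.zero_apply] at hc
  have hq : (q : ℝ) ≠ 0 := Nat.cast_ne_zero.mpr (Fact.out (p := q.Prime)).ne_zero
  have hshift : ∀ b : ZMod q, ∑ a : Fin n → ZMod q, G (a ⬝ᵥ z + b) =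
      ∑ a : Fin n → ZMod q, G (a ⬝ᵥ z) := fun b => by
    refine Fintype.sum_equiv (Equiv.addRight (Pi.single c (b * (z c)⁻¹))) _ _ fun a => ?_
    rw [Equiv.coe_addRight, add_dotProduct, single_dotProduct, inv_mul_cancel_right₀ hc]
  have h1 : (q : ℝ) * ∑ a : Fin n → ZMod q, G (a ⬝ᵥ z) = (q : ℝ) ^ n * ∑ b, G b := by
    calc (q : ℝ) * ∑ a : Fin n → ZMod q, G (a ⬝ᵥ z)
        = ∑ b : ZMod q, ∑ a : Fin n → ZMod q, G (a ⬝ᵥ z + b) := by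
          simp only [hshift, Finset.sum_const, Finset.card_univ, ZMod.card, nsmul_eq_mul]
      _ = ∑ a : Fin n → ZMod q, ∑ b : ZMod q, G (a ⬝ᵥ z + b) := Finset.sum_comm
      _ = ∑ a : Fin n → ZMod q, ∑ b : ZMod q, G b :=
          Finset.sum_congr rfl fun a _ => Fintype.sum_equiv (Equiv.addLeft _) _ _ fun b => rfl
      _ = (q : ℝ) ^ n * ∑ b, G b := by
          simp only [Finset.sum_const, Finset.card_univ, Fintype.card_fun, ZMod.card,
            Fintype.card_fin, nsmul_eq_mul]
          push_cast; rfl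
  rw [← Finset.mul_sum, ← Finset.mul_sum]
  field_simp
  linarith

theorem sum_mulVec {z : Fin n → ZMod q} (hz : z ≠ 0) (Φ : (Fin m → ZMod q) → ℝ) :
    ∑ A : Matrix (Fin m) (Fin n) (ZMod q), 1 / (q : ℝ) ^ (m * n) * Φ (A.mulVec z) =
      ∑ v : Fin m → ZMod q, 1 / (q : ℝ) ^ m * Φ v := by
  have h := sum_prod_map (ι := Fin m) (fun _ (_ : Fin n → ZMod q) => 1 / (q : ℝ) ^ n)
    (fun _ a => a ⬝ᵥ z) (fun _ _ => 1 / (q : ℝ)) (fun _ G => sum_dotProduct hz G) Φ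
  simp only [Finset.prod_const, Finset.card_univ, Fintype.card_fin, div_pow, one_pow,
    ← pow_mul] at h
  rw [mul_comm n m] at h
  exact h

/-- Union bound over the nonzero `z`, for each of which `A z` is uniform. The total is at most `q^n
q^(-m) q^(m H)`, and `m (1 - H) > 2n`. -/
theorem sum_light_codeword {η : ℝ} (h0 : 0 < η) (h1 : η < 1 / 8)
    (hm : 2 / (1 - entropy q (4 * η)) * (n : ℝ) < m) :
    ∑ A : Matrix (Fin m) (Fin n) (ZMod q), 1 / (q : ℝ) ^ (m * n) *
      (if ∃ z, z ≠ 0 ∧ (hammingNorm (A.mulVec z) : ℝ) ≤ 4 * η * m then 1 else 0) ≤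
      1 / (q : ℝ) ^ n := by
  have hq := two_le_cast (q := q)
  have hH : entropy q (4 * η) < 1 := entropy_lt_one (by linarith) (by linarith)
  have hlog : 0 < Real.log q := Real.log_pos (by linarith)
  have hm' : 2 * (n : ℝ) < m * (1 - entropy q (4 * η)) := by
    rwa [div_mul_eq_mul_div, div_lt_iff₀ (by linarith)] at hm
  calc ∑ A : Matrix (Fin m) (Fin n) (ZMod q), 1 / (q : ℝ) ^ (m * n) *
      (if ∃ z, z ≠ 0 ∧ (hammingNorm (A.mulVec z) : ℝ) ≤ 4 * η * m then (1 : ℝ) else 0)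
      ≤ ∑ A : Matrix (Fin m) (Fin n) (ZMod q), ∑ z ∈ Finset.univ.filter (· ≠ 0),
          1 / (q : ℝ) ^ (m * n) *
            (if (hammingNorm (A.mulVec z) : ℝ) ≤ 4 * η * m then (1 : ℝ) else 0) := by
        refine Finset.sum_le_sum fun A _ => ?_
        rw [← Finset.mul_sum]
        refine mul_le_mul_of_nonneg_left ?_ (by positivity)
        have hnn : ∀ z ∈ Finset.univ.filter (· ≠ (0 : Fin n → ZMod q)),
          (0 : ℝ) ≤ (if (hammingNorm (A.mulVec z) : ℝ) ≤ 4 * η * m then (1 : ℝ) else 0) :=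
          fun z _ => by split_ifs <;> norm_num
        split_ifs with hz
        · obtain ⟨z, hz, hzA⟩ := hz
          refine le_trans ?_ (Finset.single_le_sum hnn (Finset.mem_filter.mpr
            ⟨Finset.mem_univ z, hz⟩))
          rw [if_pos hzA]
        · exact Finset.sum_nonneg hnn
    _ = ∑ z ∈ Finset.univ.filter (· ≠ (0 : Fin n → ZMod q)), ∑ v : Fin m → ZMod q,
          1 / (q : ℝ) ^ m * (if (hammingNorm v : ℝ) ≤ 4 * η * m then (1 : ℝ) else 0) := by
        rw [Finset.sum_comm]
        refine Finset.sum_congr rfl fun z hz => ?_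
        exact sum_mulVec (Finset.mem_filter.mp hz).2
          fun v => if (hammingNorm v : ℝ) ≤ 4 * η * m then (1 : ℝ) else 0
    _ ≤ (q : ℝ) ^ n * (1 / (q : ℝ) ^ m *
          Real.exp (m * (entropy q (4 * η) * Real.log q))) := by
        rw [Finset.sum_const, nsmul_eq_mul]
        refine mul_le_mul ?_ ?_ ?_ (by positivity)
        · have : (Finset.univ.filter (· ≠ (0 : Fin n → ZMod q))).card ≤ q ^ n := by
            refine (Finset.card_filter_le _ _).trans ?_
            simp [ZMod.card]
          exact_mod_cast this
        · rw [← Finset.mul_sum]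
          exact mul_le_mul_of_nonneg_left (card_ball_le (by linarith) (by linarith))
            (by positivity)
        · refine Finset.sum_nonneg fun v _ => ?_
          split_ifs <;> positivity
    _ ≤ 1 / (q : ℝ) ^ n := by
        have e : ∀ j : ℕ, (q : ℝ) ^ j = Real.exp (j * Real.log q) := fun j => by
          rw [Real.exp_nat_mul, Real.exp_log (by linarith)]
        rw [e n, e m, one_div, one_div, ← Real.exp_neg, ← Real.exp_neg, ← Real.exp_add,
          ← Real.exp_add]
        refine Real.exp_le_exp.mpr ?_
        nlinarith

end Coding


/-! ### Joining several instances into one -/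

section Join

variable {q n m k : ℕ}

/-- The samples of an instance, with the noise vector in place of the right hand side. -/
abbrev Instance (q n m : ℕ) : Type := Matrix (Fin m) (Fin n) (ZMod q) × (Fin m → ZMod q)

/-- The mass of an instance with noise rate `η`. -/
noncomputable def instMass (η : ℝ) (x : Instance q n m) : ℝ :=
  1 / (q : ℝ) ^ (m * n) * ∏ i, berMass q η (x.2 i)

/-- The matrices of `k` instances side by side. -/
def joinMatrix (B : Fin k → Matrix (Fin m) (Fin n) (ZMod q)) :
    Matrix (Fin m) (Fin (k * n)) (ZMod q) := fun r c => B c.divNat r c.modNat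

/-- Joining matrices is a bijection. -/
def joinEquiv : (Fin k → Matrix (Fin m) (Fin n) (ZMod q)) ≃
    Matrix (Fin m) (Fin (k * n)) (ZMod q) where
  toFun := joinMatrix
  invFun A := fun j r c => A r (finProdFinEquiv (j, c))
  left_inv B := by
    funext j r c
    have := finProdFinEquiv.symm_apply_apply (j, c)
    rw [finProdFinEquiv_symm_apply, Prod.mk.injEq] at this
    simp only [joinMatrix, this.1, this.2]
  right_inv A := by
    funext r c
    have := finProdFinEquiv.apply_symm_apply c
    rw [finProdFinEquiv_symm_apply] at this
    simp only [joinMatrix, this]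

variable [Fact q.Prime]

/-- The probability that the solver recovers all the secrets from the sum of `k` instances. -/
noncomputable def jointSuccess (𝒮 : Solver q (k * n) m) (y : Fin k → Instance q n m) : ℝ :=
  ∑ S : Fin (k * n) → ZMod q, 1 / (q : ℝ) ^ (k * n) *
    (𝒮 (joinMatrix fun j => (y j).1)
      ((joinMatrix fun j => (y j).1).mulVec S + ∑ j, (y j).2) S).toReal

theorem sum_prod_berMass (η : ℝ) : ∑ e : Fin m → ZMod q, ∏ i, berMass q η (e i) = 1 := by
  have := Finset.prod_univ_sum (fun _ : Fin m => (Finset.univ : Finset (ZMod q)))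
    (fun _ x => berMass q η x)
  rw [Fintype.piFinset_univ] at this
  rw [← this]
  simp [sum_berMass]

theorem sum_instMass (η : ℝ) : ∑ x : Instance q n m, instMass η x = 1 := by
  have hq : (q : ℝ) ≠ 0 := Nat.cast_ne_zero.mpr (Fact.out (p := q.Prime)).ne_zero
  simp only [instMass, Fintype.sum_prod_type, ← Finset.mul_sum, sum_prod_berMass, mul_one,
    Finset.sum_const,
    Finset.card_univ, nsmul_eq_mul]
  rw [Fintype.card_congr (Matrix.of (m := Fin m) (n := Fin n) (α := ZMod q)).symm]
  simp only [Fintype.card_fun, ZMod.card, Fintype.card_fin]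
  push_cast
  rw [← pow_mul, mul_comm n m]
  field_simp

/-- After exchanging the two indices, the `m` coordinates are independent sums of `k` variables. -/
theorem sum_noise_sum (η : ℝ) (G : (Fin m → ZMod q) → ℝ) :
    ∑ es : Fin k → Fin m → ZMod q, (∏ j, ∏ i, berMass q η (es j i)) * G (∑ j, es j) =
      ∑ e : Fin m → ZMod q, (∏ i, berMass q (1 - (1 - η) ^ k) (e i)) * G e := by
  rw [← sum_prod_map (fun _ (a : Fin k → ZMod q) => ∏ j, berMass q η (a j)) (fun _ a => ∑ j, a j)
    (fun _ => berMass q (1 - (1 - η) ^ k)) (fun _ => sum_berMass_sum η k)]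
  refine Fintype.sum_equiv (Equiv.piComm _) _ _ fun es => ?_
  rw [Finset.prod_comm]
  congr 2
  funext i
  rw [Finset.sum_apply]
  rfl

/-- Joining is a bijection on matrices and the noises add up, so `k` random instances form exactly
one instance of the oracle's problem. -/
theorem sum_jointSuccess (η : ℝ) (𝒮 : Solver q (k * n) m) :
    ∑ y : Fin k → Instance q n m, (∏ j, instMass η (y j)) * jointSuccess 𝒮 y =
      successProb q (k * n) m (1 - (1 - η) ^ k) 𝒮 := by
  let g : Matrix (Fin m) (Fin (k * n)) (ZMod q) → (Fin m → ZMod q) → ℝ := fun A e =>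
    ∑ S : Fin (k * n) → ZMod q, 1 / (q : ℝ) ^ (k * n) * (𝒮 A (A.mulVec S + e) S).toReal
  have hpow : (1 / (q : ℝ) ^ (m * n)) ^ k = 1 / (q : ℝ) ^ (m * (k * n)) := by
    rw [div_pow, one_pow, ← pow_mul]; congr 2; ring
  calc ∑ y : Fin k → Instance q n m, (∏ j, instMass η (y j)) * jointSuccess 𝒮 y
      = ∑ p : (Fin k → Matrix (Fin m) (Fin n) (ZMod q)) × (Fin k → Fin m → ZMod q),
          1 / (q : ℝ) ^ (m * (k * n)) * ((∏ j, ∏ i, berMass q η (p.2 j i)) *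
            g (joinMatrix p.1) (∑ j, p.2 j)) := by
        refine Fintype.sum_equiv (Equiv.arrowProdEquivProdArrow _ _ _) _ _ fun y => ?_
        simp only [instMass, Finset.prod_mul_distrib, Finset.prod_const, Finset.card_univ,
          Fintype.card_fin, hpow, mul_assoc]
        rfl
    _ = ∑ A : Matrix (Fin m) (Fin (k * n)) (ZMod q), 1 / (q : ℝ) ^ (m * (k * n)) *
          ∑ e : Fin m → ZMod q, (∏ i, berMass q (1 - (1 - η) ^ k) (e i)) * g A e := by
        rw [Fintype.sum_prod_type]
        refine Fintype.sum_equiv joinEquiv _ _ fun B => ?_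
        rw [← Finset.mul_sum, sum_noise_sum η (g (joinMatrix B))]
        rfl
    _ = _ := by
        unfold successProb
        rw [Finset.sum_comm]
        refine Finset.sum_congr rfl fun A _ => ?_
        rw [Finset.sum_comm, Finset.mul_sum]
        refine Finset.sum_congr rfl fun e _ => ?_
        simp only [g]
        rw [Finset.mul_sum, Finset.mul_sum]
        exact Finset.sum_congr rfl fun S _ => by ring

theorem jointSuccess_nonneg (𝒮 : Solver q (k * n) m) (y : Fin k → Instance q n m) :
    0 ≤ jointSuccess 𝒮 y :=
  Finset.sum_nonneg fun S _ => by positivity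

theorem toReal_apply_le_one {α : Type*} (p : PMF α) (a : α) : (p a).toReal ≤ 1 := by
  rw [← ENNReal.toReal_one]
  exact ENNReal.toReal_mono ENNReal.one_ne_top (p.coe_le_one a)

theorem jointSuccess_le_one (𝒮 : Solver q (k * n) m) (y : Fin k → Instance q n m) :
    jointSuccess 𝒮 y ≤ 1 := by
  have hq : (q : ℝ) ≠ 0 := Nat.cast_ne_zero.mpr (Fact.out (p := q.Prime)).ne_zero
  calc jointSuccess 𝒮 y ≤ ∑ S : Fin (k * n) → ZMod q, 1 / (q : ℝ) ^ (k * n) * 1 :=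
        Finset.sum_le_sum fun S _ =>
          mul_le_mul_of_nonneg_left (toReal_apply_le_one _ _) (by positivity)
    _ = 1 := by
        simp [ZMod.card, hq]

end Join

/-! ### The law of the digits of a uniform number -/

section Digits

theorem sum_range_mul (M k : ℕ) (F : ℕ → ℝ) :
    ∑ x ∈ Finset.range (M * k), F x =
      ∑ y ∈ Finset.range M, ∑ a ∈ Finset.range k, F (a + k * y) := by
  induction M with
  | zero => simp
  | succ M ih =>
    rw [add_mul, one_mul, Finset.sum_range_add, ih, Finset.sum_range_succ]
    congr 1
    exact Finset.sum_congr rfl fun a _ => by rw [mul_comm M k, add_comm]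

theorem sum_range_zmod (q : ℕ) [NeZero q] (G : ZMod q → ℝ) :
    ∑ b ∈ Finset.range q, G (b : ZMod q) = ∑ x, G x := by
  refine Finset.sum_nbij' (fun b => (b : ZMod q)) ZMod.val (fun _ _ => Finset.mem_univ _)
    (fun x _ => Finset.mem_range.mpr (ZMod.val_lt x)) (fun b hb => ?_) (fun x _ => ?_)
    (fun _ _ => rfl)
  · exact ZMod.val_cast_of_lt (Finset.mem_range.mp hb)
  · exact ZMod.natCast_zmod_val x

/-- The element encoded by a digit: a uniform one multiplied by a coin of bias `H / P`. -/
def digitElt (q P H d : ℕ) : ZMod q := ((d % q * if d / q % P < H then 1 else 0 : ℕ) : ZMod q)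

/-- Writing `d = b + qc` makes `b` and `c` independent and uniform. The minimum appears because
every threshold from `P` on makes the coin certain. -/
theorem sum_digitElt {q : ℕ} [Fact q.Prime] {P : ℕ} (hP : 0 < P) (H : ℕ) (G : ZMod q → ℝ) :
    ∑ d : Fin (q * P), 1 / ((q * P : ℕ) : ℝ) * G (digitElt q P H d) =
      ∑ b, berMass q ((min H P : ℕ) / P) b * G b := by
  have hq0 := (Fact.out (p := q.Prime)).pos
  have hq : (q : ℝ) ≠ 0 := Nat.cast_ne_zero.mpr hq0.ne'
  have hP' : (P : ℝ) ≠ 0 := Nat.cast_ne_zero.mpr hP.ne'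
  have h1 : ∀ c < P, ∑ b ∈ Finset.range q, G (digitElt q P H (b + q * c)) =
      if c < H then ∑ x, G x else q * G 0 := by
    intro c hc
    have h2 : ∀ b ∈ Finset.range q, G (digitElt q P H (b + q * c)) =
        if c < H then G b else G 0 := fun b hb => by
      rw [Finset.mem_range] at hb
      unfold digitElt
      rw [Nat.add_mul_mod_self_left, Nat.mod_eq_of_lt hb, Nat.add_mul_div_left _ _ hq0,
        Nat.div_eq_of_lt hb, zero_add, Nat.mod_eq_of_lt hc]
      split_ifs <;> simp
    rw [Finset.sum_congr rfl h2]
    split_ifs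
    · exact sum_range_zmod q G
    · simp
  have h3 : ∑ c ∈ Finset.range P, (if c < H then ∑ x, G x else q * G 0) =
      (min H P : ℕ) * ∑ x, G x + (P - (min H P : ℕ)) * (q * G 0) := by
    have : ∀ c ∈ Finset.range P, (if c < H then ∑ x, G x else q * G 0) =
        (if c < H then (1 : ℝ) else 0) * (∑ x, G x - q * G 0) + q * G 0 := fun c _ => by
      split_ifs <;> ring
    rw [Finset.sum_congr rfl this, Finset.sum_add_distrib, ← Finset.sum_mul, Finset.sum_boole]
    have hc : (Finset.range P).filter (· < H) = Finset.range (min H P) := by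
      ext c; simp [and_comm]
    rw [hc, Finset.card_range, Finset.sum_const, Finset.card_range, nsmul_eq_mul]
    ring
  rw [← Finset.mul_sum, ← Finset.sum_range (n := q * P) fun d => G (digitElt q P H d)]
  rw [mul_comm q P, sum_range_mul, Finset.sum_congr rfl fun c hc => h1 c (Finset.mem_range.mp hc),
    h3, sum_berMass_mul]
  push_cast
  field_simp
  ring

/-- As a function of `v` the summand has period `D^M k`, and over one period position and digits run
through all combinations once. The incomplete last period is less than a quarter of the range and is
dropped, as `Φ ≥ 0`. -/
theorem sum_digits_le {k D M L : ℕ} (hk : 0 < k) (hD : 0 < D) (hL : 4 * (D ^ M * k) ≤ 2 ^ L)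
    (Φ : Fin k → (Fin M → Fin D) → ℝ) (hΦ : ∀ a g, 0 ≤ Φ a g) :
    3 / 4 * (1 / ((k : ℝ) * D ^ M)) * ∑ a, ∑ g, Φ a g ≤
      ∑ v : Fin (2 ^ L), 1 / (2 : ℝ) ^ L *
        Φ ⟨v % k, Nat.mod_lt _ hk⟩ fun i => ⟨v / k / D ^ (i : ℕ) % D, Nat.mod_lt _ hD⟩ := by
  set F : ℕ → ℝ := fun v =>
    Φ ⟨v % k, Nat.mod_lt _ hk⟩ fun i => ⟨v / k / D ^ (i : ℕ) % D, Nat.mod_lt _ hD⟩ with hF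
  have hF0 : ∀ v, 0 ≤ F v := fun v => hΦ _ _
  set B := D ^ M * k with hB
  have hB0 : 0 < B := by positivity
  have hper : ∀ x y, F (x + B * y) = F x := by
    intro x y
    simp only [hF]
    congr 1
    · rw [Fin.mk.injEq, hB, mul_assoc, mul_comm k y, ← mul_assoc, Nat.add_mul_mod_self_right]
    · funext i
      rw [Fin.mk.injEq]
      have e1 : (x + B * y) / k = x / k + D ^ (i : ℕ) * (D * (D ^ (M - i - 1) * y)) := by
        have : D ^ M = D ^ (i : ℕ) * (D * D ^ (M - i - 1)) := by
          rw [← pow_succ', ← pow_add]; congr 1; omega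
        rw [hB, show D ^ M * k * y = k * (D ^ M * y) by ring, Nat.add_mul_div_left _ _ hk, this]
        ring
      rw [e1, Nat.add_mul_div_left _ _ (by positivity), Nat.add_mul_mod_self_left]
  have hsum : ∑ x ∈ Finset.range B, F x = ∑ a, ∑ g, Φ a g := by
    rw [hB, sum_range_mul, Finset.sum_comm, Finset.sum_range]
    refine Finset.sum_congr rfl fun a _ => ?_
    rw [Finset.sum_range]
    refine Fintype.sum_equiv finFunctionFinEquiv.symm _ _ fun y => ?_
    simp only [hF]
    congr 1
    · rw [Fin.ext_iff]
      simp [Nat.mod_eq_of_lt a.2]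
    · funext i
      rw [Fin.ext_iff]
      simp only [Nat.add_mul_div_left _ _ hk, Nat.div_eq_of_lt a.2, zero_add]
      rw [finFunctionFinEquiv_symm_apply_val]
  have hR : 3 / 4 * (2 : ℝ) ^ L ≤ B * (2 ^ L / B : ℕ) := by
    have h1 : 2 ^ L < B * (2 ^ L / B) + B := by
      have := Nat.div_add_mod (2 ^ L) B
      have := Nat.mod_lt (2 ^ L) hB0
      omega
    have h2 : (2 : ℝ) ^ L < B * (2 ^ L / B : ℕ) + B := by exact_mod_cast h1
    have h3 : 4 * (B : ℝ) ≤ 2 ^ L := by exact_mod_cast hL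
    linarith
  rw [← Finset.mul_sum, ← Finset.sum_range (n := 2 ^ L) F]
  have hle : (2 ^ L / B : ℕ) * ∑ a, ∑ g, Φ a g ≤ ∑ v ∈ Finset.range (2 ^ L), F v := by
    calc (2 ^ L / B : ℕ) * ∑ a, ∑ g, Φ a g
        = ∑ v ∈ Finset.range (2 ^ L / B * B), F v := by
          rw [sum_range_mul]
          simp only [hper]
          rw [hsum, Finset.sum_const, Finset.card_range, nsmul_eq_mul]
      _ ≤ ∑ v ∈ Finset.range (2 ^ L), F v := by
          refine Finset.sum_le_sum_of_subset_of_nonneg ?_ fun v _ _ => hF0 v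
          exact Finset.range_subset_range.mpr (Nat.div_mul_le_self _ _)
  have hS0 : 0 ≤ ∑ a, ∑ g, Φ a g := Finset.sum_nonneg fun a _ => Finset.sum_nonneg fun g _ => hΦ a g
  have hBr : (B : ℝ) = k * D ^ M := by rw [hB]; push_cast; ring
  have hB0' : (0 : ℝ) < B := by exact_mod_cast hB0
  rw [← hBr]
  calc 3 / 4 * (1 / (B : ℝ)) * ∑ a, ∑ g, Φ a g
      ≤ 1 / (2 : ℝ) ^ L * ((2 ^ L / B : ℕ) * ∑ a, ∑ g, Φ a g) := by
        rw [← mul_assoc]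
        refine mul_le_mul_of_nonneg_right ?_ hS0
        rw [mul_one_div, one_div_mul_eq_div, div_le_div_iff₀ hB0' (by positivity)]
        linarith
    _ ≤ _ := mul_le_mul_of_nonneg_left hle (by positivity)

end Digits


/-! ### From random digits to random instances -/

section Hit

variable {q n m k : ℕ}

/-- The positions of the random elements in a query: the noise, the secret, the matrix. -/
abbrev DigitIdx (n m k : ℕ) : Type :=
  ((Fin m × Fin k) ⊕ Fin (k * n)) ⊕ (Fin m × Fin (k * n))

/-- The numbering of the random elements in a query. -/
def digitIdxEquiv (n m k : ℕ) : DigitIdx n m k ≃ Fin (numDigits n m k) :=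
  (Equiv.sumCongr ((Equiv.sumCongr finProdFinEquiv (Equiv.refl _)).trans finSumFinEquiv)
    finProdFinEquiv).trans finSumFinEquiv

theorem digitIdxEquiv_noise (r : Fin m) (j : Fin k) :
    (digitIdxEquiv n m k (.inl (.inl (r, j))) : ℕ) = r * k + j := by
  change (j : ℕ) + k * r = _
  ring

theorem digitIdxEquiv_secret (t : Fin (k * n)) :
    (digitIdxEquiv n m k (.inl (.inr t)) : ℕ) = m * k + t := rfl

theorem digitIdxEquiv_matrix (r : Fin m) (t : Fin (k * n)) :
    (digitIdxEquiv n m k (.inr (r, t)) : ℕ) = m * k + k * n + (r * (k * n) + t) := by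
  change m * k + k * n + ((t : ℕ) + k * n * r) = _
  ring

/-- The random instances given by the random elements. -/
def instOf (g : DigitIdx n m k → ZMod q) (j : Fin k) : Instance q n m :=
  (fun r c => g (.inr (r, finProdFinEquiv (j, c))), fun r => g (.inl (.inl (r, j))))

/-- The random secret given by the random elements. -/
def secretOf (g : DigitIdx n m k → ZMod q) (t : Fin (k * n)) : ZMod q := g (.inl (.inr t))

/-- The vector that is `s` in the block `a` and zero elsewhere. -/
def shiftAt (s : Fin n → ZMod q) (a : Fin k) (t : Fin (k * n)) : ZMod q :=
  if t.divNat = a then s t.modNat else 0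

/-- The tuple of instances whose sum is the query. -/
def plantedTuple (A : Matrix (Fin m) (Fin n) (ZMod q)) (e : Fin m → ZMod q) (a : Fin k)
    (g : DigitIdx n m k → ZMod q) : Fin k → Instance q n m :=
  Function.update (instOf g) a (A, e)

/-- The probability that the solver answers the query made from given random elements
correctly. -/
noncomputable def answerProb (𝒮 : Solver q (k * n) m) (A : Matrix (Fin m) (Fin n) (ZMod q))
    (s : Fin n → ZMod q) (e : Fin m → ZMod q) (a : Fin k) (g : DigitIdx n m k → ZMod q) : ℝ :=
  (𝒮 (joinMatrix fun j => (plantedTuple A e a g j).1)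
    ((joinMatrix fun j => (plantedTuple A e a g j).1).mulVec (secretOf g + shiftAt s a) +
      ∑ j, (plantedTuple A e a g j).2) (secretOf g + shiftAt s a)).toReal

/-- The bias of the coins in the random elements. -/
def bias (η : ℝ) : DigitIdx n m k → ℝ
  | .inl (.inl _) => η
  | _ => 1

/-- The random elements as instances and a secret. -/
def digitsSplit : (DigitIdx n m k → ZMod q) ≃
    (Fin k → Instance q n m) × (Fin (k * n) → ZMod q) where
  toFun g := (instOf g, secretOf g)
  invFun p := Sum.elim (Sum.elim (fun x => (p.1 x.2).2 x.1) p.2)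
    fun x => (p.1 x.2.divNat).1 x.1 x.2.modNat
  left_inv g := by
    funext x
    rcases x with (⟨r, j⟩ | t) | ⟨r, t⟩
    · rfl
    · rfl
    · have := finProdFinEquiv.apply_symm_apply t
      rw [finProdFinEquiv_symm_apply] at this
      simp only [Sum.elim_inr, instOf, this]
  right_inv p := by
    refine Prod.ext (funext fun j => Prod.ext (funext fun r => funext fun c => ?_) rfl) rfl
    have := finProdFinEquiv.symm_apply_apply (j, c)
    rw [finProdFinEquiv_symm_apply, Prod.mk.injEq] at this
    simp only [instOf, Sum.elim_inr, this.1, this.2]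

theorem prod_bias (η : ℝ) (g : DigitIdx n m k → ZMod q) :
    ∏ x, berMass q (bias η x) (g x) =
      (∏ j, instMass η (instOf g j)) * (1 / (q : ℝ) ^ (k * n)) := by
  have hpow : (1 / (q : ℝ) ^ (m * n)) ^ k = 1 / (q : ℝ) ^ (m * (k * n)) := by
    rw [div_pow, one_pow, ← pow_mul]; congr 2; ring
  rw [Fintype.prod_sum_type, Fintype.prod_sum_type, Fintype.prod_prod_type_right]
  simp only [bias, berMass_one, Finset.prod_const, Finset.card_univ, Fintype.card_fin,
    Fintype.card_prod, instMass, Finset.prod_mul_distrib, hpow, instOf, div_pow, one_pow]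
  ring

/-- Pointwise, the rounded noise law dominates `1 - c` times the ideal one. Only the `mk` noise
entries are rounded; secret and matrix entries are exactly uniform. -/
theorem pow_mul_prod_bias_le {η η' c : ℝ} (hη' : 0 ≤ η') (hle : η' ≤ η) (hη : η ≤ 1)
    (hc1 : c ≤ 1) (hc : (1 - c) * η ≤ η') (hc0 : 0 ≤ c) (g : DigitIdx n m k → ZMod q) :
    (1 - c) ^ (m * k) * ∏ x, berMass q (bias η x) (g x) ≤
      ∏ x, berMass q (bias η' x) (g x) := by
  have hpt : ∀ x : ZMod q, (1 - c) * berMass q η x ≤ berMass q η' x := fun x => by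
    have h1 : (1 - c) * (η / q) ≤ η' / q := by
      rw [← mul_div_assoc]; gcongr
    unfold berMass
    split_ifs
    · have : (1 - c) * (1 - η) ≤ 1 - η' := by nlinarith
      linarith
    · exact h1
  rw [Fintype.prod_sum_type, Fintype.prod_sum_type, Fintype.prod_sum_type, Fintype.prod_sum_type,
    ← mul_assoc, ← mul_assoc]
  have h0 : ∀ x : ZMod q, 0 ≤ berMass q 1 x := berMass_nonneg zero_le_one le_rfl
  refine mul_le_mul_of_nonneg_right (mul_le_mul_of_nonneg_right ?_
    (Finset.prod_nonneg fun _ _ => h0 _)) (Finset.prod_nonneg fun _ _ => h0 _)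
  have : (1 - c) ^ (m * k) = ∏ _x : Fin m × Fin k, (1 - c) := by simp
  rw [this, ← Finset.prod_mul_distrib]
  refine Finset.prod_le_prod (fun x _ => mul_nonneg (by linarith)
    (berMass_nonneg (hη'.trans hle) hη _)) fun x _ => hpt _

theorem answerProb_nonneg (𝒮 : Solver q (k * n) m) (A : Matrix (Fin m) (Fin n) (ZMod q))
    (s : Fin n → ZMod q) (e : Fin m → ZMod q) (a : Fin k) (g : DigitIdx n m k → ZMod q) :
    0 ≤ answerProb 𝒮 A s e a g := ENNReal.toReal_nonneg

variable [Fact q.Prime]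

/-- The random part of the joint secret is uniform and hence invariant under translation by the
planted `s`; this is why the right side is free of `s`. -/
theorem sum_answerProb (𝒮 : Solver q (k * n) m) (A : Matrix (Fin m) (Fin n) (ZMod q))
    (s : Fin n → ZMod q) (e : Fin m → ZMod q) (a : Fin k) (η : ℝ) :
    ∑ g : DigitIdx n m k → ZMod q, (∏ x, berMass q (bias η x) (g x)) * answerProb 𝒮 A s e a g =
      ∑ y : Fin k → Instance q n m, (∏ j, instMass η (y j)) *
        jointSuccess 𝒮 (Function.update y a (A, e)) := by
  have h1 : ∀ y : Fin k → Instance q n m, ∑ t : Fin (k * n) → ZMod q, 1 / (q : ℝ) ^ (k * n) *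
      (𝒮 (joinMatrix fun j => (Function.update y a (A, e) j).1)
        ((joinMatrix fun j => (Function.update y a (A, e) j).1).mulVec (t + shiftAt s a) +
          ∑ j, (Function.update y a (A, e) j).2) (t + shiftAt s a)).toReal =
      jointSuccess 𝒮 (Function.update y a (A, e)) := fun y =>
    Fintype.sum_equiv (Equiv.addRight (shiftAt s a)) _ _ fun t => rfl
  simp only [← h1]
  simp only [Finset.mul_sum]
  rw [← Fintype.sum_prod_type' (f := fun (y : Fin k → Instance q n m)
    (t : Fin (k * n) → ZMod q) => (∏ j, instMass η (y j)) * (1 / (q : ℝ) ^ (k * n) *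
      (𝒮 (joinMatrix fun j => (Function.update y a (A, e) j).1)
        ((joinMatrix fun j => (Function.update y a (A, e) j).1).mulVec (t + shiftAt s a) +
          ∑ j, (Function.update y a (A, e) j).2) (t + shiftAt s a)).toReal))]
  refine Fintype.sum_equiv digitsSplit _ _ fun g => ?_
  rw [prod_bias, mul_assoc]
  rfl

/-- The random elements that the program extracts from the number `x`. -/
def digitsOf (q P h : ℕ) (x : ℕ) (i : DigitIdx n m k) : ZMod q :=
  (digit q P h (m * k) x (digitIdxEquiv n m k i) : ZMod q)

theorem sum_digitsOf {P h L : ℕ} (hP : 0 < P) (hk : 0 < k)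
    (hL : 4 * ((q * P) ^ numDigits n m k * k) ≤ 2 ^ L) (hh : h ≤ P)
    (Ψ : Fin k → (DigitIdx n m k → ZMod q) → ℝ) (hΨ : ∀ a g, 0 ≤ Ψ a g) :
    3 / 4 * (1 / (k : ℝ)) * ∑ a, ∑ g, (∏ x, berMass q (bias ((h : ℝ) / P) x) (g x)) * Ψ a g ≤
      ∑ v : Fin (2 ^ L), 1 / (2 : ℝ) ^ L *
        Ψ ⟨v % k, Nat.mod_lt _ hk⟩ (digitsOf q P h (v / k)) := by
  have hq0 := (Fact.out (p := q.Prime)).pos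
  have hD : 0 < q * P := Nat.mul_pos hq0 hP
  let H : DigitIdx n m k → ℕ := fun x =>
    h + P * if m * k < (digitIdxEquiv n m k x : ℕ) + 1 then 1 else 0
  have hbias : ∀ x, ((min (H x) P : ℕ) : ℝ) / P = bias ((h : ℝ) / P) x := by
    intro x
    have hP' : (P : ℝ) ≠ 0 := Nat.cast_ne_zero.mpr hP.ne'
    rcases x with (⟨r, j⟩ | t) | ⟨r, t⟩
    · have hlt : ¬ m * k < r * k + j + 1 := by
        have := Nat.mul_le_mul_right k (show (r : ℕ) + 1 ≤ m from r.2)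
        rw [add_mul, one_mul] at this
        have := j.2
        omega
      simp only [H, bias, digitIdxEquiv_noise, if_neg hlt, mul_zero, add_zero, min_eq_left hh]
    · have e1 : H (.inl (.inr t)) = h + P * 1 :=
        congrArg (h + P * ·) (if_pos (by rw [digitIdxEquiv_secret]; omega))
      rw [e1, min_eq_right (by omega), div_self hP']
      rfl
    · have e1 : H (.inr (r, t)) = h + P * 1 :=
        congrArg (h + P * ·) (if_pos (by rw [digitIdxEquiv_matrix]; omega))
      rw [e1, min_eq_right (by omega), div_self hP']
      rfl
  have key := sum_digits_le hk hD hL (fun a g => Ψ a fun x =>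
    digitElt q P (H x) (g (digitIdxEquiv n m k x))) (fun a g => hΨ _ _)
  have h1 : ∀ a, ∑ g, (∏ x, berMass q (bias ((h : ℝ) / P) x) (g x)) * Ψ a g =
      (1 / ((q * P : ℕ) : ℝ) ^ numDigits n m k) * ∑ g : Fin (numDigits n m k) → Fin (q * P),
        Ψ a fun x => digitElt q P (H x) (g (digitIdxEquiv n m k x)) := by
    intro a
    have h2 := sum_prod_map (ι := DigitIdx n m k)
      (fun _ (_ : Fin (q * P)) => 1 / ((q * P : ℕ) : ℝ))
      (fun x d => digitElt q P (H x) d) (fun x => berMass q (bias ((h : ℝ) / P) x))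
      (fun x G => by rw [sum_digitElt hP, hbias]) (Ψ a)
    rw [← h2, ← Finset.mul_sum, Finset.prod_const, Finset.card_univ,
      Fintype.card_congr (digitIdxEquiv n m k), Fintype.card_fin, div_pow, one_pow]
    congr 1
    exact Fintype.sum_equiv ((digitIdxEquiv n m k).arrowCongr (Equiv.refl _)) _ _ fun g => by
      simp [Equiv.arrowCongr, Function.comp_def]
  have h3 : ∀ v : Fin (2 ^ L), (fun x : DigitIdx n m k => digitElt q P (H x)
      ((v : ℕ) / k / (q * P) ^ (digitIdxEquiv n m k x : ℕ) % (q * P))) =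
      digitsOf q P h ((v : ℕ) / k) := by
    intro v
    funext x
    simp only [digitElt, digitsOf, digit, H]
    rw [Nat.mod_mul_right_mod, Nat.mod_mul_right_div_self, Nat.mod_mod]
  simp only [h3] at key
  refine le_trans (le_of_eq ?_) key
  simp only [h1]
  rw [← Finset.mul_sum]
  have : (k : ℝ) ≠ 0 := Nat.cast_ne_zero.mpr hk.ne'
  push_cast
  field_simp

end Hit


/-! ### The program's query is the planted instance -/

section Decode

variable {q n m k : ℕ} {A : Matrix (Fin m) (Fin n) (ZMod q)} {b : Fin m → ZMod q}

/-- The input of the reduction as a sequence. -/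
def inputOf (A : Matrix (Fin m) (Fin n) (ZMod q)) (b : Fin m → ZMod q) (i : ℕ) : ℕ :=
  (encode A b).getD i 0

theorem length_encode : (encode A b).length = m * n + m := by simp [encode]

theorem inputOf_matrix (i : Fin m) (j : Fin n) : inputOf A b (i * n + j) = (A i j).val := by
  have hlt : (i : ℕ) * n + j < m * n := by
    have := Nat.mul_le_mul_right n (show (i : ℕ) + 1 ≤ m from i.2)
    rw [add_mul, one_mul] at this
    have := j.2
    omega
  have hp := finProdFinEquiv.symm_apply_apply (i, j)
  rw [finProdFinEquiv_symm_apply, Prod.mk.injEq] at hp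
  have he : (⟨i * n + j, hlt⟩ : Fin (m * n)) = finProdFinEquiv (i, j) :=
    Fin.ext (by change (i : ℕ) * n + j = j + n * i; ring)
  rw [inputOf, encode, List.getD_append _ _ _ _ (by simpa using hlt),
    List.getD_eq_getElem _ _ (by simpa using hlt), List.getElem_ofFn, he, hp.1, hp.2]

theorem inputOf_rhs (i : Fin m) : inputOf A b (m * n + i) = (b i).val := by
  rw [inputOf, encode, List.getD_append_right _ _ _ _ (by simp)]
  simp

theorem inputOf_lt [Fact q.Prime] (i : ℕ) : inputOf A b i < q := by
  have hq := (Fact.out (p := q.Prime)).pos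
  by_cases hi : i < (encode A b).length
  · have hmem := List.getElem_mem hi
    rw [inputOf, List.getD_eq_getElem _ _ hi]
    simp only [encode, List.mem_append, List.mem_ofFn] at hmem
    rcases hmem with ⟨p, hp⟩ | ⟨p, hp⟩
    · simp only [encode]; rw [← hp]; exact ZMod.val_lt _
    · simp only [encode]; rw [← hp]; exact ZMod.val_lt _
  · rw [inputOf, List.getD_eq_default _ _ (not_lt.mp hi)]
    exact hq

theorem answers_toOracle [Fact q.Prime] {l : ℕ} (𝒮 : Solver q l m) :
    Answers 𝒮.toOracle q (m * l + m) l := by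
  intro W hW w hw
  rw [Solver.toOracle, if_pos hW, PMF.support_map] at hw
  obtain ⟨z, -, rfl⟩ := hw
  refine ⟨by simp, fun x hx => ?_⟩
  obtain ⟨j, rfl⟩ := List.mem_ofFn.mp hx
  exact ZMod.val_lt _

theorem sum_fin_mul (F : Fin (k * n) → ZMod q) :
    ∑ c, F c = ∑ j : Fin k, ∑ l : Fin n, F (finProdFinEquiv (j, l)) := by
  rw [← finProdFinEquiv.sum_comp, Fintype.sum_prod_type]

theorem divNat_finProdFinEquiv (j : Fin k) (l : Fin n) :
    (finProdFinEquiv (j, l)).divNat = j ∧ (finProdFinEquiv (j, l)).modNat = l := by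
  have hp := finProdFinEquiv.symm_apply_apply (j, l)
  rwa [finProdFinEquiv_symm_apply, Prod.mk.injEq] at hp

variable (A) in
-- This absorbs the unknown `A s` in the given right hand side into the joint matrix times a joint
-- secret.
theorem mulVec_shiftAt (s : Fin n → ZMod q) (e : Fin m → ZMod q) (a : Fin k)
    (g : DigitIdx n m k → ZMod q) :
    (joinMatrix fun j => (plantedTuple A e a g j).1).mulVec (shiftAt s a) = A.mulVec s := by
  funext i
  simp only [Matrix.mulVec, dotProduct, joinMatrix, shiftAt]
  rw [sum_fin_mul, Finset.sum_eq_single a]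
  · simp only [divNat_finProdFinEquiv, if_true, plantedTuple, Function.update_self]
  · intro j _ hj
    simp only [divNat_finProdFinEquiv, if_neg hj, mul_zero, Finset.sum_const_zero]
  · simp

variable {P h v : ℕ}

theorem plantedMatrix_eq (hk : 0 < k) (e : Fin m → ZMod q) (i : Fin m) (c : Fin (k * n))
    [Fact q.Prime] :
    (plantedMatrix q n m k P h (inputOf A b) (v % k) (v / k) (i * (k * n) + c) : ZMod q) =
      joinMatrix (fun j => (plantedTuple A e ⟨v % k, Nat.mod_lt _ hk⟩
        (digitsOf q P h (v / k)) j).1) i c := by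
  have hc := c.2
  have h1 : ((i : ℕ) * (k * n) + c) % (k * n) = c := by
    rw [add_comm, Nat.add_mul_mod_self_right, Nat.mod_eq_of_lt hc]
  have h2 : ((i : ℕ) * (k * n) + c) / (k * n) = i := by
    rw [add_comm, Nat.add_mul_div_right _ _ (by omega), Nat.div_eq_of_lt hc, zero_add]
  simp only [plantedMatrix, joinMatrix, h1, h2, plantedTuple]
  by_cases ha : c.divNat = ⟨v % k, Nat.mod_lt _ hk⟩
  · have ha' : (c : ℕ) / n = v % k := congrArg Fin.val ha
    rw [if_pos ha', ha, Function.update_self]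
    have : inputOf A b (i * n + c % n) = _ := inputOf_matrix i c.modNat
    rw [this, ZMod.natCast_val, ZMod.cast_id]
  · have ha' : ¬ (c : ℕ) / n = v % k := fun H => ha (Fin.ext H)
    have hp := finProdFinEquiv.apply_symm_apply c
    rw [finProdFinEquiv_symm_apply] at hp
    rw [if_neg ha', Function.update_of_ne ha]
    simp only [instOf, hp, digitsOf, digitIdxEquiv_matrix]

/-- `b = A s + e` contributes the planted secret and the noise of block `a`; the masked noise
contributes the other blocks. -/
theorem queryRhs_eq [Fact q.Prime] (hk : 0 < k) (s : Fin n → ZMod q) (e : Fin m → ZMod q)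
    (i : Fin m) :
    queryRhs q n m k P h (inputOf A (A.mulVec s + e)) v i =
      ((joinMatrix fun j => (plantedTuple A e ⟨v % k, Nat.mod_lt _ hk⟩
        (digitsOf q P h (v / k)) j).1).mulVec
          (secretOf (m := m) (digitsOf q P h (v / k)) + shiftAt s ⟨v % k, Nat.mod_lt _ hk⟩) +
        ∑ j, (plantedTuple A e ⟨v % k, Nat.mod_lt _ hk⟩ (digitsOf q P h (v / k)) j).2) i := by
  set a : Fin k := ⟨v % k, Nat.mod_lt _ hk⟩ with ha
  set g : DigitIdx n m k → ZMod q := digitsOf q P h (v / k) with hg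
  have h1 : ∑ j ∈ Finset.range k,
      (maskedNoise q m k P h (v % k) (v / k) (i * k + j) : ZMod q) =
      ∑ j : Fin k, if j = a then 0 else g (.inl (.inl (i, j))) := by
    rw [Finset.sum_range]
    refine Finset.sum_congr rfl fun j _ => ?_
    have e1 : ((i : ℕ) * k + j) % k = j := by
      rw [add_comm, Nat.add_mul_mod_self_right, Nat.mod_eq_of_lt j.2]
    have e2 : (j : ℕ) = v % k ↔ j = a := by rw [Fin.ext_iff]
    simp only [maskedNoise, e1, e2]
    split_ifs
    · simp
    · simp only [hg, digitsOf, digitIdxEquiv_noise]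
  have h2 : ∑ j ∈ Finset.range (k * n),
      (plantedMatrix q n m k P h (inputOf A (A.mulVec s + e)) (v % k) (v / k)
        (i * (k * n) + j) : ZMod q) * shiftSecret q m k P h (v / k) j =
      ((joinMatrix fun j => (plantedTuple A e a g j).1).mulVec (secretOf g)) i := by
    rw [Finset.sum_range]
    refine Finset.sum_congr rfl fun c _ => ?_
    rw [plantedMatrix_eq hk e]
    rfl
  have h3 : (∑ j, (plantedTuple A e a g j).2) i =
      e i + ∑ j : Fin k, if j = a then 0 else g (.inl (.inl (i, j))) := by
    rw [Finset.sum_apply, ← Finset.add_sum_erase _ _ (Finset.mem_univ a),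
      ← Finset.add_sum_erase _ (fun j : Fin k => if j = a then 0 else g (.inl (.inl (i, j))))
        (Finset.mem_univ a), if_pos rfl, zero_add]
    congr 1
    · simp [plantedTuple]
    · refine Finset.sum_congr rfl fun j hj => ?_
      have hj' := Finset.ne_of_mem_erase hj
      rw [if_neg hj', plantedTuple, Function.update_of_ne hj']
      rfl
  rw [queryRhs, h1, h2, inputOf_rhs, ZMod.natCast_val, ZMod.cast_id, Matrix.mulVec_add,
    mulVec_shiftAt, Pi.add_apply, Pi.add_apply, Pi.add_apply, h3]
  ring

theorem toOracle_queryList [Fact q.Prime] (hk : 0 < k) (𝒮 : Solver q (k * n) m)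
    (s : Fin n → ZMod q) (e : Fin m → ZMod q) :
    𝒮.toOracle (queryList q n m k P h (inputOf A (A.mulVec s + e)) v) =
      (𝒮 (joinMatrix fun j => (plantedTuple A e ⟨v % k, Nat.mod_lt _ hk⟩
        (digitsOf q P h (v / k)) j).1)
        ((joinMatrix fun j => (plantedTuple A e ⟨v % k, Nat.mod_lt _ hk⟩
          (digitsOf q P h (v / k)) j).1).mulVec
          (secretOf (m := m) (digitsOf q P h (v / k)) + shiftAt s ⟨v % k, Nat.mod_lt _ hk⟩) +
        ∑ j, (plantedTuple A e ⟨v % k, Nat.mod_lt _ hk⟩ (digitsOf q P h (v / k)) j).2)).map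
      fun z => List.ofFn fun j => (z j).val := by
  have hlen : (queryList q n m k P h (inputOf A (A.mulVec s + e)) v).length =
      m * (k * n) + m := by simp [queryList]
  rw [Solver.toOracle, if_pos hlen]
  refine congrArg (PMF.map _) (congrArg₂ 𝒮 (funext fun i => funext fun c => ?_)
    (funext fun i => ?_))
  · have hlt : (i : ℕ) * (k * n) + c < m * (k * n) := by
      have := Nat.mul_le_mul_right (k * n) (show (i : ℕ) + 1 ≤ m from i.2)
      rw [add_mul, one_mul] at this
      have := c.2
      omega
    rw [List.getD_eq_getElem _ _ (by omega)]
    simp only [queryList, List.getElem_map, List.getElem_range, if_pos hlt]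
    exact plantedMatrix_eq hk e i c
  · rw [List.getD_eq_getElem _ _ (by have := i.2; omega)]
    simp only [queryList, List.getElem_map, List.getElem_range]
    rw [if_neg (by omega), Nat.add_sub_cancel_left, ZMod.natCast_val, ZMod.cast_id,
      queryRhs_eq hk]

/-- A vector as a sequence. -/
def extend (s : Fin n → ZMod q) (j : ℕ) : ZMod q := if h : j < n then s ⟨j, h⟩ else 0

theorem candidateOf_eq [Fact q.Prime] (hk : 0 < k) (s : Fin n → ZMod q) {j : ℕ} (hj : j < n) :
    candidateOf q n m k P h v (List.ofFn fun c => ((secretOf (m := m) (digitsOf q P h (v / k)) +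
      shiftAt s ⟨v % k, Nat.mod_lt _ hk⟩ : Fin (k * n) → ZMod q) c).val) j = extend s j := by
  have hlt : v % k * n + j < k * n := by
    have := Nat.mul_le_mul_right n (show v % k + 1 ≤ k from Nat.mod_lt _ hk)
    rw [add_mul, one_mul] at this
    omega
  have h1 : (⟨v % k * n + j, hlt⟩ : Fin (k * n)) =
      finProdFinEquiv (⟨v % k, Nat.mod_lt _ hk⟩, ⟨j, hj⟩) :=
    Fin.ext (by change v % k * n + j = j + n * (v % k); ring)
  have h2 := divNat_finProdFinEquiv (⟨v % k, Nat.mod_lt _ hk⟩ : Fin k) (⟨j, hj⟩ : Fin n)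
  rw [candidateOf, List.getD_eq_getElem _ _ (by simpa using hlt), List.getElem_ofFn,
    ZMod.natCast_val, ZMod.cast_id, Pi.add_apply]
  have h3 : secretOf (m := m) (digitsOf q P h (v / k)) ⟨v % k * n + j, hlt⟩ =
      shiftSecret q m k P h (v / k) (v % k * n + j) := rfl
  rw [h3, add_sub_cancel_left, h1, shiftAt, h2.1, h2.2, if_pos rfl, extend, dif_pos hj]

/-- Only an inequality: a trial also hits when just the planted block of the answer is correct. -/
theorem le_hitProb [Fact q.Prime] (hk : 0 < k) (𝒮 : Solver q (k * n) m) (s : Fin n → ZMod q)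
    (e : Fin m → ZMod q) (L : ℕ) :
    ENNReal.ofReal (∑ v : Fin (2 ^ L), 1 / (2 : ℝ) ^ L *
        answerProb 𝒮 A s e ⟨v % k, Nat.mod_lt _ hk⟩ (digitsOf q P h (v / k))) ≤
      hitProb q n m k P h L (inputOf A (A.mulVec s + e)) 𝒮.toOracle (extend s) := by
  rw [ENNReal.ofReal_sum_of_nonneg fun v _ => mul_nonneg (by positivity)
    (answerProb_nonneg 𝒮 A s e _ _), hitProb]
  refine Finset.sum_le_sum fun v _ => ?_
  rw [ENNReal.ofReal_mul (by positivity), one_div, ENNReal.ofReal_inv_of_pos (by positivity),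
    ENNReal.ofReal_pow zero_le_two, ENNReal.ofReal_ofNat]
  gcongr
  rw [answerProb, ENNReal.ofReal_toReal (PMF.apply_ne_top _ _), toOracle_queryList hk,
    PMF.toOuterMeasure_map_apply, ← PMF.toOuterMeasure_apply_singleton]
  refine PMF.toOuterMeasure_mono _ ?_
  rintro z ⟨rfl, -⟩ j hj
  exact candidateOf_eq hk s hj

end Decode


/-! ### Success on a fixed good instance -/

section Success

variable {q n m k : ℕ}

theorem instMass_nonneg {η : ℝ} (h0 : 0 ≤ η) (h1 : η ≤ 1) (x : Instance q n m) :
    0 ≤ instMass η x :=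
  mul_nonneg (by positivity) (Finset.prod_nonneg fun _ _ => berMass_nonneg h0 h1 _)

theorem four_mul_le_two_pow_numCoins (P : ℕ) :
    4 * ((q * P) ^ numDigits n m k * k) ≤ 2 ^ numCoins q n m k P := by
  have h1 : (q * P) ^ numDigits n m k ≤ (2 ^ Nat.size (q * P)) ^ numDigits n m k :=
    Nat.pow_le_pow_left (Nat.lt_size_self _).le _
  have h2 : k ≤ 2 ^ Nat.size k := (Nat.lt_size_self _).le
  have h3 : 2 ^ numCoins q n m k P =
      4 * ((2 ^ Nat.size (q * P)) ^ numDigits n m k * 2 ^ Nat.size k) := by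
    rw [numCoins, pow_add, pow_add, mul_comm (numDigits n m k), pow_mul]
    ring
  rw [h3]
  gcongr

theorem pow_le_two_pow_prec : (q : ℝ) ^ n ≤ 2 ^ prec q n m k := by
  have h : q ^ n ≤ 2 ^ prec q n m k := by
    calc q ^ n ≤ (2 ^ Nat.size q) ^ n := Nat.pow_le_pow_left (Nat.lt_size_self q).le n
      _ = 2 ^ (n * Nat.size q) := by rw [← pow_mul, mul_comm]
      _ ≤ 2 ^ prec q n m k := Nat.pow_le_pow_right two_pos (by rw [prec]; omega)
  exact_mod_cast h

variable [Fact q.Prime]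

/-- The average success probability of the solver when the given instance is planted at a
random position among random instances. -/
noncomputable def plantedProb (η : ℝ) (𝒮 : Solver q (k * n) m) (x : Instance q n m) : ℝ :=
  1 / k * ∑ a, ∑ y : Fin k → Instance q n m, (∏ j, instMass η (y j)) *
    jointSuccess 𝒮 (Function.update y a x)

/-- The half is `3/4 · 2/3`: the first factor for using `2^L` equally likely numbers, the second for
rounding `η`. -/
theorem plantedProb_le_hitProb (hk : 0 < k) {η : ℝ} (hη0 : 0 < η) (hη1 : η ≤ 1) {P L : ℕ}
    (hP : 3 * ((m : ℝ) * k) ≤ P * η) (hP1 : 1 ≤ P * η)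
    (hL : 4 * ((q * P) ^ numDigits n m k * k) ≤ 2 ^ L) (𝒮 : Solver q (k * n) m)
    (A : Matrix (Fin m) (Fin n) (ZMod q)) (s : Fin n → ZMod q) (e : Fin m → ZMod q) :
    ENNReal.ofReal (1 / 2 * plantedProb η 𝒮 (A, e)) ≤
      hitProb q n m k P ⌊P * η⌋₊ L (inputOf A (A.mulVec s + e)) 𝒮.toOracle (extend s) := by
  have hP0 : (0 : ℝ) < P := by
    by_contra! h
    nlinarith
  have hPn : 0 < P := by exact_mod_cast hP0
  have hfl : (⌊P * η⌋₊ : ℝ) ≤ P * η := Nat.floor_le (by positivity)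
  have hfl' : P * η < ⌊P * η⌋₊ + 1 := Nat.lt_floor_add_one _
  have hle : (⌊P * η⌋₊ : ℝ) / P ≤ η := by rw [div_le_iff₀ hP0]; linarith
  have hh : ⌊P * η⌋₊ ≤ P := by
    have : (⌊P * η⌋₊ : ℝ) ≤ P := hfl.trans (mul_le_of_le_one_right hP0.le hη1)
    exact_mod_cast this
  set c : ℝ := 1 / (P * η) with hc
  have hPη : 0 < P * η := by positivity
  have hc0 : 0 ≤ c := by positivity
  have hc1 : c ≤ 1 := by rw [hc, div_le_one hPη]; exact hP1
  have hcη : (1 - c) * η ≤ ⌊P * η⌋₊ / P := by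
    rw [le_div_iff₀ hP0]
    have : (1 - c) * η * P = P * η - 1 := by rw [hc]; field_simp
    linarith
  -- Bernoulli's inequality with `mkc ≤ 1/3`, which is `hP`.
  have hpow : 2 / 3 ≤ (1 - c) ^ (m * k) := by
    have h1 := one_add_mul_le_pow (a := -c) (by linarith) (m * k)
    have h2 : (m * k : ℕ) * c ≤ 1 / 3 := by
      rw [hc, mul_one_div, div_le_iff₀ hPη]
      push_cast
      linarith
    rw [← sub_eq_add_neg] at h1
    linarith
  refine le_trans (ENNReal.ofReal_le_ofReal ?_) (le_hitProb hk 𝒮 s e L)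
  refine le_trans ?_ (sum_digitsOf hPn hk hL hh (answerProb 𝒮 A s e)
    fun a g => answerProb_nonneg 𝒮 A s e a g)
  have hsum : ∀ a, 2 / 3 * ∑ y : Fin k → Instance q n m, (∏ j, instMass η (y j)) *
      jointSuccess 𝒮 (Function.update y a (A, e)) ≤
      ∑ g, (∏ x, berMass q (bias ((⌊P * η⌋₊ : ℝ) / P) x) (g x)) * answerProb 𝒮 A s e a g := by
    intro a
    rw [← sum_answerProb 𝒮 A s e a η, Finset.mul_sum]
    refine Finset.sum_le_sum fun g _ => ?_
    rw [← mul_assoc]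
    refine mul_le_mul_of_nonneg_right ?_ (answerProb_nonneg 𝒮 A s e a g)
    refine le_trans (mul_le_mul_of_nonneg_right hpow (Finset.prod_nonneg fun x _ => ?_))
      (pow_mul_prod_bias_le (by positivity) hle hη1 hc1 hcη hc0 g)
    rcases x with (x | x) | x
    · exact berMass_nonneg hη0.le hη1 _
    · exact berMass_nonneg zero_le_one le_rfl _
    · exact berMass_nonneg zero_le_one le_rfl _
  calc 1 / 2 * plantedProb η 𝒮 (A, e)
      = 3 / 4 * (1 / (k : ℝ)) * ∑ a, 2 / 3 * ∑ y : Fin k → Instance q n m,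
          (∏ j, instMass η (y j)) * jointSuccess 𝒮 (Function.update y a (A, e)) := by
        rw [plantedProb, ← Finset.mul_sum]
        ring
    _ ≤ _ := mul_le_mul_of_nonneg_left (Finset.sum_le_sum fun a _ => hsum a) (by positivity)

theorem violations_eq_hammingDist (A : Matrix (Fin m) (Fin n) (ZMod q)) (b : Fin m → ZMod q)
    (y : ℕ → ZMod q) :
    violations q n m (inputOf A b) y = hammingDist (A.mulVec fun j => y j) b := by
  rw [violations, hammingDist, Finset.card_filter, Finset.sum_range]
  refine Finset.sum_congr rfl fun i _ => ?_
  have h1 : ∑ j ∈ Finset.range n, (inputOf A b (i * n + j) : ZMod q) * y j =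
      A.mulVec (fun j => y j) i := by
    rw [Finset.sum_range]
    refine Finset.sum_congr rfl fun j _ => ?_
    rw [inputOf_matrix, ZMod.natCast_val, ZMod.cast_id]
  rw [h1, inputOf_rhs, ZMod.natCast_val, ZMod.cast_id]
  by_cases h : A.mulVec (fun j => y j) i = b i <;> simp [h]

/-- If `y` is no worse than `s`, both codewords are within the weight of `e` of the same vector.
Their difference then has weight at most `4t`, and by `hA` it comes from zero. -/
theorem eq_of_violations_le {t : ℝ} {A : Matrix (Fin m) (Fin n) (ZMod q)} {e : Fin m → ZMod q}
    (he : (hammingNorm e : ℝ) ≤ 2 * t)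
    (hA : ¬ ∃ z, z ≠ 0 ∧ (hammingNorm (A.mulVec z) : ℝ) ≤ 4 * t) (s : Fin n → ZMod q)
    (y : ℕ → ZMod q)
    (hy : violations q n m (inputOf A (A.mulVec s + e)) y ≤
      violations q n m (inputOf A (A.mulVec s + e)) (extend s)) :
    ∀ j < n, y j = extend s j := by
  have hs : (fun j : Fin n => extend s j) = s := by
    funext j
    simp [extend]
  rw [violations_eq_hammingDist, violations_eq_hammingDist, hs] at hy
  have h1 : hammingDist (A.mulVec s) (A.mulVec s + e) = hammingNorm e := by
    rw [hammingDist_eq_hammingNorm, neg_add_cancel_left]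
  have h2 : hammingNorm (A.mulVec ((fun j : Fin n => y j) - s)) ≤ 2 * hammingNorm e := by
    rw [Matrix.mulVec_sub, sub_eq_neg_add, ← hammingDist_eq_hammingNorm, hammingDist_comm]
    have := hammingDist_triangle_right (A.mulVec fun j : Fin n => y j) (A.mulVec s)
      (A.mulVec s + e)
    omega
  have h3 : (hammingNorm (A.mulVec ((fun j : Fin n => y j) - s)) : ℝ) ≤ 2 * hammingNorm e := by
    exact_mod_cast h2
  have h4 : (fun j : Fin n => y j) - s = 0 := by
    by_contra h
    exact hA ⟨_, h, by linarith⟩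
  intro j hj
  rw [extend, dif_pos hj]
  exact congrFun (sub_eq_zero.mp h4) ⟨j, hj⟩

theorem runOn_spec {S N : ℕ} {η δ ε : ℝ} (hF : Fits q n m k ε S N) (hn : 0 < n) (hk : 0 < k)
    (hη : η ≤ 1) (hε : ε ≤ 1) (𝒮 : Solver q (k * n) m) (A : Matrix (Fin m) (Fin n) (ZMod q))
    (b : Fin m → ZMod q) :
    (∀ σ ∈ (runOn reduction k η δ ε 𝒮.toOracle A b).support,
      σ.time ≤ reduction.bound S N ∧ σ.queries = numTrials q n m k ε) ∧
    ∀ z : ℕ → ZMod q, (∀ y : ℕ → ZMod q,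
      violations q n m (inputOf A b) y ≤ violations q n m (inputOf A b) z → ∀ j < n, y j = z j) →
      (runOn reduction k η δ ε 𝒮.toOracle A b).toOuterMeasure
          {σ | ∀ j < n, (σ.mem j : ZMod q) = z j}ᶜ ≤
        (1 - hitProb q n m k (2 ^ prec q n m k) ⌊(2 : ℝ) ^ prec q n m k * η⌋₊
          (numCoins q n m k (2 ^ prec q n m k)) (inputOf A b) 𝒮.toOracle z) ^
            numTrials q n m k ε := by
  have hq := (Fact.out (p := q.Prime)).pos
  have hshift : ∀ i, (q :: n :: m :: k :: encode A b).getD (4 + i) 0 = inputOf A b i := fun i => by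
    rw [add_comm]
    rfl
  have hsz : 1 ≤ Nat.size q := Nat.size_pos.mpr hq
  have hp : 2 * m + k + n * Nat.size q < S := hF.precS
  have hS : ∀ x : ℕ, x < S → x < 2 ^ S := fun x hx => hx.trans Nat.lt_two_pow_self
  have hqS : q < 2 ^ S := (Nat.lt_size_self q).trans_le <| Nat.pow_le_pow_right two_pos <| by
    have := Nat.le_mul_of_pos_left (Nat.size q) hn
    omega
  have hnS : n < S := by
    have := Nat.le_mul_of_pos_right n hsz
    omega
  refine exec_reduction (r := ![η, δ, ε]) hF hq hn hk inputOf_lt (answers_toOracle 𝒮) (fun a => ?_)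
    rfl rfl rfl rfl (fun i _ => hshift i) (fun a ha => ?_) hη hε
  · match a with
    | 0 => exact hqS
    | 1 => exact hS n hnS
    | 2 => exact hS m (by omega)
    | 3 => exact hS k (by omega)
    | a + 4 => exact (inputOf_lt a).trans hqS
  · obtain ⟨i, rfl⟩ := Nat.exists_eq_add_of_le (show 4 ≤ a by omega)
    rw [hshift, inputOf, List.getD_eq_default]
    rw [length_encode]
    omega

theorem exists_fits (q n m k : ℕ) (ε : ℝ) : ∃ S N, Fits q n m k ε S N :=
  let G := 6 * segLen n m k + prec q n m k + 1 + numCoins q n m k (2 ^ prec q n m k) +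
    numTrials q n m k ε
  ⟨G, G, by omega, by omega, by omega, by omega, by omega, by omega, by omega, by omega⟩

theorem toSolver_apply (R : Prog) {η δ ε : ℝ} (𝒪 : Oracle) (A : Matrix (Fin m) (Fin n) (ZMod q))
    (b : Fin m → ZMod q) (s : Fin n → ZMod q) :
    R.toSolver k η δ ε 𝒪 A b s = (runOn R k η δ ε 𝒪 A b).toOuterMeasure
      {σ | ∀ j < n, (σ.mem j : ZMod q) = extend s j} := by
  rw [Prog.toSolver, ← PMF.toOuterMeasure_apply_singleton, PMF.toOuterMeasure_map_apply]
  congr 1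
  ext σ
  simp only [Set.mem_preimage, Set.mem_singleton_iff, Set.mem_ofPred_eq, funext_iff]
  refine ⟨fun h j hj => ?_, fun h j => ?_⟩
  · rw [extend, dif_pos hj]; exact h ⟨j, hj⟩
  · rw [h j j.2, extend, dif_pos j.2]

/-- The conditions under which an instance can be solved with the help of the oracle. -/
structure Solvable (η ε : ℝ) (𝒮 : Solver q (k * n) m) (A : Matrix (Fin m) (Fin n) (ZMod q))
    (e : Fin m → ZMod q) : Prop where
  planted : ε / 8 ≤ plantedProb η 𝒮 (A, e)
  noise : (hammingNorm e : ℝ) ≤ 2 * η * m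
  code : ¬ ∃ z, z ≠ 0 ∧ (hammingNorm (A.mulVec z) : ℝ) ≤ 4 * η * m

/-- At least `16k/ε` trials, each with success probability at least `ε/16`. -/
theorem le_toSolver_apply {η δ ε : ℝ} (hn : 0 < n) (hk : 0 < k) (hη0 : 0 < η)
    (hη1 : η ≤ 1) (hε0 : 0 < ε) (hε : ε ≤ 1) (hηm : 6 ≤ η * m) (hεq : 1 ≤ ε * (q : ℝ) ^ n)
    {𝒮 : Solver q (k * n) m} {A : Matrix (Fin m) (Fin n) (ZMod q)} {e : Fin m → ZMod q}
    (h : Solvable η ε 𝒮 A e) (s : Fin n → ZMod q) :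
    1 - Real.exp (-k) ≤
      (reduction.toSolver k η δ ε 𝒮.toOracle A (A.mulVec s + e) s).toReal := by
  obtain ⟨S, N, hF⟩ := exists_fits q n m k ε
  have hspec := (runOn_spec (δ := δ) hF hn hk hη1 hε 𝒮 A (A.mulVec s + e)).2 (extend s)
    (eq_of_violations_le (t := η * m) (by have := h.noise; linarith)
      (by have := h.code; simpa only [mul_assoc] using this) s)
  set p := prec q n m k with hp
  have hk1 : (1 : ℝ) ≤ k := by exact_mod_cast hk
  have hm1 : (1 : ℝ) ≤ m := by
    rcases Nat.eq_zero_or_pos m with rfl | h0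
    · norm_num at hηm
    · exact_mod_cast h0
  have h2 : ∀ a : ℕ, (a : ℝ) ≤ 2 ^ a := fun a => by exact_mod_cast Nat.lt_two_pow_self.le
  -- The summands `2m + k` of the precision are there for this: with `ηm ≥ 6` it gives `2^p η ≥
  -- 6mk`, so the rounding of `η` is harmless.
  have hPmk : (m : ℝ) * m * k ≤ 2 ^ p := by
    have hge : (2 : ℝ) ^ (m + m + k) ≤ 2 ^ p :=
      pow_le_pow_right₀ one_le_two (by rw [hp, prec]; omega)
    rw [pow_add, pow_add] at hge
    refine le_trans ?_ hge
    gcongr <;> exact h2 _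
  have hPη : 6 * ((m : ℝ) * k) ≤ 2 ^ p * η := by
    have h3 : (m : ℝ) * m * k * η ≤ 2 ^ p * η := mul_le_mul_of_nonneg_right hPmk hη0.le
    have h4 : 6 * ((m : ℝ) * k) ≤ η * m * (m * k) := by gcongr
    linarith
  have hmk : 1 ≤ (m : ℝ) * k := one_le_mul_of_one_le_of_one_le hm1 hk1
  have hPq : (q : ℝ) ^ n ≤ 2 ^ p := pow_le_two_pow_prec
  -- The summand `n * size q` of the precision makes `⌊2^p ε⌋` positive, so the division in the
  -- number of trials is not by zero.
  have hPε : 1 ≤ 2 ^ p * ε := by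
    have := mul_le_mul_of_nonneg_left hPq hε0.le
    linarith
  have hT : 16 * k / ε ≤ numTrials q n m k ε := by
    have hfl : (⌊(2 : ℝ) ^ p * ε⌋₊ : ℝ) ≤ 2 ^ p * ε := Nat.floor_le (by positivity)
    have hfl1 : 1 ≤ ⌊(2 : ℝ) ^ p * ε⌋₊ := Nat.le_floor (by simpa using hPε)
    have hd : (2 : ℕ) ^ p < ⌊(2 : ℝ) ^ p * ε⌋₊ * (2 ^ p / ⌊(2 : ℝ) ^ p * ε⌋₊ + 1) :=
      Nat.lt_mul_div_succ _ hfl1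
    have hd' : (2 : ℝ) ^ p < ⌊(2 : ℝ) ^ p * ε⌋₊ * ((2 ^ p / ⌊(2 : ℝ) ^ p * ε⌋₊ : ℕ) + 1) := by
      exact_mod_cast hd
    have h5 : (1 : ℝ) ≤ ε * ((2 ^ p / ⌊(2 : ℝ) ^ p * ε⌋₊ : ℕ) + 1) := by
      have hpos : (0 : ℝ) < 2 ^ p := by positivity
      have h6 : (⌊(2 : ℝ) ^ p * ε⌋₊ : ℝ) * ((2 ^ p / ⌊(2 : ℝ) ^ p * ε⌋₊ : ℕ) + 1) ≤
          2 ^ p * ε * ((2 ^ p / ⌊(2 : ℝ) ^ p * ε⌋₊ : ℕ) + 1) :=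
        mul_le_mul_of_nonneg_right hfl (by positivity)
      nlinarith
    rw [div_le_iff₀ hε0, numTrials]
    push_cast
    have : 16 * (k : ℝ) * 1 ≤ 16 * k * (ε * ((2 ^ p / ⌊(2 : ℝ) ^ p * ε⌋₊ : ℕ) + 1)) := by
      gcongr
    linarith
  have hcast : ((2 ^ p : ℕ) : ℝ) = (2 : ℝ) ^ p := by push_cast; rfl
  have hhit := plantedProb_le_hitProb (P := 2 ^ p) (L := numCoins q n m k (2 ^ p)) hk hη0 hη1
    (by rw [hcast]; linarith) (by rw [hcast]; linarith) (four_mul_le_two_pow_numCoins _) 𝒮 A s e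
  rw [hcast] at hhit
  have hhit' : ENNReal.ofReal (ε / 16) ≤ _ :=
    (ENNReal.ofReal_le_ofReal (by have := h.planted; linarith)).trans hhit
  have hfail : (runOn reduction k η δ ε 𝒮.toOracle A (A.mulVec s + e)).toOuterMeasure
      {σ | ∀ j < n, (σ.mem j : ZMod q) = extend s j}ᶜ ≤ ENNReal.ofReal (Real.exp (-k)) := by
    refine hspec.trans ?_
    calc _ ≤ (1 - ENNReal.ofReal (ε / 16)) ^ numTrials q n m k ε := by gcongr
      _ = ENNReal.ofReal ((1 - ε / 16) ^ numTrials q n m k ε) := by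
          rw [← ENNReal.ofReal_one, ← ENNReal.ofReal_sub _ (by positivity),
            ENNReal.ofReal_pow (by linarith)]
      _ ≤ _ := ENNReal.ofReal_le_ofReal ?_
    calc (1 - ε / 16) ^ numTrials q n m k ε ≤ Real.exp (-(ε / 16)) ^ numTrials q n m k ε :=
          pow_le_pow_left₀ (by linarith) (Real.one_sub_le_exp_neg _) _
      _ = Real.exp (numTrials q n m k ε * -(ε / 16)) := (Real.exp_nat_mul _ _).symm
      _ ≤ Real.exp (-k) := by
          rw [div_le_iff₀ hε0] at hT
          exact Real.exp_le_exp.mpr (by linarith)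
  rw [toSolver_apply]
  rw [toOuterMeasure_compl, tsub_le_iff_right] at hfail
  have hne : (runOn reduction k η δ ε 𝒮.toOracle A (A.mulVec s + e)).toOuterMeasure
      {σ | ∀ j < n, (σ.mem j : ZMod q) = extend s j} ≠ ⊤ := by
    rw [← toSolver_apply]
    exact PMF.apply_ne_top _ _
  have hreal := ENNReal.toReal_mono (ENNReal.add_ne_top.mpr ⟨ENNReal.ofReal_ne_top, hne⟩) hfail
  rw [ENNReal.toReal_add ENNReal.ofReal_ne_top hne, ENNReal.toReal_one,
    ENNReal.toReal_ofReal (Real.exp_pos _).le] at hreal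
  linarith

end Success


/-! ### Averaging over the instances -/

section Main

variable {q n m k : ℕ} [Fact q.Prime]

open scoped Classical in
theorem sum_planted_fail {η δ ε : ℝ} (hk : 0 < k) (hη0 : 0 ≤ η) (hη1 : η ≤ 1) (hδ : 0 < δ)
    (hε0 : 0 < ε) (hε1 : ε ≤ 1) (hkδ : 192 / δ * Real.log (8 / ε) < k)
    {𝒮 : Solver q (k * n) m} (hS : ε ≤ successProb q (k * n) m (1 - (1 - η) ^ k) 𝒮) :
    ∑ x : Instance q n m, instMass η x * (if plantedProb η 𝒮 x < ε / 8 then 1 else 0) ≤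
      δ / 2 := by
  have hk0 : (0 : ℝ) < k := by exact_mod_cast hk
  have : Nonempty (Fin k) := ⟨⟨0, hk⟩⟩
  refine le_trans (le_of_eq (Finset.sum_congr rfl fun x _ => mul_ite _ _ _ _)) ?_
  simp only [mul_one, mul_zero]
  refine sum_planted_small (ι := Fin k) (instMass η) (instMass_nonneg hη0 hη1) (sum_instMass η)
    (jointSuccess 𝒮) (jointSuccess_nonneg 𝒮) (jointSuccess_le_one 𝒮) hε0 hε1 hδ
    (by rwa [Fintype.card_fin]) (by rwa [sum_jointSuccess]) _ fun x hx => ?_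
  rw [plantedProb, one_div_mul_eq_div, div_lt_iff₀ hk0] at hx
  rw [Fintype.card_fin, mul_comm]
  exact hx.le

open scoped Classical in
theorem sum_noise_fail {η : ℝ} (hη0 : 0 ≤ η) (hη1 : η ≤ 1) :
    ∑ x : Instance q n m, instMass η x * (if 2 * η * m < hammingNorm x.2 then 1 else 0) ≤
      Real.exp (-(η * m / 3)) := by
  have hq : (q : ℝ) ≠ 0 := Nat.cast_ne_zero.mpr (Fact.out (p := q.Prime)).ne_zero
  refine le_trans (le_of_eq ?_) (sum_heavy_noise (q := q) hη0 hη1)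
  rw [Fintype.sum_prod_type]
  simp only [instMass, mul_assoc, ← Finset.mul_sum]
  rw [Finset.sum_const, Finset.card_univ, nsmul_eq_mul,
    Fintype.card_congr (Matrix.of (m := Fin m) (n := Fin n) (α := ZMod q)).symm]
  simp only [Fintype.card_fun, ZMod.card, Fintype.card_fin]
  push_cast
  rw [← pow_mul, mul_comm n m, ← mul_assoc, one_div_mul_cancel (by positivity), one_mul]
  simp only [mul_ite, mul_one, mul_zero]

open scoped Classical in
theorem sum_code_fail {η : ℝ} (hη0 : 0 < η) (hη1 : η < 1 / 8)
    (hm : 2 / (1 - entropy q (4 * η)) * (n : ℝ) < m) :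
    ∑ x : Instance q n m, instMass η x *
      (if ∃ z, z ≠ 0 ∧ (hammingNorm (x.1.mulVec z) : ℝ) ≤ 4 * η * m then 1 else 0) ≤
      1 / (q : ℝ) ^ n := by
  refine le_trans (le_of_eq ?_) (sum_light_codeword hη0 hη1 hm)
  rw [Fintype.sum_prod_type]
  refine Finset.sum_congr rfl fun A _ => ?_
  change ∑ e, instMass η (A, e) * (if ∃ z, z ≠ 0 ∧ (hammingNorm (A.mulVec z) : ℝ) ≤ 4 * η * m
    then (1 : ℝ) else 0) = _
  rw [← Finset.sum_mul]
  simp only [instMass, ← Finset.mul_sum, sum_prod_berMass, mul_one]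

/-- The budget is `δ/2` for instances with small planted success and `δ/384` each for heavy noise,
light codewords and failure of all trials. -/
theorem one_sub_le_successProb {η δ ε : ℝ} (hn : 0 < n) (hk : 0 < k) (hη0 : 0 < η)
    (hη1 : η < 1 / 8) (hδ0 : 0 < δ) (hδ1 : δ ≤ 1) (hε0 : 0 < ε) (hε1 : ε ≤ 1)
    (hm : 2 / (1 - entropy q (4 * η)) * (n : ℝ) < m) (hkδ : 192 / δ * Real.log (8 / ε) < k)
    (hkε : (k : ℝ) < ε / 8 * min ((q : ℝ) ^ n) (Real.exp (η * m / 3)))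
    {𝒮 : Solver q (k * n) m} (hS : ε ≤ successProb q (k * n) m (1 - (1 - η) ^ k) 𝒮) :
    1 - δ ≤ successProb q n m η (reduction.toSolver k η δ ε 𝒮.toOracle) := by
  classical
  have hk1 : (1 : ℝ) ≤ k := by exact_mod_cast hk
  have hq : (0 : ℝ) < q := by exact_mod_cast (Fact.out (p := q.Prime)).pos
  have hηle : η ≤ 1 := by linarith
  have hkq : (k : ℝ) < ε / 8 * (q : ℝ) ^ n :=
    hkε.trans_le (mul_le_mul_of_nonneg_left (min_le_left _ _) (by positivity))
  have hke : (k : ℝ) < ε / 8 * Real.exp (η * m / 3) :=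
    hkε.trans_le (mul_le_mul_of_nonneg_left (min_le_right _ _) (by positivity))
  have hlog : 2 ≤ Real.log (8 / ε) := by
    have h1 : Real.log (2 ^ 3) ≤ Real.log (8 / ε) :=
      Real.log_le_log (by norm_num) (by rw [le_div_iff₀ hε0]; linarith)
    rw [Real.log_pow] at h1
    have := Real.log_two_gt_d9
    push_cast at h1
    linarith
  -- As `k ≥ 1`, the upper bound on `k` gives `exp(ηm/3) > 8/ε`, and `log(8/ε) ≥ log 8 > 2`.
  have hηm : 6 ≤ η * m := by
    have h1 : 8 / ε < Real.exp (η * m / 3) := by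
      rw [div_lt_iff₀ hε0]
      linarith
    have := (Real.log_lt_iff_lt_exp (by positivity)).mpr h1
    linarith
  have hkδ' : 384 ≤ δ * k := by
    have h1 : 192 / δ * 2 ≤ 192 / δ * Real.log (8 / ε) := by gcongr
    have h2 : 192 / δ * 2 < k := h1.trans_lt hkδ
    rw [div_mul_eq_mul_div, div_lt_iff₀ hδ0] at h2
    linarith
  -- The quantities `exp(k)`, `exp(ηm/3)` and `q^n` are all at least `k`, and `k ≥ 384/δ`.
  have hinv : ∀ x : ℝ, k ≤ x → 1 / x ≤ δ / 384 := fun x hx => by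
    rw [div_le_div_iff₀ (by linarith) (by norm_num)]
    nlinarith
  have hf1 : Real.exp (-k) ≤ δ / 384 := by
    rw [Real.exp_neg, ← one_div]
    exact hinv _ (by have := Real.add_one_le_exp (k : ℝ); linarith)
  have hf2 : Real.exp (-(η * m / 3)) ≤ δ / 384 := by
    rw [Real.exp_neg, ← one_div]
    refine hinv _ (hke.le.trans (mul_le_of_le_one_left (Real.exp_pos _).le (by linarith)))
  have hf3 : 1 / (q : ℝ) ^ n ≤ δ / 384 :=
    hinv _ (hkq.le.trans (mul_le_of_le_one_left (by positivity) (by linarith)))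
  have s1 := sum_planted_fail hk hη0.le hηle hδ0 hε0 hε1 hkδ hS
  have s2 := sum_noise_fail (q := q) (n := n) (m := m) hη0.le hηle
  have s3 := sum_code_fail hη0 hη1 hm
  set B : Instance q n m → ℝ := fun x => if plantedProb η 𝒮 x < ε / 8 then 1 else 0 with hB
  set H : Instance q n m → ℝ := fun x => if 2 * η * m < hammingNorm x.2 then 1 else 0 with hH
  set C : Instance q n m → ℝ := fun x =>
    if ∃ z, z ≠ 0 ∧ (hammingNorm (x.1.mulVec z) : ℝ) ≤ 4 * η * m then 1 else 0 with hC
  have hB0 : ∀ x, 0 ≤ B x := fun x => by simp only [hB]; positivity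
  have hH0 : ∀ x, 0 ≤ H x := fun x => by simp only [hH]; positivity
  have hC0 : ∀ x, 0 ≤ C x := fun x => by simp only [hC]; positivity
  -- On a bad instance one of the indicators is `1` and the left side is negative.
  have hpt : ∀ (x : Instance q n m) (s : Fin n → ZMod q),
      1 - Real.exp (-k) - B x - H x - C x ≤
        (reduction.toSolver k η δ ε 𝒮.toOracle x.1 (x.1.mulVec s + x.2) s).toReal := by
    intro x s
    have hB' := hB0 x
    have hH' := hH0 x
    have hC' := hC0 x
    have he := Real.exp_pos (-(k : ℝ))
    by_cases h1 : plantedProb η 𝒮 x < ε / 8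
    · have : B x = 1 := if_pos h1
      exact le_trans (by linarith) ENNReal.toReal_nonneg
    by_cases h2 : 2 * η * m < hammingNorm x.2
    · have : H x = 1 := if_pos h2
      exact le_trans (by linarith) ENNReal.toReal_nonneg
    by_cases h3 : ∃ z, z ≠ 0 ∧ (hammingNorm (x.1.mulVec z) : ℝ) ≤ 4 * η * m
    · have : C x = 1 := if_pos h3
      exact le_trans (by linarith) ENNReal.toReal_nonneg
    refine le_trans (by linarith) (le_toSolver_apply hn hk hη0 hηle hε0 hε1 hηm (by linarith)
      ⟨not_lt.mp h1, not_lt.mp h2, h3⟩ s)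
  have hsum : ∑ x : Instance q n m, instMass η x * (1 - Real.exp (-k) - B x - H x - C x) =
      1 - Real.exp (-k) - ∑ x, instMass η x * B x - ∑ x, instMass η x * H x -
        ∑ x, instMass η x * C x := by
    simp only [mul_sub, Finset.sum_sub_distrib, ← Finset.sum_mul, sum_instMass, mul_one, one_mul]
  calc 1 - δ ≤ ∑ x : Instance q n m, instMass η x * (1 - Real.exp (-k) - B x - H x - C x) := by
        rw [hsum]
        linarith
    _ = ∑ s : Fin n → ZMod q, 1 / (q : ℝ) ^ n *
          ∑ x : Instance q n m, instMass η x * (1 - Real.exp (-k) - B x - H x - C x) := by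
        rw [Finset.sum_const, Finset.card_univ, nsmul_eq_mul, Fintype.card_fun, ZMod.card,
          Fintype.card_fin]
        push_cast
        field_simp
    _ ≤ ∑ s : Fin n → ZMod q, 1 / (q : ℝ) ^ n * ∑ x : Instance q n m, instMass η x *
          (reduction.toSolver k η δ ε 𝒮.toOracle x.1 (x.1.mulVec s + x.2) s).toReal := by
        gcongr with s _ x _
        · exact instMass_nonneg hη0.le hηle x
        · exact hpt x s
    _ = _ := by
        unfold successProb
        refine Finset.sum_congr rfl fun s _ => ?_
        rw [Fintype.sum_prod_type, Finset.mul_sum]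
        refine Finset.sum_congr rfl fun A _ => ?_
        rw [Finset.mul_sum]
        exact Finset.sum_congr rfl fun e _ => by simp only [instMass]; ring

end Main


/-! ### Polynomial bounds on time and oracle calls -/

section Resources

variable {q n m k : ℕ}

/-- `⌊2^p ε⌋ ≥ 1` is at least half of `2^p ε`, so the quotient is at most `2/ε`; the added `1` is at
most `1/ε`, and `16 · 3 = 48`. -/
theorem numTrials_le {ε : ℝ} (hε0 : 0 < ε) (hε1 : ε ≤ 1) (hεq : 1 ≤ ε * (q : ℝ) ^ n) :
    (numTrials q n m k ε : ℝ) ≤ 48 * (k * (1 / ε)) := by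
  set p := prec q n m k with hp
  have hPq : (q : ℝ) ^ n ≤ 2 ^ p := pow_le_two_pow_prec
  have hPε : 1 ≤ 2 ^ p * ε := by
    have := mul_le_mul_of_nonneg_left hPq hε0.le
    linarith
  have hfl1 : 1 ≤ ⌊(2 : ℝ) ^ p * ε⌋₊ := Nat.le_floor (by simpa using hPε)
  have hfl1' : (1 : ℝ) ≤ ⌊(2 : ℝ) ^ p * ε⌋₊ := by exact_mod_cast hfl1
  have hfl : (2 : ℝ) ^ p * ε < ⌊(2 : ℝ) ^ p * ε⌋₊ + 1 := Nat.lt_floor_add_one _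
  have hdiv : ((2 ^ p / ⌊(2 : ℝ) ^ p * ε⌋₊ : ℕ) : ℝ) ≤ 2 * (1 / ε) := by
    refine Nat.cast_div_le.trans ?_
    rw [mul_one_div, div_le_div_iff₀ (by linarith) hε0]
    push_cast
    linarith
  have h1 : 1 ≤ 1 / ε := by rwa [le_div_iff₀ hε0, one_mul]
  rw [numTrials]
  push_cast
  calc (16 : ℝ) * k * ((2 ^ p / ⌊(2 : ℝ) ^ p * ε⌋₊ : ℕ) + 1)
      ≤ 16 * k * (2 * (1 / ε) + 1 / ε) := by gcongr
    _ = _ := by ring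

/-- The fifth power comes from the coins: about `y^3` digits of about `y^2` bits each. -/
theorem fits_of_le {ε : ℝ} {y : ℕ} (hy : 1 ≤ y) (hn : n ≤ y) (hm : m ≤ y) (hk : k ≤ y)
    (hq : Nat.size q ≤ y) (hT : numTrials q n m k ε ≤ 48 * y ^ 2) :
    Fits q n m k ε (300 * y ^ 5) (300 * y ^ 5) := by
  have p1 : y ≤ y ^ 5 := by simpa using Nat.pow_le_pow_right hy (show 1 ≤ 5 by norm_num)
  have p2 : y ^ 2 ≤ y ^ 5 := Nat.pow_le_pow_right hy (by norm_num)
  have p3 : y ^ 3 ≤ y ^ 5 := Nat.pow_le_pow_right hy (by norm_num)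
  have q1 : y ≤ y ^ 2 := by simpa using Nat.pow_le_pow_right hy (show 1 ≤ 2 by norm_num)
  have q2 : y ^ 2 ≤ y ^ 3 := Nat.pow_le_pow_right hy (by norm_num)
  have mul2 : ∀ a b, a ≤ y → b ≤ y → a * b ≤ y ^ 2 := fun a b ha hb => by
    rw [pow_two]; exact Nat.mul_le_mul ha hb
  have hD : numDigits n m k ≤ 3 * y ^ 3 := by
    have h1 := mul2 m k hm hk
    have h2 := mul2 k n hk hn
    have h3 : m * (k * n) ≤ y ^ 3 := by
      rw [pow_succ']; exact Nat.mul_le_mul hm h2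
    rw [numDigits]
    omega
  have hseg : segLen n m k ≤ 38 * y ^ 3 := by
    have h1 := mul2 m n hm hn
    have h2 : 1 ≤ y ^ 3 := Nat.one_le_pow _ _ hy
    rw [segLen]
    omega
  have hprec : prec q n m k ≤ 4 * y ^ 2 := by
    have h1 := mul2 n _ hn hq
    rw [prec]
    omega
  have hcoins : numCoins q n m k (2 ^ prec q n m k) ≤ 21 * y ^ 5 := by
    have h1 : Nat.size (q * 2 ^ prec q n m k) ≤ 6 * y ^ 2 := by
      have h2 := size_mul_le q (2 ^ prec q n m k)
      rw [Nat.size_pow] at h2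
      have : 1 ≤ y ^ 2 := Nat.one_le_pow _ _ hy
      omega
    have h2 : numDigits n m k * Nat.size (q * 2 ^ prec q n m k) ≤ 3 * y ^ 3 * (6 * y ^ 2) :=
      Nat.mul_le_mul hD h1
    have h3 : 3 * y ^ 3 * (6 * y ^ 2) = 18 * y ^ 5 := by ring
    have h4 := size_le_self k
    have h5 : 1 ≤ y ^ 5 := Nat.one_le_pow _ _ hy
    rw [numCoins]
    omega
  have h5 : 1 ≤ y ^ 5 := Nat.one_le_pow _ _ hy
  constructor <;> omega

theorem exists_resources_le : ∃ C : ℕ, ∀ (q n m k : ℕ) (δ ε : ℝ), 0 < n → 0 < δ → 0 < ε → ε ≤ 1 →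
    1 ≤ ε * (q : ℝ) ^ n → ∃ S N, Fits q n m k ε S N ∧
      (reduction.bound S N : ℝ) ≤ C * ((n : ℝ) + k + 1 / δ + 1 / ε + m + Nat.size q) ^ C ∧
      (numTrials q n m k ε : ℝ) ≤ C * ((n : ℝ) + k + 1 / δ + 1 / ε) ^ C := by
  obtain ⟨C, hC⟩ := reduction.exists_bound_le
  -- Coefficient and exponent at once: `601 · (2Y)^5 = 19232 Y^5`, where `601` collects `S + N + 1`
  -- and the `2` comes from rounding `1/ε` up.
  refine ⟨C * 19232 ^ C + 5 * C + 48, fun q n m k δ ε hn hδ hε0 hε1 hεq => ?_⟩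
  have hT := numTrials_le (m := m) (k := k) hε0 hε1 hεq
  have hn1 : (1 : ℝ) ≤ n := by exact_mod_cast hn
  have hδ' : 0 < 1 / δ := by positivity
  have hε' : 1 ≤ 1 / ε := by rwa [le_div_iff₀ hε0, one_mul]
  set Z : ℝ := (n : ℝ) + k + 1 / δ + 1 / ε with hZ
  have hk0 : (0 : ℝ) ≤ k := Nat.cast_nonneg k
  have hm0 : (0 : ℝ) ≤ m := Nat.cast_nonneg m
  have hq0 : (0 : ℝ) ≤ Nat.size q := Nat.cast_nonneg _
  have hZ1 : 1 ≤ Z := by linarith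
  set Y : ℝ := Z + m + Nat.size q with hY
  have hY1 : 1 ≤ Y := by linarith
  set y : ℕ := n + k + ⌈1 / ε⌉₊ + m + Nat.size q with hy
  have hc : (⌈1 / ε⌉₊ : ℝ) < 1 / ε + 1 := Nat.ceil_lt_add_one (by linarith)
  have hyY : (y : ℝ) ≤ 2 * Y := by
    rw [hy]
    push_cast
    linarith
  have hFits : Fits q n m k ε (300 * y ^ 5) (300 * y ^ 5) := by
    refine fits_of_le (by omega) (by omega) (by omega) (by omega) (by omega) ?_
    have h1 : (numTrials q n m k ε : ℝ) ≤ 48 * (k * ⌈1 / ε⌉₊ : ℕ) := by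
      refine hT.trans ?_
      push_cast
      gcongr
      exact Nat.le_ceil _
    have h2 : numTrials q n m k ε ≤ 48 * (k * ⌈1 / ε⌉₊) := by exact_mod_cast h1
    refine h2.trans (Nat.mul_le_mul_left _ ?_)
    rw [pow_two]
    exact Nat.mul_le_mul (by omega) (by omega)
  refine ⟨_, _, hFits, ?_, ?_⟩
  · have h1 : 300 * y ^ 5 + 300 * y ^ 5 + 1 ≤ 601 * y ^ 5 := by
      have : 1 ≤ y ^ 5 := Nat.one_le_pow _ _ (by omega)
      omega
    have h2 : reduction.bound (300 * y ^ 5) (300 * y ^ 5) ≤ C * (601 * y ^ 5) ^ C :=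
      (hC _ _).trans (Nat.mul_le_mul_left _ (Nat.pow_le_pow_left h1 _))
    calc (reduction.bound (300 * y ^ 5) (300 * y ^ 5) : ℝ)
        ≤ C * (601 * (y : ℝ) ^ 5) ^ C := by exact_mod_cast h2
      _ ≤ C * (601 * (2 * Y) ^ 5) ^ C := by gcongr
      _ = C * 19232 ^ C * Y ^ (5 * C) := by
          rw [show 601 * (2 * Y) ^ 5 = 19232 * Y ^ 5 by ring, mul_pow, ← pow_mul]
          ring
      _ ≤ _ := by
          push_cast
          gcongr
          · linarith [(Nat.cast_nonneg C : (0 : ℝ) ≤ C)]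
          · omega
  · calc (numTrials q n m k ε : ℝ) ≤ 48 * (k * (1 / ε)) := hT
      _ ≤ 48 * Z ^ 2 := by
          rw [pow_two]
          gcongr <;> linarith
      _ ≤ _ := by
          gcongr
          · push_cast
            have : (0 : ℝ) ≤ C * 19232 ^ C + 5 * C := by positivity
            linarith
          · omega

end Resources

end LPN

/-! ### The theorem -/

theorem mainTheorem1 :
    ∃ (P : LPN.Prog) (C : ℕ),
      ∀ (q n m k : ℕ) [Fact q.Prime] (η δ ε : ℝ),
        0 < n → 0 < m → 0 < k →
        0 < η → η < 1 / 8 →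
        0 < δ → δ ≤ 1 →
        0 < ε → ε ≤ 1 →
        2 / (1 - LPN.entropy q (4 * η)) * (n : ℝ) < (m : ℝ) →
        192 / δ * Real.log (8 / ε) < (k : ℝ) →
        (k : ℝ) < ε / 8 * min ((q : ℝ) ^ n) (Real.exp (η * m / 3)) →
        ∀ 𝒮 : LPN.Solver q (k * n) m,
          (ε ≤ LPN.successProb q (k * n) m (1 - (1 - η) ^ k) 𝒮 →
            1 - δ ≤ LPN.successProb q n m η (P.toSolver k η δ ε 𝒮.toOracle)) ∧
          ∀ (A : Matrix (Fin m) (Fin n) (ZMod q)) (b : Fin m → ZMod q),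
            ∀ σ ∈ (LPN.runOn P k η δ ε 𝒮.toOracle A b).support,
              (σ.time : ℝ) ≤
                C * ((n : ℝ) + k + 1 / δ + 1 / ε + m + Nat.size q) ^ C ∧
              (σ.queries : ℝ) ≤ C * ((n : ℝ) + k + 1 / δ + 1 / ε) ^ C := by
  obtain ⟨C, hC⟩ := LPN.exists_resources_le
  refine ⟨LPN.reduction, C, fun q n m k _ η δ ε hn _ hk hη0 hη1 hδ0 hδ1 hε0 hε1 hm hkδ hkε 𝒮 =>
    ⟨LPN.one_sub_le_successProb hn hk hη0 hη1 hδ0 hδ1 hε0 hε1 hm hkδ hkε, fun A b σ hσ => ?_⟩⟩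
  -- The resource bounds need this lower bound but no assumption on the oracle's success, so they
  -- hold for every solver and every input.
  have hεq : 1 ≤ ε * (q : ℝ) ^ n := by
    have h1 : (k : ℝ) < ε / 8 * (q : ℝ) ^ n :=
      hkε.trans_le (mul_le_mul_of_nonneg_left (min_le_left _ _) (by positivity))
    have h2 : (1 : ℝ) ≤ k := by exact_mod_cast hk
    linarith
  obtain ⟨S, N, hF, hS, hN⟩ := hC q n m k δ ε hn hδ0 hε0 hε1 hεq
  obtain ⟨ht, hq⟩ := (LPN.runOn_spec hF hn hk (by linarith) hε1 𝒮 A b).1 σ hσ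
  rw [hq]
  exact ⟨le_trans (by exact_mod_cast ht) hS, hN⟩
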